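/- **Setting.** Let $n,d\in\mathbb N$, let $W=W(\mathbf u,F)$ be a $\mathcal C^\infty$ real-valued function of $\mathbf u=(u_\alpha)\in\mathbb R^n$ and $F=(u_{\alpha,j})\in\mathbb R^{n\times d}$, and assume (summation over repeated indices is understood) * (H1) $\partial_{u_\alpha}W(\mathbf u,0)=0$ for all $\mathbf u,\alpha$; * (H2) $\partial_{u_\alpha}\partial_{u_{\beta,j}}W(\mathbf u,0)=0$ for all $\mathbf u,\alpha,\beta,j$; * (H3) $v_\alpha\xi_j v_\beta\xi_\ell\,\partial_{u_{\alpha,j}}\partial_{u_{\beta,\ell}}W(\mathbf u,0)>0$ for all $\mathbf u\in\mathbb R^n$, $\mathbf v\in\mathbb R^n\setminus\{0\}$, $\boldsymbol\xi\in\mathbb R^d\setminus\{0\}$. Let $\boldsymbol\nu\in\mathbb R^d$ be a unit vector (the inward normal to the half-space $\Omega=\{\boldsymbol\nu\cdot\mathbf x>0\}$), and let $\underline{\mathbf u}\in\mathbb R^n$ satisfy $\nu_j\,\partial_{u_{\alpha,j}}W(\underline{\mathbf u},0)=0$ for all $\alpha$. Put $$c_{\alpha j\beta\ell}=\partial_{u_{\alpha,j}}\partial_{u_{\beta,\ell}}W(\underline{\mathbf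 u},0),\quad e_{\alpha\beta j\gamma\ell}=\partial_{u_\alpha}\partial_{u_{\beta,j}}\partial_{u_{\gamma,\ell}}W(\underline{\mathbf u},0),\quad d_{\alpha j\beta\ell\gamma m}=\partial_{u_{\alpha,j}}\partial_{u_{\beta,\ell}}\partial_{u_{\gamma,m}}W(\underline{\mathbf u},0).$$ For $\tau\in\mathbb R$, $\boldsymbol\eta\in\mathbb R^d$, and with $\partial^{(j)}:=\nu_j\partial_z+\eta_j\partial_y$, consider the problem for $\mathbf v(y,z)\in\mathbb C^n$, $y\in\mathbb R$, $z\ge 0$, $$\tau^2\partial_y^2v_\alpha-c_{\alpha j\beta\ell}\,\partial^{(j)}\partial^{(\ell)}v_\beta=0\ (z>0),\qquad \nu_jc_{\alpha j\beta\ell}\,\partial^{(\ell)}v_\beta=0\ (z=0).\tag{P1}$$ Assume (H4): $\tau\neq0$; $\boldsymbol\eta\cdot\boldsymbol\nu=0$; the interior equation in (P1) has no solution $e^{iy}e^{i\xi z}\underline{\mathbf V}$ with $\xi\in\mathbb R$, $\underline{\mathbf V}\ne0$; and the space of solutions of (P1) of the form $e^{iy}\mathbf V(z)$ with $\mathbf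 V\in L^2(\mathbb R^+)$ is one-dimensional. Fix such a $\mathbf V\neq0$, and put, for $z>0$, $\widehat{\mathbf r}(k,z)=\mathbf V(kz)$ if $k>0$, $\widehat{\mathbf r}(k,z)=\overline{\mathbf V(-kz)}$ if $k<0$, and $$c=\tau\int_0^\infty|\widehat{\mathbf r}(1,\zeta)|^2\,d\zeta .$$ With $\rho_\alpha(\xi)=\widehat r_\alpha(\xi,z)$ and $G_{\alpha j}(\xi)=\nu_j\,\partial_z\widehat r_\alpha(\xi,z)+i\xi\eta_j\,\widehat r_\alpha(\xi,z)$, let, for $\xi_1\xi_2\xi_3\ne0$, $b=b_1+b_2$ where $$4\pi b_2(\xi_1,\xi_2,\xi_3)=\int_0^\infty d_{\alpha j\beta\ell\gamma m}\,G_{\alpha j}(\xi_1)G_{\beta\ell}(\xi_2)G_{\gamma m}(\xi_3)\,dz,$$ $$4\pi b_1(\xi_1,\xi_2,\xi_3)=\int_0^\infty\! e_{\alpha\beta j\gamma\ell}\,\rho_\alpha(\xi_1)G_{\beta j}(\xi_2)G_{\gamma\ell}(\xi_3)\,dz+\int_0^\infty\! e_{\beta\alpha j\gamma\ell}\,G_{\alpha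 j}(\xi_1)\rho_\beta(\xi_2)G_{\gamma\ell}(\xi_3)\,dz+\int_0^\infty\! e_{\gamma\alpha j\beta\ell}\,G_{\alpha j}(\xi_1)G_{\beta\ell}(\xi_2)\rho_\gamma(\xi_3)\,dz .$$ With $\widehat w(k)=\int_{\mathbb R} w(y)e^{-iky}\,dy$, let $\mathcal H$ be the Hilbert transform, $\widehat{\mathcal H v}(k)=-i\,\mathrm{sgn}(k)\,\widehat v(k)$, let $$\widehat{\mathcal B[w]}(k)=\frac1c\int_{\mathbb R}b(-k,k-m,m)\,\widehat w(k-m)\,\widehat w(m)\,dm ,$$ and let $|\partial_y|^{1/2}$ be the Fourier multiplier with symbol $|k|^{1/2}$, acting on $L^2(\mathbb R;\mathbb R)$. For $\sigma\in\mathbb R$ let $X_\sigma=\{w\in L^2(\mathbb R;\mathbb R):\ |\partial_y|^{1/2}w\in H^\sigma(\mathbb R)\}$ be the inverse image of $H^\sigma(\mathbb R)$ under $|\partial_y|^{1/2}$, with the norm $\|w\|_{X_\sigma}=\|w\|_{L^2}+\||\partial_y|^{1/2}w\|_{H^\sigma}$. **Statement.** For every $\sigma>2$, the amplitude equation $$w_s+\mathcal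 H(\mathcal B[w])=0$$ is locally well-posed in $X_\sigma$. That is, calling $w\in\mathcal C([0,T];X_\sigma)$ a solution on $[0,T]$ if it is differentiable in $s$ with values in $L^2$, the integral defining $\widehat{\mathcal B[w(s)]}(k)$ converges absolutely for a.e. $k$ and defines a function $\mathcal B[w(s)]\in L^2(\mathbb R;\mathbb R)$, and the equation holds in $L^2$, for every $s\in[0,T]$: 1. for all $T>0$, two solutions on $[0,T]$ with the same value at $s=0$ are equal; 2. for all $R>0$ there is $T>0$ such that for every $w_0\in X_\sigma$ with $\|w_0\|_{X_\sigma}\le R$ there is a solution $w$ on $[0,T]$ with $w(0)=w_0$, and the map $w_0\mapsto w$ is continuous from $\{w_0\in X_\sigma:\|w_0\|_{X_\sigma}\le R\}$ to $\mathcal C([0,T];X_\sigma)$. -/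

import Mathlib

open Set Filter Topology MeasureTheory
open scoped ContDiff FourierTransform

noncomputable section

namespace SurfaceWave

/-! ## The energy density and its derivatives

`W (u, F)` is the energy density, `u` standing for the state and `F α j` for `u_{α,j}`. -/

/-- The space of pairs `(u, ∇u)`. -/
abbrev Jet (n d : ℕ) : Type := (Fin n → ℝ) × (Fin n → Fin d → ℝ)

/-- `∂f/∂u_α`. -/
def dU {n d : ℕ} (α : Fin n) (f : Jet n d → ℝ) : Jet n d → ℝ :=
  fun p => fderiv ℝ f p (Pi.single α 1, 0)

/-- `∂f/∂u_{α,j}`. -/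
def dF {n d : ℕ} (α : Fin n) (j : Fin d) (f : Jet n d → ℝ) : Jet n d → ℝ :=
  fun p => fderiv ℝ f p (0, Pi.single α (Pi.single j 1))

/-- (H1): `∂W/∂u_α (u, 0) = 0` for all `u`. -/
def H1 {n d : ℕ} (W : Jet n d → ℝ) : Prop :=
  ∀ (u : Fin n → ℝ) (α : Fin n), dU α W (u, 0) = 0

/-- (H2): `∂²W/∂u_α∂u_{β,j} (u, 0) = 0` for all `u`. -/
def H2 {n d : ℕ} (W : Jet n d → ℝ) : Prop :=
  ∀ (u : Fin n → ℝ) (α β : Fin n) (j : Fin d), dU α (dF β j W) (u, 0) = 0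

/-- (H3): strict rank-one convexity at all `(u, 0)`. -/
def H3 {n d : ℕ} (W : Jet n d → ℝ) : Prop :=
  ∀ (u v : Fin n → ℝ) (ξ : Fin d → ℝ), v ≠ 0 → ξ ≠ 0 →
    0 < ∑ α, ∑ j, ∑ β, ∑ l, v α * ξ j * v β * ξ l * dF α j (dF β l W) (u, 0)

/-- `N[u₀] = 0`: the constant state `u₀` satisfies the natural boundary condition
`ν_j ∂W/∂u_{α,j} (u₀, 0) = 0`. -/
def NaturalBC {n d : ℕ} (W : Jet n d → ℝ) (ν : EuclideanSpace ℝ (Fin d))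
    (u₀ : Fin n → ℝ) : Prop :=
  ∀ α, ∑ j, ν j * dF α j W (u₀, 0) = 0

/-- `c_{αjβℓ}`. -/
def coefC {n d : ℕ} (W : Jet n d → ℝ) (u₀ : Fin n → ℝ)
    (α : Fin n) (j : Fin d) (β : Fin n) (l : Fin d) : ℝ :=
  dF α j (dF β l W) (u₀, 0)

/-- `e_{αβjγℓ}`. -/
def coefE {n d : ℕ} (W : Jet n d → ℝ) (u₀ : Fin n → ℝ)
    (α β : Fin n) (j : Fin d) (γ : Fin n) (l : Fin d) : ℝ :=
  dU α (dF β j (dF γ l W)) (u₀, 0)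

/-- `d_{αjβℓγm}`. -/
def coefD {n d : ℕ} (W : Jet n d → ℝ) (u₀ : Fin n → ℝ)
    (α : Fin n) (j : Fin d) (β : Fin n) (l : Fin d) (γ : Fin n) (m : Fin d) : ℝ :=
  dF α j (dF β l (dF γ m W)) (u₀, 0)

/-! ## Linear surface waves `v(y,z) = e^{iy} V(z)`, `z ≥ 0` -/

/-- The action of `ν_j ∂_z + η_j ∂_y` on `e^{iy} V(z)`: the profile `ν_j V' + i η_j V` on `[0, ∞)`
(the derivative at `0` is one-sided). -/
def tangD {n d : ℕ} (ν η : EuclideanSpace ℝ (Fin d)) (j : Fin d) (V : ℝ → Fin n → ℂ) :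
    ℝ → Fin n → ℂ :=
  fun z α => (ν j : ℂ) * derivWithin V (Ici 0) z α + Complex.I * (η j : ℂ) * V z α

/-- `τ² v_yy + P^η v = 0` for `z > 0`, where `v = e^{iy} V(z)` and
`(P^η v)_α = - c_{αjβℓ} (ν_j ∂_z + η_j ∂_y)(ν_ℓ ∂_z + η_ℓ ∂_y) v_β`. -/
def InteriorEq {n d : ℕ} (W : Jet n d → ℝ) (u₀ : Fin n → ℝ) (ν η : EuclideanSpace ℝ (Fin d))
    (τ : ℝ) (V : ℝ → Fin n → ℂ) : Prop :=
  ∀ z : ℝ, 0 < z → ∀ α, -((τ : ℂ) ^ 2 * V z α) -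
    ∑ j, ∑ β, ∑ l, (coefC W u₀ α j β l : ℂ) * tangD ν η j (tangD ν η l V) z β = 0

/-- `B^η v = 0` at `z = 0`, where `v = e^{iy} V(z)` and
`(B^η v)_α = ν_j c_{αjβℓ} (ν_ℓ ∂_z + η_ℓ ∂_y) v_β`. -/
def BoundaryEq {n d : ℕ} (W : Jet n d → ℝ) (u₀ : Fin n → ℝ) (ν η : EuclideanSpace ℝ (Fin d))
    (V : ℝ → Fin n → ℂ) : Prop :=
  ∀ α, ∑ j, ∑ β, ∑ l, (ν j : ℂ) * (coefC W u₀ α j β l : ℂ) * tangD ν η l V 0 β = 0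

/-- `e^{iy} V(z)` is a solution of the linearized problem (P1) with `V ∈ L²(ℝ⁺)`. -/
structure IsSurfaceWave {n d : ℕ} (W : Jet n d → ℝ) (u₀ : Fin n → ℝ)
    (ν η : EuclideanSpace ℝ (Fin d)) (τ : ℝ) (V : ℝ → Fin n → ℂ) : Prop where
  contDiffOn : ContDiffOn ℝ 2 V (Ici 0)
  memLp : MemLp V 2 (volume.restrict (Ioi 0))
  interior : InteriorEq W u₀ ν η τ V
  boundary : BoundaryEq W u₀ ν η V

/-- `V` is not the zero profile on `[0, ∞)`. -/
def Nontriv {n : ℕ} (V : ℝ → Fin n → ℂ) : Prop := ∃ z : ℝ, 0 ≤ z ∧ V z ≠ 0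

/-- (H4): `τ ≠ 0`, `η` is cotangent to the boundary, there are no normal modes
`e^{iy} e^{iξz} V₀` with `ξ` real and `V₀ ≠ 0`, and the space of linear surface waves
(as functions on `[0, ∞)`) is one-dimensional. -/
structure H4 {n d : ℕ} (W : Jet n d → ℝ) (u₀ : Fin n → ℝ)
    (ν η : EuclideanSpace ℝ (Fin d)) (τ : ℝ) : Prop where
  tau_ne : τ ≠ 0
  cotangent : inner ℝ ν η = 0
  noNormalMode : ∀ (ξ : ℝ) (V₀ : Fin n → ℂ), V₀ ≠ 0 →
    ¬ InteriorEq W u₀ ν η τ (fun z => Complex.exp (Complex.I * ξ * z) • V₀)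
  oneDim : ∃ V₁ : ℝ → Fin n → ℂ, IsSurfaceWave W u₀ ν η τ V₁ ∧ Nontriv V₁ ∧
    ∀ V, IsSurfaceWave W u₀ ν η τ V → ∃ a : ℂ, ∀ z : ℝ, 0 ≤ z → V z = a • V₁ z

/-! ## The coefficient and the kernel of the amplitude equation -/

/-- `r̂(k,z) = V(kz)` for `k > 0`, and `conj V(-kz)` for `k < 0` (the value at `k = 0` is
irrelevant). -/
def rHat {n : ℕ} (V : ℝ → Fin n → ℂ) (k z : ℝ) (α : Fin n) : ℂ :=
  if 0 < k then V (k * z) α else starRingEnd ℂ (V (-k * z) α)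

/-- `c = τ ∫₀^∞ |r̂(1,ζ)|² dζ`. -/
def coefc {n : ℕ} (τ : ℝ) (V : ℝ → Fin n → ℂ) : ℝ :=
  τ * ∫ ζ in Ioi (0 : ℝ), ∑ α, ‖rHat V 1 ζ α‖ ^ 2

/-- `ν_j ∂_z r̂_α(ξ,z) + i ξ η_j r̂_α(ξ,z)`. -/
def gradR {n d : ℕ} (ν η : EuclideanSpace ℝ (Fin d)) (V : ℝ → Fin n → ℂ)
    (ξ : ℝ) (j : Fin d) (z : ℝ) (α : Fin n) : ℂ :=
  (ν j : ℂ) * deriv (fun z' => rHat V ξ z' α) z + Complex.I * ξ * (η j : ℂ) * rHat V ξ z α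

/-- The kernel `b₁`, each of the three integrands being written in factored form. -/
def kernelB1 {n d : ℕ} (W : Jet n d → ℝ) (u₀ : Fin n → ℝ) (ν η : EuclideanSpace ℝ (Fin d))
    (V : ℝ → Fin n → ℂ) (ξ₁ ξ₂ ξ₃ : ℝ) : ℂ :=
  (4 * Real.pi : ℂ)⁻¹ *
    ((∫ z in Ioi (0 : ℝ), ∑ α, ∑ β, ∑ j, ∑ γ, ∑ l, (coefE W u₀ α β j γ l : ℂ) *
        (rHat V ξ₁ z α * gradR ν η V ξ₂ j z β * gradR ν η V ξ₃ l z γ)) +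
     (∫ z in Ioi (0 : ℝ), ∑ α, ∑ β, ∑ j, ∑ γ, ∑ l, (coefE W u₀ β α j γ l : ℂ) *
        (gradR ν η V ξ₁ j z α * rHat V ξ₂ z β * gradR ν η V ξ₃ l z γ)) +
     (∫ z in Ioi (0 : ℝ), ∑ α, ∑ β, ∑ j, ∑ γ, ∑ l, (coefE W u₀ γ α j β l : ℂ) *
        (gradR ν η V ξ₁ j z α * gradR ν η V ξ₂ l z β * rHat V ξ₃ z γ)))

/-- The kernel `b₂`. -/
def kernelB2 {n d : ℕ} (W : Jet n d → ℝ) (u₀ : Fin n → ℝ) (ν η : EuclideanSpace ℝ (Fin d))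
    (V : ℝ → Fin n → ℂ) (ξ₁ ξ₂ ξ₃ : ℝ) : ℂ :=
  (4 * Real.pi : ℂ)⁻¹ *
    ∫ z in Ioi (0 : ℝ), ∑ α, ∑ j, ∑ β, ∑ l, ∑ γ, ∑ m, (coefD W u₀ α j β l γ m : ℂ) *
      (gradR ν η V ξ₁ j z α * gradR ν η V ξ₂ l z β * gradR ν η V ξ₃ m z γ)

/-- The kernel `b = b₁ + b₂`. -/
def kernelB {n d : ℕ} (W : Jet n d → ℝ) (u₀ : Fin n → ℝ) (ν η : EuclideanSpace ℝ (Fin d))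
    (V : ℝ → Fin n → ℂ) (ξ₁ ξ₂ ξ₃ : ℝ) : ℂ :=
  kernelB1 W u₀ ν η V ξ₁ ξ₂ ξ₃ + kernelB2 W u₀ ν η V ξ₁ ξ₂ ξ₃

/-! ## The amplitude equation -/

/-- Real-valued square integrable functions on the line. -/
abbrev L2R : Type := Lp ℝ 2 (volume : Measure ℝ)

/-- The Fourier transform `ŵ(k) = ∫ w(y) e^{-iky} dy`, extended to `L²`; Mathlib's transform uses
the character `e^{-2πiky}`. -/
def hat (w : L2R) (k : ℝ) : ℂ :=
  (𝓕 (Complex.ofRealCLM.compLpL 2 volume w : Lp ℂ 2 (volume : Measure ℝ)) :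
    Lp ℂ 2 (volume : Measure ℝ)) (k / (2 * Real.pi))

/-- `h` is the Hilbert transform of `v`: `ĥ(k) = -i sgn(k) v̂(k)`. -/
def IsHilbertTransform (v h : L2R) : Prop :=
  ∀ᵐ k : ℝ, hat h k = -Complex.I * (SignType.sign k : ℝ) * hat v k

/-- `g = 𝓑[w]`: `ĝ(k) = c⁻¹ ∫ b(-k,k-m,m) ŵ(k-m) ŵ(m) dm`, with an absolutely convergent
integral. -/
def IsAmplitudeB (b : ℝ → ℝ → ℝ → ℂ) (c : ℝ) (w g : L2R) : Prop :=
  ∀ᵐ k : ℝ, Integrable (fun m : ℝ => b (-k) (k - m) m * hat w (k - m) * hat w m) ∧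
    hat g k = (c : ℂ)⁻¹ * ∫ m : ℝ, b (-k) (k - m) m * hat w (k - m) * hat w m

/-- `(∫ (1+k²)^σ |f(k)|² dk)^{1/2}`: the `H^σ` norm of a function in terms of its Fourier
transform `f`. -/
def sobolevNorm (σ : ℝ) (f : ℝ → ℂ) : ENNReal :=
  (∫⁻ k : ℝ, ENNReal.ofReal ((1 + k ^ 2) ^ σ) * ‖f k‖ₑ ^ 2) ^ (1 / 2 : ℝ)

/-- The Fourier transform `|k|^{1/2} ŵ(k)` of `|∂_y|^{1/2} w`. -/
def halfDerivHat (w : L2R) (k : ℝ) : ℂ := (Real.sqrt |k| : ℂ) * hat w k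

/-- The inverse image of `H^σ(ℝ)` under `|∂_y|^{1/2}`, inside `L²(ℝ;ℝ)`. -/
def invImage (σ : ℝ) : Set L2R := {w | sobolevNorm σ (halfDerivHat w) < ⊤}

/-- The graph norm `‖w‖_{L²} + ‖|∂_y|^{1/2} w‖_{H^σ}` on this inverse image. -/
def invNorm (σ : ℝ) (w : L2R) : ENNReal := ‖w‖ₑ + sobolevNorm σ (halfDerivHat w)

/-- `w ∈ C([0,T]; X_σ)` solves `w_s + 𝓗(𝓑[w]) = 0` on `[0,T]`, `X_σ` being the inverse image of
`H^σ` with its graph norm; the time derivative is taken in `L²`, and is one-sided at the ends. -/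
structure IsSolution (b : ℝ → ℝ → ℝ → ℂ) (c σ T : ℝ) (w : ℝ → L2R) : Prop where
  mem : ∀ s ∈ Icc 0 T, w s ∈ invImage σ
  cont : ∀ s ∈ Icc 0 T, Tendsto (fun s' => invNorm σ (w s' - w s)) (𝓝[Icc 0 T] s) (𝓝 0)
  eqn : ∀ s ∈ Icc 0 T, ∃ g h : L2R, IsAmplitudeB b c (w s) g ∧ IsHilbertTransform g h ∧
    HasDerivWithinAt w (-h) (Icc 0 T) s

/-- Local well-posedness (in the sense of Hadamard) of the Cauchy problem for
`w_s + 𝓗(𝓑[w]) = 0` in `X_σ`: solutions with the same initial datum coincide, and, for every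
bounded set of initial data, there is a common existence time `T > 0` such that the solution
in `C([0,T]; X_σ)` exists and depends continuously on the datum. -/
structure LocallyWellPosed (b : ℝ → ℝ → ℝ → ℂ) (c σ : ℝ) : Prop where
  unique : ∀ T > 0, ∀ w₁ w₂ : ℝ → L2R, IsSolution b c σ T w₁ → IsSolution b c σ T w₂ →
    w₁ 0 = w₂ 0 → EqOn w₁ w₂ (Icc 0 T)
  exist : ∀ R > 0, ∃ T > 0,
    (∀ w₀ ∈ invImage σ, invNorm σ w₀ ≤ ENNReal.ofReal R →
      ∃ w : ℝ → L2R, IsSolution b c σ T w ∧ w 0 = w₀) ∧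
    (∀ w : ℝ → L2R, IsSolution b c σ T w → invNorm σ (w 0) ≤ ENNReal.ofReal R →
      ∀ ε : ENNReal, 0 < ε → ∃ δ : ENNReal, 0 < δ ∧
        ∀ w' : ℝ → L2R, IsSolution b c σ T w' → invNorm σ (w' 0) ≤ ENNReal.ofReal R →
          invNorm σ (w' 0 - w 0) < δ → ∀ s ∈ Icc 0 T, invNorm σ (w' s - w s) < ε)

end SurfaceWave

end

noncomputable section

namespace SurfaceWave

open scoped ComplexConjugate ENNReal

/-! In Fourier variables the equation reads `ŵ_s(k) = i sgn(k) c⁻¹ ∫ b(-k, k-m, m) ŵ(k-m) ŵ(m) dm`,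
an integral over triples of frequencies with sum zero. Three properties of the kernel suffice
(`AdmissibleKernel`): it is symmetric, it is Hermitian, and `|b(x,y,z)| ≤ C |x| (1 + |z|)` when `z`
is the smallest frequency. The factor `|x|` is the loss of one derivative, and two cancellations
absorb it.

Weighted energies: the derivative of `∫ θ |ŵ|²` is a trilinear integral which, symmetrised over the
three frequencies, has the symbol `(sgn x θ(x) + sgn y θ(y) + sgn z θ(z)) b(x,y,z)`. When `z` is
smallest, `x` and `y` have opposite signs, so the two large terms form a difference of values of
`θ`, which gains `|z|/|x|` (`EnergyWeight.bound_symm`). The energy is thus controlled with `∫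
(1+k²)|ŵ|` as coefficient (`AdmissibleKernel.energy_le`), and for `σ > 2` this coefficient is
bounded by the energy with weight `1 + |k|(1+k²)^σ`, equivalent to the square of the norm of `X_σ`
(`exists_l1_bound`).

Differences: `Q(v,v) - Q(w,w) = Q(v-w, v+w)`. Paired with `v-w` and symmetrised over the two copies
of `v-w`, the symbol contains `sgn x + sgn y`. It vanishes unless the frequency of `v+w` is the
largest one, so the derivatives fall on `v+w` and an `L²` stability estimate follows
(`AdmissibleKernel.diff_le`, `norm_sub_sq_le`). This gives uniqueness.

Existence: restricting the kernel to frequencies at most `N` makes the equation an ODE in `L²` with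
a locally Lipschitz field, and the truncated kernel obeys the same bounds, so energy bound and
lifespan do not depend on `N` (`exists_trunc_solution_bounds`). The solutions are Cauchy in `L²` as
`N → ∞`, and the limit solves the equation (`exists_solution_bounds`).

Continuity in time and in the data, for the strong topology of `X_σ`: the weights `tailW ρ θ`, which
damp the frequencies below `ρ`, satisfy the energy estimate with constants independent of `ρ`.
High-frequency energy therefore grows at most by a fixed factor over the lifespan, and convergence
in `X_σ` reduces to convergence in `L²` plus smallness of the tails at time `0` (`En_split`,
`continuous_dependence`).

That the actual kernel is admissible: its symmetries come from those of the third derivatives of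
`W`. For the bound, (H3) in the direction `ν` allows the interior equation to be solved for `V''`; a
square integrable solution then has `V` and `V'` bounded and square integrable
(`exists_bound_of_second_order`). With two of the three profiles taken in `L²` and one in `L∞`,
scaling makes the integral over `z` of size `1/|x|`, and counting the frequencies produced by the
gradients gives the bound (`IsSurfaceWave.exists_kernel_bound`). -/

/-! ## The Fourier transform of real square integrable functions -/

/-- Complex square integrable functions on the line. -/
abbrev L2C : Type := Lp ℂ 2 (volume : Measure ℝ)

/-- Pointwise complex conjugation on `L²`. -/
def conjL : L2C →L[ℝ] L2C :=
  ContinuousLinearMap.compLpL 2 volume (Complex.conjCLE : ℂ →L[ℝ] ℂ)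

lemma conjL_coe (f : L2C) : conjL f =ᵐ[volume] fun x => conj (f x) :=
  ContinuousLinearMap.coeFn_compLpL _ f

/-- Reflection on `L²`. -/
def reflL : L2C →ₗᵢ[ℝ] L2C :=
  Lp.compMeasurePreservingₗᵢ ℝ (fun x : ℝ => -x) (Measure.measurePreserving_neg volume)

lemma reflL_coe (f : L2C) : reflL f =ᵐ[volume] fun x => f (-x) :=
  Lp.coeFn_compMeasurePreserving f (Measure.measurePreserving_neg volume)

lemma fourier_conj (φ : ℝ → ℂ) (x : ℝ) :
    𝓕 (fun y => conj (φ y)) x = conj (𝓕 φ (-x)) := by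
  rw [Real.fourier_eq', Real.fourier_eq', ← integral_conj]
  congr 1
  ext v
  simp only [smul_eq_mul, map_mul, ← Complex.exp_conj]
  congr 2
  simp [map_ofNat (starRingEnd ℂ) 2]

/-- Both sides are continuous in `f`, so it is enough to check Schwartz functions, for which the
transform is an integral. -/
lemma fourier_conjL (f : L2C) : (𝓕 (conjL f) : L2C) = conjL (reflL (𝓕 f : L2C)) := by
  have hd := SchwartzMap.denseRange_toLpCLM (E := ℝ) (F := ℂ) (p := 2) (μ := volume)
    ENNReal.ofNat_ne_top
  refine DenseRange.induction_on (p := fun f : L2C =>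
    (𝓕 (conjL f) : L2C) = conjL (reflL (𝓕 f : L2C))) hd f ?_ ?_
  · have hF : Continuous (fun f : L2C => (𝓕 f : L2C)) :=
      (Lp.fourierTransformₗᵢ ℝ ℂ).continuous
    exact isClosed_eq (hF.comp conjL.continuous)
      (conjL.continuous.comp (reflL.continuous.comp hF))
  · intro φ
    set ψ : SchwartzMap ℝ ℂ :=
      SchwartzMap.postcompCLM (𝕜 := ℝ) (Complex.conjCLE : ℂ →L[ℝ] ℂ) φ with hψ
    have hψ' : (ψ : ℝ → ℂ) = fun x => conj (φ x) := by ext x; simp [hψ]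
    have h1 : conjL (φ.toLp 2) = ψ.toLp 2 := by
      apply Lp.ext
      filter_upwards [conjL_coe (φ.toLp 2), SchwartzMap.coeFn_toLp φ 2,
        SchwartzMap.coeFn_toLp ψ 2] with x hx1 hx2 hx3
      rw [hx1, hx2, hx3, hψ']
    change (𝓕 (conjL (φ.toLp 2)) : L2C) = conjL (reflL (𝓕 (φ.toLp 2) : L2C))
    rw [h1, SchwartzMap.toLp_fourier_eq, SchwartzMap.toLp_fourier_eq]
    apply Lp.ext
    have h3 : ∀ᵐ x : ℝ, ((𝓕 φ).toLp 2 : L2C) (-x) = 𝓕 φ (-x) :=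
      (Measure.measurePreserving_neg volume).quasiMeasurePreserving.ae
        (SchwartzMap.coeFn_toLp (𝓕 φ) 2 volume)
    filter_upwards [conjL_coe (reflL ((𝓕 φ).toLp 2)), reflL_coe ((𝓕 φ).toLp 2), h3,
      SchwartzMap.coeFn_toLp (𝓕 ψ) 2] with x hx1 hx2 hx3 hx4
    rw [hx1, hx2, hx3, hx4, SchwartzMap.fourier_coe, SchwartzMap.fourier_coe, hψ', fourier_conj]

/-- A real square integrable function, seen as a complex one. -/
def toC (w : L2R) : L2C := Complex.ofRealCLM.compLpL 2 volume w

lemma toC_coe (w : L2R) : toC w =ᵐ[volume] fun x => (w x : ℂ) :=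
  ContinuousLinearMap.coeFn_compLpL _ w

lemma conjL_toC (w : L2R) : conjL (toC w) = toC w := by
  apply Lp.ext
  filter_upwards [conjL_coe (toC w), toC_coe w] with x h1 h2
  rw [h1, h2, Complex.conj_ofReal]

lemma exists_toC {f : L2C} (hf : conjL f = f) : ∃ w, toC w = f := by
  refine ⟨Complex.reCLM.compLpL 2 volume f, ?_⟩
  apply Lp.ext
  filter_upwards [toC_coe (Complex.reCLM.compLpL 2 volume f),
    ContinuousLinearMap.coeFn_compLpL Complex.reCLM f, conjL_coe f] with x h1 h2 h3
  rw [h1, h2]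
  rw [hf] at h3
  exact (Complex.conj_eq_iff_re.mp h3.symm)

lemma map_div_two_pi :
    Measure.map (fun k : ℝ => k / (2 * Real.pi)) volume
      = ENNReal.ofReal (2 * Real.pi) • (volume : Measure ℝ) := by
  have h := Real.map_volume_mul_left (a := (2 * Real.pi)⁻¹) (by positivity)
  rw [inv_inv, abs_of_pos (by positivity)] at h
  rw [← h]
  congr 1
  ext k
  rw [div_eq_inv_mul]

lemma quasi_div_two_pi :
    Measure.QuasiMeasurePreserving (fun k : ℝ => k / (2 * Real.pi)) volume volume :=
  ⟨by fun_prop, by rw [map_div_two_pi]; exact Measure.smul_absolutelyContinuous⟩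

lemma quasi_mul_two_pi :
    Measure.QuasiMeasurePreserving (fun k : ℝ => 2 * Real.pi * k) volume volume :=
  ⟨by fun_prop, by
    rw [Real.map_volume_mul_left (by positivity)]; exact Measure.smul_absolutelyContinuous⟩

lemma hat_eq (w : L2R) (k : ℝ) : hat w k = (𝓕 (toC w) : L2C) (k / (2 * Real.pi)) := rfl

lemma measurable_hat (w : L2R) : Measurable (hat w) :=
  (Lp.stronglyMeasurable (𝓕 (toC w) : L2C)).measurable.comp (by fun_prop)

lemma fourier_toC_conj (w : L2R) :
    ∀ᵐ x : ℝ, (𝓕 (toC w) : L2C) (-x) = conj ((𝓕 (toC w) : L2C) x) := by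
  have h := fourier_conjL (toC w)
  rw [conjL_toC] at h
  filter_upwards [conjL_coe (reflL (𝓕 (toC w) : L2C)), reflL_coe (𝓕 (toC w) : L2C)] with x h1 h2
  conv_rhs => rw [h, h1, h2, Complex.conj_conj]

lemma hat_conj (w : L2R) : ∀ᵐ k : ℝ, hat w (-k) = conj (hat w k) := by
  filter_upwards [quasi_div_two_pi.ae (fourier_toC_conj w)] with k hk
  rw [hat_eq, hat_eq, neg_div, hk]

lemma toC_add (v w : L2R) : toC (v + w) = toC v + toC w := map_add _ _ _

lemma toC_smul (a : ℝ) (w : L2R) : toC (a • w) = (a : ℂ) • toC w := by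
  apply Lp.ext
  filter_upwards [toC_coe (a • w), toC_coe w, Lp.coeFn_smul a w, Lp.coeFn_smul (a : ℂ) (toC w)]
    with x h1 h2 h3 h4
  rw [h1, h4, h3, Pi.smul_apply, Pi.smul_apply, h2]
  simp

lemma hat_add (v w : L2R) : hat (v + w) =ᵐ[volume] fun k => hat v k + hat w k := by
  have h := quasi_div_two_pi.ae (Lp.coeFn_add (𝓕 (toC v) : L2C) (𝓕 (toC w)))
  filter_upwards [h] with k hk
  rw [hat_eq, hat_eq, hat_eq, toC_add, FourierAdd.fourier_add, hk, Pi.add_apply]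

lemma hat_smul (a : ℝ) (w : L2R) : hat (a • w) =ᵐ[volume] fun k => a * hat w k := by
  have h := quasi_div_two_pi.ae (Lp.coeFn_smul (a : ℂ) (𝓕 (toC w) : L2C))
  filter_upwards [h] with k hk
  rw [hat_eq, hat_eq, toC_smul, FourierTransform.fourier_smul, hk, Pi.smul_apply, smul_eq_mul]

lemma inner_toC (v w : L2R) : inner ℂ (toC v) (toC w) = ((inner ℝ v w : ℝ) : ℂ) := by
  rw [L2.inner_def, L2.inner_def, ← integral_complex_ofReal]
  apply integral_congr_ae
  filter_upwards [toC_coe v, toC_coe w] with x h1 h2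
  rw [h1, h2]
  simp

lemma integral_comp_div_two_pi {E : Type*} [NormedAddCommGroup E] [NormedSpace ℝ E]
    (g : ℝ → E) :
    ∫ k : ℝ, g (k / (2 * Real.pi)) = (2 * Real.pi) • ∫ k : ℝ, g k := by
  rw [Measure.integral_comp_div, abs_of_pos (by positivity)]

/-- **Plancherel** for `hat`. -/
lemma inner_eq_integral_hat (v w : L2R) :
    inner ℝ v w = (2 * Real.pi)⁻¹ * (∫ k : ℝ, conj (hat v k) * hat w k).re := by
  have h1 : ∫ k : ℝ, conj (hat v k) * hat w k
      = (2 * Real.pi) • ∫ k : ℝ, conj ((𝓕 (toC v) : L2C) k) * (𝓕 (toC w) : L2C) k :=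
    integral_comp_div_two_pi (fun k => conj ((𝓕 (toC v) : L2C) k) * (𝓕 (toC w) : L2C) k)
  have h2 : ∫ k : ℝ, conj ((𝓕 (toC v) : L2C) k) * (𝓕 (toC w) : L2C) k
      = ((inner ℝ v w : ℝ) : ℂ) := by
    rw [← inner_toC, ← Lp.inner_fourier_eq, L2.inner_def]
    apply integral_congr_ae
    filter_upwards with k
    simp [mul_comm]
  rw [h1, h2]
  simp
  field_simp

lemma lintegral_comp_div_two_pi {g : ℝ → ℝ≥0∞} (hg : Measurable g) :
    ∫⁻ k : ℝ, g (k / (2 * Real.pi)) = ENNReal.ofReal (2 * Real.pi) * ∫⁻ k : ℝ, g k := by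
  rw [← lintegral_map (μ := volume) (f := g) (g := fun k : ℝ => k / (2 * Real.pi)) hg
    (by fun_prop), map_div_two_pi, lintegral_smul_measure, smul_eq_mul]

lemma enorm_sq_L2C (f : L2C) : ‖f‖ₑ ^ 2 = ∫⁻ k : ℝ, ‖f k‖ₑ ^ 2 := by
  have h := eLpNorm_eq_lintegral_rpow_enorm_toReal (μ := (volume : Measure ℝ)) (f := (f : ℝ → ℂ))
    (p := 2) (by norm_num) (by norm_num)
  rw [Lp.enorm_def, h, ← ENNReal.rpow_natCast, ← ENNReal.rpow_mul]
  simp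

lemma enorm_toC (w : L2R) : ‖toC w‖ₑ = ‖w‖ₑ := by
  have h := inner_toC w w
  rw [inner_self_eq_norm_sq_to_K, real_inner_self_eq_norm_sq] at h
  have h2 : ‖toC w‖ ^ 2 = ‖w‖ ^ 2 := by
    have := congrArg Complex.re h
    simpa [← Complex.ofReal_pow] using this
  have h3 : ‖toC w‖ = ‖w‖ := by
    rwa [sq_eq_sq₀ (norm_nonneg _) (norm_nonneg _)] at h2
  rw [← ofReal_norm, ← ofReal_norm, h3]

lemma lintegral_hat_sq (w : L2R) :
    ∫⁻ k : ℝ, ‖hat w k‖ₑ ^ 2 = ENNReal.ofReal (2 * Real.pi) * ‖w‖ₑ ^ 2 := by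
  have hm : Measurable fun k => ‖(𝓕 (toC w) : L2C) k‖ₑ ^ 2 :=
    ((Lp.stronglyMeasurable (𝓕 (toC w) : L2C)).measurable.enorm).pow_const 2
  have hn : ‖(𝓕 (toC w) : L2C)‖ₑ = ‖toC w‖ₑ := by
    rw [← ofReal_norm, ← ofReal_norm, Lp.norm_fourier_eq]
  calc ∫⁻ k : ℝ, ‖hat w k‖ₑ ^ 2
      = ENNReal.ofReal (2 * Real.pi) * ∫⁻ k : ℝ, ‖(𝓕 (toC w) : L2C) k‖ₑ ^ 2 :=
        lintegral_comp_div_two_pi hm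
    _ = _ := by rw [← enorm_sq_L2C, hn, enorm_toC]

lemma hat_injective {v w : L2R} (h : hat v =ᵐ[volume] hat w) : v = w := by
  have h1 : hat (v + (-1 : ℝ) • w) =ᵐ[volume] 0 := by
    filter_upwards [hat_add v ((-1 : ℝ) • w), hat_smul (-1) w, h] with k h1 h2 h3
    rw [h1, h2, h3]; simp
  have h2 := lintegral_hat_sq (v + (-1 : ℝ) • w)
  have h3 : ∫⁻ k : ℝ, ‖hat (v + (-1 : ℝ) • w) k‖ₑ ^ 2 = 0 := by
    rw [lintegral_congr_ae (g := fun _ => 0)]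
    · simp
    · filter_upwards [h1] with k hk
      rw [hk]; simp
  rw [h3] at h2
  have h4 : ‖v + (-1 : ℝ) • w‖ₑ = 0 := by
    rcases mul_eq_zero.mp h2.symm with h | h
    · exact absurd h (by simp [Real.pi_pos])
    · exact pow_eq_zero_iff (two_ne_zero) |>.mp h
  rw [enorm_eq_zero] at h4
  simpa [← sub_eq_add_neg, sub_eq_zero] using h4

/-- Hermitian square integrable functions are Fourier transforms of real ones. -/
lemma exists_hat_eq {f : ℝ → ℂ} (hf : MemLp f 2) (hc : ∀ᵐ k : ℝ, f (-k) = conj (f k)) :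
    ∃ w : L2R, hat w =ᵐ[volume] f := by
  have hg : MemLp (fun k => f (2 * Real.pi * k)) 2 := by
    refine ⟨hf.1.comp_quasiMeasurePreserving quasi_mul_two_pi, ?_⟩
    have h1 : eLpNorm (fun k => f (2 * Real.pi * k)) 2 volume
        = eLpNorm f 2 (Measure.map (fun k : ℝ => 2 * Real.pi * k) volume) := by
      rw [eLpNorm_map_measure]
      · rfl
      · rw [Real.map_volume_mul_left (by positivity)]
        exact hf.1.smul_measure _
      · fun_prop
    rw [h1, Real.map_volume_mul_left (by positivity)]
    exact (hf.smul_measure ENNReal.ofReal_ne_top).2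
  set F : L2C := hg.toLp _ with hF
  have hFc : F =ᵐ[volume] fun k => f (2 * Real.pi * k) := hg.coeFn_toLp
  set g : L2C := 𝓕⁻ F with hgdef
  have hFg : (𝓕 g : L2C) = F := FourierTransform.fourier_fourierInv_eq F
  have hgc : conjL g = g := by
    have h1 : (𝓕 (conjL g) : L2C) = 𝓕 g := by
      rw [fourier_conjL, hFg]
      apply Lp.ext
      have h3 : ∀ᵐ x : ℝ, F (-x) = f (2 * Real.pi * (-x)) :=
        (Measure.measurePreserving_neg volume).quasiMeasurePreserving.ae hFc
      have h4 : ∀ᵐ x : ℝ, f (-(2 * Real.pi * x)) = conj (f (2 * Real.pi * x)) :=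
        quasi_mul_two_pi.ae hc
      filter_upwards [conjL_coe (reflL F), reflL_coe F, hFc, h3, h4] with x h1 h2 h3 h4 h5
      rw [h1, h2, h4, h3, mul_neg, h5, Complex.conj_conj]
    exact (Lp.fourierTransformₗᵢ ℝ ℂ).injective h1
  obtain ⟨w, hw⟩ := exists_toC hgc
  refine ⟨w, ?_⟩
  filter_upwards [quasi_div_two_pi.ae hFc] with k hk
  rw [hat_eq, hw, hFg, hk]
  congr 1
  field_simp

/-- An everywhere Hermitian representative of the Fourier transform. -/
def fhat (w : L2R) (k : ℝ) : ℂ := (hat w k + conj (hat w (-k))) / 2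

lemma measurable_fhat (w : L2R) : Measurable (fhat w) := by
  have := measurable_hat w
  unfold fhat
  fun_prop

/-- This is the point of `fhat`: the Hermitian symmetry holds at every `k`, not only almost
everywhere, which is what `conv_conj` and `hat_ofHat` ask for. -/
lemma fhat_neg (w : L2R) (k : ℝ) : fhat w (-k) = conj (fhat w k) := by
  simp [fhat, add_comm, map_ofNat (starRingEnd ℂ) 2]

lemma fhat_ae (w : L2R) : fhat w =ᵐ[volume] hat w := by
  filter_upwards [hat_conj w] with k hk
  simp [fhat, hk]

lemma fhat_add (v w : L2R) : fhat (v + w) =ᵐ[volume] fun k => fhat v k + fhat w k := by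
  filter_upwards [fhat_ae v, fhat_ae w, fhat_ae (v + w), hat_add v w] with k h1 h2 h3 h4
  rw [h1, h2, h3, h4]

lemma fhat_smul (a : ℝ) (w : L2R) : fhat (a • w) =ᵐ[volume] fun k => a * fhat w k := by
  filter_upwards [fhat_ae w, fhat_ae (a • w), hat_smul a w] with k h1 h2 h3
  rw [h1, h2, h3]

lemma fhat_sub (v w : L2R) : fhat (v - w) =ᵐ[volume] fun k => fhat v k - fhat w k := by
  have : v - w = v + (-1 : ℝ) • w := by simp [sub_eq_add_neg]
  rw [this]
  filter_upwards [fhat_add v ((-1 : ℝ) • w), fhat_smul (-1) w] with k h1 h2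
  rw [h1, h2]; simp [sub_eq_add_neg]

lemma fhat_neg_ae (w : L2R) : fhat (-w) =ᵐ[volume] fun k => -fhat w k := by
  filter_upwards [fhat_smul (-1) w] with k h
  simpa using h

lemma fhat_injective {v w : L2R} (h : fhat v =ᵐ[volume] fhat w) : v = w :=
  hat_injective ((fhat_ae v).symm.trans (h.trans (fhat_ae w)))

lemma lintegral_fhat_sq (w : L2R) :
    ∫⁻ k : ℝ, ‖fhat w k‖ₑ ^ 2 = ENNReal.ofReal (2 * Real.pi) * ‖w‖ₑ ^ 2 := by
  rw [← lintegral_hat_sq]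
  apply lintegral_congr_ae
  filter_upwards [fhat_ae w] with k hk
  rw [hk]

lemma inner_eq_integral_fhat (v w : L2R) :
    inner ℝ v w = (2 * Real.pi)⁻¹ * (∫ k : ℝ, fhat v (-k) * fhat w k).re := by
  rw [inner_eq_integral_hat]
  congr 2
  apply integral_congr_ae
  filter_upwards [fhat_ae v, fhat_ae w] with k h1 h2
  rw [fhat_neg, h1, h2]

open Classical in
/-- The real square integrable function with a given Fourier transform (`0` if there is none). -/
def ofHat (f : ℝ → ℂ) : L2R := if h : ∃ w : L2R, hat w =ᵐ[volume] f then h.choose else 0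

lemma hat_ofHat {f : ℝ → ℂ} (hf : MemLp f 2) (hc : ∀ k : ℝ, f (-k) = conj (f k)) :
    hat (ofHat f) =ᵐ[volume] f := by
  have h := exists_hat_eq hf (Eventually.of_forall hc)
  rw [ofHat, dif_pos h]
  exact h.choose_spec

lemma fhat_ofHat {f : ℝ → ℂ} (hf : MemLp f 2) (hc : ∀ k : ℝ, f (-k) = conj (f k)) :
    fhat (ofHat f) =ᵐ[volume] f :=
  (fhat_ae _).trans (hat_ofHat hf hc)

/-! ## Kernels and weights -/

/-- Symmetric Hermitian kernels that grow linearly in the two large frequencies. -/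
structure AdmissibleKernel (b : ℝ → ℝ → ℝ → ℂ) (C : ℝ) : Prop where
  nonneg : 0 ≤ C
  meas : Measurable (fun p : ℝ × ℝ × ℝ => b p.1 p.2.1 p.2.2)
  swap12 : ∀ x y z, b x y z = b y x z
  swap23 : ∀ x y z, b x y z = b x z y
  neg : ∀ x y z, b (-x) (-y) (-z) = conj (b x y z)
  -- `z` is the smallest frequency, so `|x|` and `|y|` are comparable; by symmetry this case
  -- determines the size of `b` on the whole plane `x + y + z = 0`.
  bound : ∀ x y z, x + y + z = 0 → |z| ≤ |x| → |z| ≤ |y| → ‖b x y z‖ ≤ C * |x| * (1 + |z|)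

/-- Even weights, increasing and with controlled growth in `|k|`. -/
structure EnergyWeight (θ : ℝ → ℝ) (K : ℝ) : Prop where
  Knonneg : 0 ≤ K
  meas : Measurable θ
  nonneg : ∀ x, 0 ≤ θ x
  mono : ∀ x y, |x| ≤ |y| → θ x ≤ θ y
  -- Moving a frequency by `|z|` changes `θ` by a relative amount of at most `K |z| / |x|`;
  -- multiplying out by `|x|` covers `x = 0`.
  growth : ∀ x z, |z| ≤ |x| → θ (|x| + |z|) * |x| ≤ (|x| + K * |z|) * θ x

/-- The sign of a real number as a real number. -/
abbrev sg (x : ℝ) : ℝ := (SignType.sign x : ℝ)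

lemma sg_of_pos {x : ℝ} (h : 0 < x) : sg x = 1 := by simp [sg, sign_pos h]
lemma sg_of_neg {x : ℝ} (h : x < 0) : sg x = -1 := by simp [sg, sign_neg h]
lemma sg_zero : sg 0 = 0 := by simp [sg]
lemma sg_neg (x : ℝ) : sg (-x) = -sg x := by
  rcases lt_trichotomy x 0 with h | h | h
  · rw [sg_of_neg h, sg_of_pos (by linarith)]; norm_num
  · subst h; simp [sg_zero]
  · rw [sg_of_pos h, sg_of_neg (by linarith)]
lemma abs_sg_le (x : ℝ) : |sg x| ≤ 1 := by
  rcases lt_trichotomy x 0 with h | h | h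
  · rw [sg_of_neg h]; norm_num
  · subst h; simp [sg_zero]
  · rw [sg_of_pos h]; norm_num
lemma measurable_sg : Measurable sg := by
  have : sg = fun x => if 0 < x then 1 else if x < 0 then -1 else 0 := by
    ext x
    rcases lt_trichotomy x 0 with h | h | h
    · rw [sg_of_neg h, if_neg (not_lt.mpr h.le), if_pos h]
    · subst h; simp [sg_zero]
    · rw [sg_of_pos h, if_pos h]
  rw [this]
  exact Measurable.ite measurableSet_Ioi measurable_const
    (Measurable.ite measurableSet_Iio measurable_const measurable_const)

namespace AdmissibleKernel

variable {b : ℝ → ℝ → ℝ → ℂ} {C : ℝ}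

lemma swap13 (h : AdmissibleKernel b C) (x y z : ℝ) : b x y z = b z y x := by
  rw [h.swap12, h.swap23, h.swap12]

/-- Whichever frequency is the smallest, a large one is bounded by the sum of the other two. The two
input frequencies can thus carry one factor each, and the output frequency `x` none. -/
lemma bound_pair (h : AdmissibleKernel b C) {x y z : ℝ} (h0 : x + y + z = 0) :
    ‖b x y z‖ ≤ 2 * C * (1 + |y|) * (1 + |z|) := by
  have hC := h.nonneg
  have hx : |x| ≤ |y| + |z| := by
    have : x = -(y + z) := by linarith
    rw [this, abs_neg]; exact abs_add_le y z
  have hay := abs_nonneg y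
  have haz := abs_nonneg z
  have hax := abs_nonneg x
  have key : ∀ r t s : ℝ, 0 ≤ r → 0 ≤ t → r ≤ 2 * (1 + s) → 0 ≤ s →
      C * r * (1 + t) ≤ 2 * C * (1 + s) * (1 + t) := by
    intro r t s hr ht hrs hs
    have := mul_le_mul_of_nonneg_right (mul_le_mul_of_nonneg_left hrs hC)
      (by positivity : 0 ≤ 1 + t)
    linarith
  rcases le_total |x| |y| with hxy | hxy
  · rcases le_total |x| |z| with hxz | hxz
    · rw [h.swap13, h.swap23, h.swap12]
      rw [h.swap12]
      have := h.bound z y x (by linarith) hxz hxy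
      rw [h.swap23 z x y]
      refine this.trans ?_
      have e1 : C * |z| * (1 + |x|) ≤ C * |z| * (1 + |y|) := by gcongr
      have e2 := key |z| |y| |z| haz hay (by linarith) haz
      nlinarith [e1, e2]
    · have := h.bound x y z h0 hxz (hxz.trans hxy)
      exact this.trans (key _ _ _ hax haz (by linarith) hay)
  · rcases le_total |y| |z| with hyz | hyz
    · rw [h.swap23]
      have := h.bound x z y (by linarith) hxy hyz
      refine this.trans ((key _ _ |z| hax hay (by linarith) haz).trans (le_of_eq (by ring)))
    · have := h.bound x y z h0 (hyz.trans hxy) hyz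
      exact this.trans (key _ _ _ hax haz (by linarith) hay)

/-- If the signs do not cancel, `x` and `y` lie on the same side of `0` (or one vanishes). Then `|z|
= |x| + |y|` is the largest frequency, and the growth of `b` is paid for by `z` alone. This is the
symbol of the `L²` estimate for differences. -/
lemma bound_sum_sign (h : AdmissibleKernel b C) {x y z : ℝ} (h0 : x + y + z = 0) :
    |sg x + sg y| * ‖b x y z‖ ≤ 4 * C * (1 + z ^ 2) := by
  have hC := h.nonneg
  by_cases hs : sg x + sg y = 0
  · rw [hs]; simp; positivity
  have hz : |z| = |x| + |y| := by
    have hzz : z = -(x + y) := by linarith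
    rw [hzz, abs_neg]
    rcases lt_trichotomy x 0 with hx | hx | hx
    · rcases le_or_gt y 0 with hy | hy
      · rw [abs_of_neg hx, abs_of_nonpos hy, abs_of_nonpos (by linarith)]; ring
      · exact absurd (by rw [sg_of_neg hx, sg_of_pos hy]; norm_num) hs
    · subst hx; simp
    · rcases le_or_gt 0 y with hy | hy
      · rw [abs_of_pos hx, abs_of_nonneg hy, abs_of_nonneg (by linarith)]
      · exact absurd (by rw [sg_of_pos hx, sg_of_neg hy]; norm_num) hs
  have hax := abs_nonneg x
  have hay := abs_nonneg y
  have h2 : |sg x + sg y| ≤ 2 := by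
    have := abs_add_le (sg x) (sg y)
    linarith [abs_sg_le x, abs_sg_le y]
  have hb : ‖b x y z‖ ≤ C * |z| * (1 + |z|) := by
    rcases le_total |x| |y| with hxy | hxy
    · have := h.bound z y x (by linarith) (by linarith) hxy
      rw [h.swap13]
      refine this.trans ?_
      have : |x| ≤ |z| := by linarith
      gcongr
    · have := h.bound z x y (by linarith) (by linarith) hxy
      rw [h.swap13, h.swap23]
      refine this.trans ?_
      have : |y| ≤ |z| := by linarith
      gcongr
  have hz2 : |z| * (1 + |z|) ≤ 2 * (1 + z ^ 2) := by
    rw [← sq_abs z]; nlinarith [sq_nonneg (|z| - 1)]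
  calc |sg x + sg y| * ‖b x y z‖ ≤ 2 * (C * |z| * (1 + |z|)) :=
        mul_le_mul h2 hb (norm_nonneg _) (by norm_num)
    _ = 2 * C * (|z| * (1 + |z|)) := by ring
    _ ≤ 2 * C * (2 * (1 + z ^ 2)) := by gcongr
    _ = _ := by ring

end AdmissibleKernel

namespace EnergyWeight

variable {b : ℝ → ℝ → ℝ → ℂ} {C : ℝ} {θ : ℝ → ℝ} {K : ℝ}

lemma abs_eq (h : EnergyWeight θ K) (x : ℝ) : θ |x| = θ x :=
  le_antisymm (h.mono _ _ (by simp)) (h.mono _ _ (by simp))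

lemma even (h : EnergyWeight θ K) (x : ℝ) : θ (-x) = θ x := by
  rw [← h.abs_eq, abs_neg, h.abs_eq]

lemma le_sqrt_mul (h : EnergyWeight θ K) {x y : ℝ} (hxy : |x| ≤ |y|) :
    θ x ≤ √(θ x) * √(θ y) := by
  calc θ x = √(θ x) * √(θ x) := (Real.mul_self_sqrt (h.nonneg x)).symm
    _ ≤ _ := by gcongr; exact h.mono _ _ hxy

lemma growth_sub (h : EnergyWeight θ K) {x y z : ℝ} (hz : |z| ≤ |x|) (hy : |y| = |x| + |z|) :
    (θ y - θ x) * |x| ≤ K * |z| * (√(θ x) * √(θ y)) := by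
  have h1 := h.growth x z hz
  rw [← hy, h.abs_eq] at h1
  have h2 := h.le_sqrt_mul (x := x) (y := y) (by rw [hy]; linarith [abs_nonneg z])
  have h3 : K * |z| * θ x ≤ K * |z| * (√(θ x) * √(θ y)) :=
    mul_le_mul_of_nonneg_left h2 (mul_nonneg h.Knonneg (abs_nonneg z))
  nlinarith

/-- Since `z` is smallest and `x ≠ 0`, the signs of `x` and `y` are opposite, and the sum is `±(θ x
- θ y)` with `|x|` and `|y|` differing by `|z|`. The growth condition, applied at the smaller of the
two, trades the factor `|x|` for `K |z|`. The factor `2` is needed when `|x| = |y| + |z| ≤ 2|y|`. -/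
lemma signed_diff (h : EnergyWeight θ K) {x y z : ℝ} (h0 : x + y + z = 0) (hzx : |z| ≤ |x|)
    (hzy : |z| ≤ |y|) :
    |sg x * θ x + sg y * θ y| * |x| ≤ 2 * K * |z| * (√(θ x) * √(θ y)) := by
  have hK := h.Knonneg
  by_cases hx0 : x = 0
  · subst hx0; simp; positivity
  -- opposite signs
  have hopp : sg y = -sg x ∧ (|y| = |x| + |z| ∨ |x| = |y| + |z|) ∧ 0 < |y| := by
    rcases lt_or_gt_of_ne hx0 with hx | hx
    · have hy : 0 < y := by
        by_contra hy
        push Not at hy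
        rw [abs_of_neg hx, abs_of_nonneg (by linarith : 0 ≤ z)] at hzx
        rw [abs_of_nonpos hy, abs_of_nonneg (by linarith : 0 ≤ z)] at hzy
        have : y = 0 := by linarith
        linarith
      refine ⟨by rw [sg_of_neg hx, sg_of_pos hy]; norm_num, ?_, by positivity⟩
      rw [abs_of_neg hx, abs_of_pos hy]
      rcases le_total 0 z with hz | hz
      · right; rw [abs_of_nonneg hz]; linarith
      · left; rw [abs_of_nonpos hz]; linarith
    · have hy : y < 0 := by
        by_contra hy
        push Not at hy
        rw [abs_of_pos hx, abs_of_nonpos (by linarith : z ≤ 0)] at hzx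
        rw [abs_of_nonneg hy, abs_of_nonpos (by linarith : z ≤ 0)] at hzy
        have : y = 0 := by linarith
        linarith
      refine ⟨by rw [sg_of_pos hx, sg_of_neg hy], ?_, abs_pos.mpr hy.ne⟩
      rw [abs_of_pos hx, abs_of_neg hy]
      rcases le_total 0 z with hz | hz
      · left; rw [abs_of_nonneg hz]; linarith
      · right; rw [abs_of_nonpos hz]; linarith
  obtain ⟨hsy, hor, hypos⟩ := hopp
  have hle : |sg x * θ x + sg y * θ y| ≤ |θ y - θ x| := by
    rw [hsy, show sg x * θ x + -sg x * θ y = sg x * (θ x - θ y) by ring, abs_mul,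
      abs_sub_comm (θ y)]
    exact mul_le_of_le_one_left (abs_nonneg _) (abs_sg_le x)
  have hss : 0 ≤ √(θ x) * √(θ y) := by positivity
  rcases hor with hy | hx
  · have h1 := h.growth_sub hzx hy
    have h2 : θ x ≤ θ y := h.mono _ _ (by rw [hy]; linarith [abs_nonneg z])
    rw [abs_of_nonneg (by linarith : 0 ≤ θ y - θ x)] at hle
    have := mul_le_mul_of_nonneg_right hle (abs_nonneg x)
    have h5 : 0 ≤ K * |z| * (√(θ x) * √(θ y)) := by positivity
    nlinarith
  · have h1 := h.growth_sub hzy hx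
    have h2 : θ y ≤ θ x := h.mono _ _ (by rw [hx]; linarith [abs_nonneg z])
    rw [abs_of_nonpos (by linarith : θ y - θ x ≤ 0)] at hle
    have h3 : |x| ≤ 2 * |y| := by rw [hx]; linarith
    have h4 : |sg x * θ x + sg y * θ y| * |x| ≤ (θ x - θ y) * (2 * |y|) :=
      mul_le_mul (by linarith) h3 (abs_nonneg x) (by linarith)
    rw [mul_comm (√(θ y))] at h1
    nlinarith

/-- The two large frequencies are handled together by `signed_diff`, which replaces the `|x|` of the
kernel bound by `|z|`. The term in `θ z` needs no cancellation: monotonicity moves half of the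
weight onto `y`, and the kernel is at most `2C(1 + x²)`. -/
lemma bound_min (h : EnergyWeight θ K) (hb : AdmissibleKernel b C) {x y z : ℝ}
    (h0 : x + y + z = 0) (hzx : |z| ≤ |x|) (hzy : |z| ≤ |y|) :
    |sg x * θ x + sg y * θ y + sg z * θ z| * ‖b x y z‖ ≤
      (4 * K + 2) * C * ((1 + z ^ 2) * (√(θ x) * √(θ y)) + (1 + x ^ 2) * (√(θ y) * √(θ z))
        + (1 + y ^ 2) * (√(θ x) * √(θ z))) := by
  have hC := hb.nonneg
  have hK := h.Knonneg
  have hbd := hb.bound x y z h0 hzx hzy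
  have h1 := h.signed_diff h0 hzx hzy
  have h2 : |sg z * θ z| ≤ √(θ z) * √(θ y) := by
    rw [abs_mul, abs_of_nonneg (h.nonneg z)]
    exact (mul_le_of_le_one_left (h.nonneg z) (abs_sg_le z)).trans (h.le_sqrt_mul hzy)
  have hz2 : |z| * (1 + |z|) ≤ 2 * (1 + z ^ 2) := by
    rw [← sq_abs z]; nlinarith [sq_nonneg (|z| - 1)]
  have hx2 : |x| * (1 + |x|) ≤ 2 * (1 + x ^ 2) := by
    rw [← sq_abs x]; nlinarith [sq_nonneg (|x| - 1)]
  set P := √(θ x) * √(θ y)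
  set Q := √(θ y) * √(θ z)
  set R := √(θ x) * √(θ z)
  have hP : 0 ≤ P := by positivity
  have hQ : 0 ≤ Q := by positivity
  have hR : 0 ≤ R := by positivity
  rw [mul_comm (√(θ z))] at h2
  have e1 : |sg x * θ x + sg y * θ y| * ‖b x y z‖ ≤ 4 * K * C * ((1 + z ^ 2) * P) := by
    calc |sg x * θ x + sg y * θ y| * ‖b x y z‖
        ≤ |sg x * θ x + sg y * θ y| * (C * |x| * (1 + |z|)) := by gcongr
      _ = C * (1 + |z|) * (|sg x * θ x + sg y * θ y| * |x|) := by ring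
      _ ≤ C * (1 + |z|) * (2 * K * |z| * P) := by gcongr
      _ = 2 * K * C * P * (|z| * (1 + |z|)) := by ring
      _ ≤ 2 * K * C * P * (2 * (1 + z ^ 2)) := by gcongr
      _ = _ := by ring
  have e2 : |sg z * θ z| * ‖b x y z‖ ≤ 2 * C * ((1 + x ^ 2) * Q) := by
    calc |sg z * θ z| * ‖b x y z‖ ≤ Q * (C * |x| * (1 + |x|)) := by
          refine mul_le_mul h2 (hbd.trans ?_) (norm_nonneg _) hQ
          gcongr
      _ = C * Q * (|x| * (1 + |x|)) := by ring
      _ ≤ C * Q * (2 * (1 + x ^ 2)) := by gcongr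
      _ = _ := by ring
  have e3 : |sg x * θ x + sg y * θ y + sg z * θ z| * ‖b x y z‖
      ≤ |sg x * θ x + sg y * θ y| * ‖b x y z‖ + |sg z * θ z| * ‖b x y z‖ := by
    rw [← add_mul]; gcongr; exact abs_add_le _ _
  have p1 : 0 ≤ C * ((1 + z ^ 2) * P) := by positivity
  have p2 : 0 ≤ K * C * ((1 + x ^ 2) * Q) := by positivity
  have p3 : 0 ≤ (4 * K + 2) * C * ((1 + y ^ 2) * R) := by positivity
  nlinarith

/-- The symmetrized symbol of the weighted energy of a solution. -/
lemma bound_symm (h : EnergyWeight θ K) (hb : AdmissibleKernel b C) {x y z : ℝ}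
    (h0 : x + y + z = 0) :
    |sg x * θ x + sg y * θ y + sg z * θ z| * ‖b x y z‖ ≤
      (4 * K + 2) * C * ((1 + z ^ 2) * (√(θ x) * √(θ y)) + (1 + x ^ 2) * (√(θ y) * √(θ z))
        + (1 + y ^ 2) * (√(θ x) * √(θ z))) := by
  by_cases hz : |z| ≤ |x| ∧ |z| ≤ |y|
  · exact h.bound_min hb h0 hz.1 hz.2
  by_cases hy : |y| ≤ |x| ∧ |y| ≤ |z|
  · have := h.bound_min hb (x := x) (y := z) (z := y) (by linarith) hy.1 hy.2
    rw [hb.swap23]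
    convert this using 1
    · congr 2; ring
    · ring
  · have hx : |x| ≤ |z| ∧ |x| ≤ |y| := by
      rcases le_total |x| |y| with h1 | h1 <;> rcases le_total |y| |z| with h2 | h2 <;>
        rcases le_total |x| |z| with h3 | h3 <;> grind
    have := h.bound_min hb (x := z) (y := y) (z := x) (by linarith) hx.1 hx.2
    rw [hb.swap13]
    convert this using 1
    · congr 2; ring
    · ring

end EnergyWeight

/-! ## Trilinear integrals -/

/-- The exchange of the first two frequencies in `(-k, k - m, m)`. -/
def swapA : ℝ × ℝ ≃ᵐ ℝ × ℝ :=
  MeasurableEquiv.ofInvolutive (fun p => (p.2 - p.1, p.2)) (fun p => by simp) (by fun_prop)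

/-- The exchange of the first and third frequencies in `(-k, k - m, m)`. -/
def swapB : ℝ × ℝ ≃ᵐ ℝ × ℝ :=
  MeasurableEquiv.ofInvolutive (fun p => (-p.2, -p.1)) (fun p => by simp) (by fun_prop)

lemma swapA_apply (p : ℝ × ℝ) : swapA p = (p.2 - p.1, p.2) := rfl

lemma swapB_apply (p : ℝ × ℝ) : swapB p = (-p.2, -p.1) := rfl

lemma measurePreserving_swapA : MeasurePreserving swapA (volume : Measure (ℝ × ℝ)) volume := by
  have h := ((Measure.measurePreserving_neg (volume : Measure ℝ)).prod
    (MeasurePreserving.id volume)).comp (measurePreserving_sub_prod (volume : Measure ℝ) volume)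
  have e : (swapA : ℝ × ℝ → ℝ × ℝ) = Prod.map Neg.neg id ∘ fun z => (z.1 - z.2, z.2) := by
    ext p <;> simp [swapA_apply]
  rw [e]
  exact h

lemma measurePreserving_swapB : MeasurePreserving swapB (volume : Measure (ℝ × ℝ)) volume := by
  have h := ((Measure.measurePreserving_neg (volume : Measure ℝ)).prod
    (Measure.measurePreserving_neg volume)).comp
      (Measure.measurePreserving_swap (μ := (volume : Measure ℝ)) (ν := volume))
  exact h

lemma lintegral_swap12 {ψ : ℝ → ℝ → ℝ → ℝ≥0∞} :
    ∫⁻ p : ℝ × ℝ, ψ (p.1 - p.2) (-p.1) p.2 = ∫⁻ p : ℝ × ℝ, ψ (-p.1) (p.1 - p.2) p.2 := by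
  rw [← measurePreserving_swapA.lintegral_comp_emb swapA.measurableEmbedding]
  congr 1
  ext p
  simp [swapA_apply]

lemma lintegral_swap13 {ψ : ℝ → ℝ → ℝ → ℝ≥0∞} :
    ∫⁻ p : ℝ × ℝ, ψ p.2 (p.1 - p.2) (-p.1) = ∫⁻ p : ℝ × ℝ, ψ (-p.1) (p.1 - p.2) p.2 := by
  rw [← measurePreserving_swapB.lintegral_comp_emb swapB.measurableEmbedding]
  congr 1
  ext p
  simp [swapB_apply, neg_add_eq_sub]

lemma integral_swap12 {ψ : ℝ → ℝ → ℝ → ℂ} :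
    ∫ p : ℝ × ℝ, ψ (p.1 - p.2) (-p.1) p.2 = ∫ p : ℝ × ℝ, ψ (-p.1) (p.1 - p.2) p.2 := by
  rw [← measurePreserving_swapA.integral_comp swapA.measurableEmbedding]
  congr 1
  ext p
  simp [swapA_apply]

lemma integral_swap13 {ψ : ℝ → ℝ → ℝ → ℂ} :
    ∫ p : ℝ × ℝ, ψ p.2 (p.1 - p.2) (-p.1) = ∫ p : ℝ × ℝ, ψ (-p.1) (p.1 - p.2) p.2 := by
  rw [← measurePreserving_swapB.integral_comp swapB.measurableEmbedding]
  congr 1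
  ext p
  simp [swapB_apply, neg_add_eq_sub]

lemma lintegral_mul_le_sqrt {α : Type*} [MeasurableSpace α] {μ : Measure α} {F G : α → ℝ≥0∞}
    (hF : AEMeasurable F μ) (hG : AEMeasurable G μ) :
    ∫⁻ x, F x * G x ∂μ ≤ (∫⁻ x, F x ^ 2 ∂μ) ^ (1 / 2 : ℝ) * (∫⁻ x, G x ^ 2 ∂μ) ^ (1 / 2 : ℝ) := by
  have := ENNReal.lintegral_mul_le_Lp_mul_Lq μ Real.HolderConjugate.two_two hF hG
  simpa using this

lemma sq_lintegral_mul_le {α : Type*} [MeasurableSpace α] {μ : Measure α} {F G : α → ℝ≥0∞}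
    (hF : AEMeasurable F μ) (hG : AEMeasurable G μ) :
    (∫⁻ x, F x * G x ∂μ) ^ 2 ≤ (∫⁻ x, F x ^ 2 ∂μ) * ∫⁻ x, G x ^ 2 ∂μ := by
  calc _ ≤ ((∫⁻ x, F x ^ 2 ∂μ) ^ (1 / 2 : ℝ) * (∫⁻ x, G x ^ 2 ∂μ) ^ (1 / 2 : ℝ)) ^ 2 := by
        gcongr; exact lintegral_mul_le_sqrt hF hG
    _ = _ := by
        rw [mul_pow, ← ENNReal.rpow_natCast, ← ENNReal.rpow_natCast, ← ENNReal.rpow_mul,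
          ← ENNReal.rpow_mul]
        simp

/-- Two factors in `L²`, the third one in `L¹`. -/
lemma lintegral_trilinear_le {F G H : ℝ → ℝ≥0∞} (hF : Measurable F) (hG : Measurable G)
    (hH : Measurable H) :
    ∫⁻ p : ℝ × ℝ, F (-p.1) * G (p.1 - p.2) * H p.2 ≤
      (∫⁻ x, F x ^ 2) ^ (1 / 2 : ℝ) * (∫⁻ x, G x ^ 2) ^ (1 / 2 : ℝ) * ∫⁻ x, H x := by
  rw [Measure.volume_eq_prod, lintegral_prod_symm _ (by fun_prop), ← lintegral_const_mul _ hH]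
  apply lintegral_mono
  intro m
  simp only
  rw [lintegral_mul_const _ (by fun_prop)]
  gcongr
  refine (lintegral_mul_le_sqrt (by fun_prop) (by fun_prop)).trans ?_
  rw [lintegral_neg_eq_self (fun x => F x ^ 2), lintegral_sub_right_eq_self (fun x => G x ^ 2)]

lemma lintegral_trilinear_le₁ {F G H : ℝ → ℝ≥0∞} (hF : Measurable F) (hG : Measurable G)
    (hH : Measurable H) :
    ∫⁻ p : ℝ × ℝ, H (-p.1) * F (p.1 - p.2) * G p.2 ≤
      (∫⁻ x, F x ^ 2) ^ (1 / 2 : ℝ) * (∫⁻ x, G x ^ 2) ^ (1 / 2 : ℝ) * ∫⁻ x, H x := by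
  rw [← lintegral_swap13 (ψ := fun x y z => H x * F y * G z)]
  calc _ = ∫⁻ p : ℝ × ℝ, G (-p.1) * F (p.1 - p.2) * H p.2 := by
        congr 1; ext p; ring
    _ ≤ _ := (lintegral_trilinear_le hG hF hH).trans (by rw [mul_comm (_ ^ _)])

lemma lintegral_trilinear_le₂ {F G H : ℝ → ℝ≥0∞} (hF : Measurable F) (hG : Measurable G)
    (hH : Measurable H) :
    ∫⁻ p : ℝ × ℝ, F (-p.1) * H (p.1 - p.2) * G p.2 ≤
      (∫⁻ x, F x ^ 2) ^ (1 / 2 : ℝ) * (∫⁻ x, G x ^ 2) ^ (1 / 2 : ℝ) * ∫⁻ x, H x := by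
  rw [← lintegral_swap12 (ψ := fun x y z => F x * H y * G z)]
  calc _ = ∫⁻ p : ℝ × ℝ, H (-p.1) * F (p.1 - p.2) * G p.2 := by
        congr 1; ext p; ring
    _ ≤ _ := lintegral_trilinear_le₁ hF hG hH

/-- Young's inequality `L² * L¹ ⊂ L²`. -/
lemma lintegral_conv_sq_le {F G : ℝ → ℝ≥0∞} (hF : Measurable F) (hG : Measurable G) :
    ∫⁻ k : ℝ, (∫⁻ m : ℝ, F (k - m) * G m) ^ 2 ≤ (∫⁻ x, F x ^ 2) * (∫⁻ x, G x) ^ 2 := by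
  have h1 : ∀ k : ℝ, (∫⁻ m : ℝ, F (k - m) * G m) ^ 2
      ≤ (∫⁻ m : ℝ, F (k - m) ^ 2 * G m) * ∫⁻ m, G m := by
    intro k
    -- Cauchy–Schwarz for the measure `G(m) dm`, against the constant function `1`.
    have := sq_lintegral_mul_le (μ := volume.withDensity G) (F := fun m => F (k - m))
      (G := fun _ => 1) (by fun_prop) (by fun_prop)
    simp only [mul_one, one_pow] at this
    rw [lintegral_withDensity_eq_lintegral_mul _ hG (by fun_prop),
      lintegral_withDensity_eq_lintegral_mul _ hG (by fun_prop),
      lintegral_withDensity_eq_lintegral_mul _ hG (by fun_prop)] at this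
    simp only [Pi.mul_apply, mul_one] at this
    simpa only [mul_comm] using this
  calc ∫⁻ k : ℝ, (∫⁻ m : ℝ, F (k - m) * G m) ^ 2
      ≤ ∫⁻ k : ℝ, (∫⁻ m : ℝ, F (k - m) ^ 2 * G m) * ∫⁻ m, G m := lintegral_mono h1
    _ = (∫⁻ k : ℝ, ∫⁻ m : ℝ, F (k - m) ^ 2 * G m) * ∫⁻ m, G m := by
        rw [lintegral_mul_const]
        exact Measurable.lintegral_prod_right' (f := fun p : ℝ × ℝ => F (p.1 - p.2) ^ 2 * G p.2)
          (by fun_prop)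
    _ = (∫⁻ m : ℝ, ∫⁻ k : ℝ, F (k - m) ^ 2 * G m) * ∫⁻ m, G m := by
        rw [lintegral_lintegral_swap]
        exact Measurable.aemeasurable (by unfold Function.uncurry; fun_prop)
    _ = (∫⁻ x, F x ^ 2) * (∫⁻ x, G x) ^ 2 := by
        have : ∀ m, ∫⁻ k : ℝ, F (k - m) ^ 2 * G m = (∫⁻ x, F x ^ 2) * G m := by
          intro m
          rw [lintegral_mul_const _ (by fun_prop), lintegral_sub_right_eq_self (fun x => F x ^ 2)]
        simp_rw [this]
        rw [lintegral_const_mul _ hG, sq, mul_assoc]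

/-! ## The bilinear Fourier integral operator of a kernel -/

/-- `∫ b(-k, k-m, m) f(k-m) g(m) dm`. -/
def conv (b : ℝ → ℝ → ℝ → ℂ) (f g : ℝ → ℂ) (k : ℝ) : ℂ :=
  ∫ m : ℝ, b (-k) (k - m) m * f (k - m) * g m

/-- The weighted modulus `φ |f|`. -/
def wmod (φ : ℝ → ℝ) (f : ℝ → ℂ) (x : ℝ) : ℝ≥0∞ := ENNReal.ofReal (φ x) * ‖f x‖ₑ

/-- The weight `1 + |x|`. -/
def w1 (x : ℝ) : ℝ := 1 + |x|

/-- The weight `1 + x²`. -/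
def w2 (x : ℝ) : ℝ := 1 + x ^ 2

lemma w1_pos (x : ℝ) : 0 < w1 x := by unfold w1; positivity
lemma w2_pos (x : ℝ) : 0 < w2 x := by unfold w2; positivity
lemma measurable_w1 : Measurable w1 := by unfold w1; fun_prop
lemma measurable_w2 : Measurable w2 := by unfold w2; fun_prop

lemma measurable_wmod {φ : ℝ → ℝ} {f : ℝ → ℂ} (hφ : Measurable φ) (hf : Measurable f) :
    Measurable (wmod φ f) := by
  unfold wmod; fun_prop

lemma w1_le (x : ℝ) : w1 x ≤ 2 * w2 x := by
  unfold w1 w2; rw [← sq_abs x]; nlinarith [sq_nonneg (|x| - 1), abs_nonneg x]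

lemma w1_sq_le (x : ℝ) : w1 x ^ 2 ≤ 2 * w2 x := by
  unfold w1 w2; rw [← sq_abs x]; nlinarith [sq_nonneg (|x| - 1), abs_nonneg x]

lemma wmod_add_le (φ : ℝ → ℝ) (f g : ℝ → ℂ) (x : ℝ) :
    wmod φ (fun x => f x + g x) x ≤ wmod φ f x + wmod φ g x := by
  unfold wmod
  rw [← mul_add]
  gcongr
  exact enorm_add_le _ _

lemma conv_congr {b : ℝ → ℝ → ℝ → ℂ} {f f' g g' : ℝ → ℂ} (hf : f =ᵐ[volume] f')
    (hg : g =ᵐ[volume] g') : conv b f g = conv b f' g' := by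
  ext k
  apply integral_congr_ae
  have h1 : ∀ᵐ m : ℝ, f (k - m) = f' (k - m) :=
    (quasiMeasurePreserving_sub_left volume k).ae hf
  filter_upwards [h1, hg] with m h1 h2
  rw [h1, h2]

section Bound

variable {a : ℝ → ℝ → ℝ → ℂ} {φ : ℝ → ℝ} {D : ℝ} {f g : ℝ → ℂ}

lemma measurable_conv_integrand (ha : Measurable (fun p : ℝ × ℝ × ℝ => a p.1 p.2.1 p.2.2))
    (hf : Measurable f) (hg : Measurable g) :
    Measurable (fun p : ℝ × ℝ => a (-p.1) (p.1 - p.2) p.2 * f (p.1 - p.2) * g p.2) := by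
  have h1 : Measurable (fun p : ℝ × ℝ => a (-p.1) (p.1 - p.2) p.2) :=
    ha.comp (g := fun p : ℝ × ℝ × ℝ => a p.1 p.2.1 p.2.2)
      (f := fun p : ℝ × ℝ => (-p.1, p.1 - p.2, p.2)) (by fun_prop)
  fun_prop

lemma measurable_conv (ha : Measurable (fun p : ℝ × ℝ × ℝ => a p.1 p.2.1 p.2.2))
    (hf : Measurable f) (hg : Measurable g) : Measurable (conv a f g) :=
  ((measurable_conv_integrand ha hf hg).stronglyMeasurable.integral_prod_right').measurable

lemma enorm_conv_integrand_le
    (hb : ∀ y z, ‖a (-(y + z)) y z‖ ≤ D * φ y * φ z) (hD : 0 ≤ D) (hφ : ∀ x, 0 ≤ φ x) (k m : ℝ) :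
    ‖a (-k) (k - m) m * f (k - m) * g m‖ₑ
      ≤ ENNReal.ofReal D * (wmod φ f (k - m) * wmod φ g m) := by
  have h := hb (k - m) m
  rw [sub_add_cancel] at h
  have h2 : ‖a (-k) (k - m) m‖ₑ
      ≤ ENNReal.ofReal D * ENNReal.ofReal (φ (k - m)) * ENNReal.ofReal (φ m) := by
    rw [← ENNReal.ofReal_mul hD, ← ENNReal.ofReal_mul (mul_nonneg hD (hφ _)), ← ofReal_norm]
    exact ENNReal.ofReal_le_ofReal h
  rw [enorm_mul, enorm_mul, wmod, wmod]
  calc _ ≤ ENNReal.ofReal D * ENNReal.ofReal (φ (k - m)) * ENNReal.ofReal (φ m)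
        * ‖f (k - m)‖ₑ * ‖g m‖ₑ := by gcongr
    _ = _ := by ring

lemma lintegral_conv_integrand_sq_le
    (hb : ∀ y z, ‖a (-(y + z)) y z‖ ≤ D * φ y * φ z) (hD : 0 ≤ D) (hφ : ∀ x, 0 ≤ φ x)
    (hφm : Measurable φ) (hf : Measurable f) (hg : Measurable g) :
    ∫⁻ k : ℝ, (∫⁻ m : ℝ, ‖a (-k) (k - m) m * f (k - m) * g m‖ₑ) ^ 2
      ≤ ENNReal.ofReal D ^ 2 * ((∫⁻ x, wmod φ f x ^ 2) * (∫⁻ x, wmod φ g x) ^ 2) := by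
  have hF := measurable_wmod hφm hf
  have hG := measurable_wmod hφm hg
  calc _ ≤ ∫⁻ k : ℝ, (ENNReal.ofReal D * ∫⁻ m : ℝ, wmod φ f (k - m) * wmod φ g m) ^ 2 := by
        gcongr with k
        rw [← lintegral_const_mul _ (by fun_prop)]
        exact lintegral_mono fun m => enorm_conv_integrand_le hb hD hφ k m
    _ = ENNReal.ofReal D ^ 2 * ∫⁻ k : ℝ, (∫⁻ m : ℝ, wmod φ f (k - m) * wmod φ g m) ^ 2 := by
        simp_rw [mul_pow]
        rw [lintegral_const_mul]
        have : Measurable fun k : ℝ => ∫⁻ m : ℝ, wmod φ f (k - m) * wmod φ g m :=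
          Measurable.lintegral_prod_right'
            (f := fun p : ℝ × ℝ => wmod φ f (p.1 - p.2) * wmod φ g p.2) (by fun_prop)
        fun_prop
    _ ≤ _ := by
        gcongr
        exact lintegral_conv_sq_le hF hG

lemma lintegral_conv_sq_le' (hb : ∀ y z, ‖a (-(y + z)) y z‖ ≤ D * φ y * φ z) (hD : 0 ≤ D)
    (hφ : ∀ x, 0 ≤ φ x) (hφm : Measurable φ) (hf : Measurable f) (hg : Measurable g) :
    ∫⁻ k : ℝ, ‖conv a f g k‖ₑ ^ 2
      ≤ ENNReal.ofReal D ^ 2 * ((∫⁻ x, wmod φ f x ^ 2) * (∫⁻ x, wmod φ g x) ^ 2) := by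
  refine le_trans ?_ (lintegral_conv_integrand_sq_le hb hD hφ hφm hf hg)
  gcongr with k
  exact enorm_integral_le_lintegral_enorm _

lemma ae_integrable_conv (ha : Measurable (fun p : ℝ × ℝ × ℝ => a p.1 p.2.1 p.2.2))
    (hb : ∀ y z, ‖a (-(y + z)) y z‖ ≤ D * φ y * φ z) (hD : 0 ≤ D)
    (hφ : ∀ x, 0 ≤ φ x) (hφm : Measurable φ) (hf : Measurable f) (hg : Measurable g)
    (hf2 : ∫⁻ x, wmod φ f x ^ 2 < ⊤) (hg1 : ∫⁻ x, wmod φ g x < ⊤) :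
    ∀ᵐ k : ℝ, Integrable (fun m : ℝ => a (-k) (k - m) m * f (k - m) * g m) := by
  have h := lintegral_conv_integrand_sq_le hb hD hφ hφm hf hg
  have hm := measurable_conv_integrand ha hf hg
  have hm2 : Measurable fun k : ℝ => ∫⁻ m : ℝ, ‖a (-k) (k - m) m * f (k - m) * g m‖ₑ :=
    Measurable.lintegral_prod_right' (f := fun p : ℝ × ℝ =>
      ‖a (-p.1) (p.1 - p.2) p.2 * f (p.1 - p.2) * g p.2‖ₑ) hm.enorm
  have hfin : ∫⁻ k : ℝ, (∫⁻ m : ℝ, ‖a (-k) (k - m) m * f (k - m) * g m‖ₑ) ^ 2 ≠ ⊤ := by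
    refine (h.trans_lt ?_).ne
    exact ENNReal.mul_lt_top (ENNReal.pow_lt_top ENNReal.ofReal_lt_top)
      (ENNReal.mul_lt_top hf2 (ENNReal.pow_lt_top hg1))
  filter_upwards [ae_lt_top (hm2.pow_const 2) hfin] with k hk
  refine ⟨(hm.comp (g := fun p : ℝ × ℝ => a (-p.1) (p.1 - p.2) p.2 * f (p.1 - p.2) * g p.2)
    (measurable_prodMk_left (x := k))).aestronglyMeasurable, ?_⟩
  rw [hasFiniteIntegral_iff_enorm]
  by_contra hc
  rw [not_lt, top_le_iff] at hc
  rw [hc] at hk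
  simp at hk

end Bound

/-- Functions in the weighted spaces in which the bilinear operator is defined. -/
structure Reg (f : ℝ → ℂ) : Prop where
  meas : Measurable f
  l2 : ∫⁻ x, wmod w1 f x ^ 2 < ⊤
  l1 : ∫⁻ x, wmod w1 f x < ⊤

lemma wmod_neg (φ : ℝ → ℝ) (f : ℝ → ℂ) (x : ℝ) :
    wmod φ (fun x => -f x) x = wmod φ f x := by simp [wmod]

lemma Reg.neg {f : ℝ → ℂ} (hf : Reg f) : Reg (fun x => -f x) :=
  ⟨hf.meas.neg, by simpa only [wmod_neg] using hf.l2, by simpa only [wmod_neg] using hf.l1⟩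

lemma add_sq_le_ennreal (a b : ℝ≥0∞) : (a + b) ^ 2 ≤ 2 * (a ^ 2 + b ^ 2) := by
  have := ENNReal.rpow_add_le_mul_rpow_add_rpow a b (p := 2) (by norm_num)
  norm_num at this
  exact this

lemma Reg.add {f g : ℝ → ℂ} (hf : Reg f) (hg : Reg g) : Reg (fun x => f x + g x) := by
  have hmf := measurable_wmod measurable_w1 hf.meas
  have hmg := measurable_wmod measurable_w1 hg.meas
  refine ⟨hf.meas.add hg.meas, ?_, ?_⟩
  · calc ∫⁻ x, wmod w1 (fun x => f x + g x) x ^ 2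
        ≤ ∫⁻ x, 2 * (wmod w1 f x ^ 2 + wmod w1 g x ^ 2) := by
          gcongr with x
          refine le_trans ?_ (add_sq_le_ennreal _ _)
          gcongr
          exact wmod_add_le _ _ _ _
      _ = 2 * ((∫⁻ x, wmod w1 f x ^ 2) + ∫⁻ x, wmod w1 g x ^ 2) := by
          rw [lintegral_const_mul _ (by fun_prop), lintegral_add_left (by fun_prop)]
      _ < ⊤ := ENNReal.mul_lt_top (by simp) (ENNReal.add_lt_top.mpr ⟨hf.l2, hg.l2⟩)
  · calc ∫⁻ x, wmod w1 (fun x => f x + g x) x ≤ ∫⁻ x, (wmod w1 f x + wmod w1 g x) :=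
          lintegral_mono fun x => wmod_add_le _ _ _ _
      _ = _ := lintegral_add_left hmf _
      _ < ⊤ := ENNReal.add_lt_top.mpr ⟨hf.l1, hg.l1⟩

namespace AdmissibleKernel

variable {b : ℝ → ℝ → ℝ → ℂ} {C : ℝ}

lemma bound_w1 (h : AdmissibleKernel b C) (y z : ℝ) :
    ‖b (-(y + z)) y z‖ ≤ 2 * C * w1 y * w1 z :=
  h.bound_pair (by ring)

lemma two_nonneg (h : AdmissibleKernel b C) : 0 ≤ 2 * C := by have := h.nonneg; positivity

lemma ae_integrable (h : AdmissibleKernel b C) {f g : ℝ → ℂ} (hf : Reg f) (hg : Reg g) :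
    ∀ᵐ k : ℝ, Integrable (fun m : ℝ => b (-k) (k - m) m * f (k - m) * g m) :=
  ae_integrable_conv h.meas h.bound_w1 h.two_nonneg (fun x => (w1_pos x).le) measurable_w1
    hf.meas hg.meas hf.l2 hg.l1

lemma conv_sq_le (h : AdmissibleKernel b C) {f g : ℝ → ℂ} (hf : Reg f) (hg : Reg g) :
    ∫⁻ k : ℝ, ‖conv b f g k‖ₑ ^ 2 ≤
      ENNReal.ofReal (2 * C) ^ 2 * ((∫⁻ x, wmod w1 f x ^ 2) * (∫⁻ x, wmod w1 g x) ^ 2) :=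
  lintegral_conv_sq_le' h.bound_w1 h.two_nonneg (fun x => (w1_pos x).le) measurable_w1
    hf.meas hg.meas

lemma memLp_conv (h : AdmissibleKernel b C) {f g : ℝ → ℂ} (hf : Reg f) (hg : Reg g) :
    MemLp (conv b f g) 2 := by
  refine ⟨(measurable_conv h.meas hf.meas hg.meas).aestronglyMeasurable, ?_⟩
  rw [eLpNorm_lt_top_iff_lintegral_rpow_enorm_lt_top (by norm_num) (by norm_num)]
  simp only [ENNReal.toReal_ofNat, ENNReal.rpow_ofNat]
  refine (h.conv_sq_le hf hg).trans_lt ?_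
  exact ENNReal.mul_lt_top (ENNReal.pow_lt_top ENNReal.ofReal_lt_top)
      (ENNReal.mul_lt_top hf.l2 (ENNReal.pow_lt_top hg.l1))

lemma conv_comm (h : AdmissibleKernel b C) (f g : ℝ → ℂ) : conv b f g = conv b g f := by
  ext k
  unfold conv
  rw [← integral_sub_left_eq_self _ volume k]
  congr 1
  ext m
  rw [sub_sub_cancel, h.swap23]
  ring

lemma conv_conj (h : AdmissibleKernel b C) {f g : ℝ → ℂ} (hf : ∀ k, f (-k) = conj (f k))
    (hg : ∀ k, g (-k) = conj (g k)) (k : ℝ) : conv b f g (-k) = conj (conv b f g k) := by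
  unfold conv
  rw [← integral_conj, ← integral_neg_eq_self]
  congr 1
  ext m
  rw [show -k - -m = -(k - m) by ring, h.neg, hf, hg]
  simp

lemma conv_add_left (h : AdmissibleKernel b C) {f₁ f₂ g : ℝ → ℂ} (h1 : Reg f₁) (h2 : Reg f₂)
    (hg : Reg g) :
    conv b (fun x => f₁ x + f₂ x) g =ᵐ[volume] fun k => conv b f₁ g k + conv b f₂ g k := by
  filter_upwards [h.ae_integrable h1 hg, h.ae_integrable h2 hg] with k i1 i2
  unfold conv
  rw [← integral_add i1 i2]
  congr 1
  ext m
  ring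

end AdmissibleKernel

/-! ## Energy estimates -/

/-- The right-hand side of the amplitude equation in Fourier variables. -/
def amp (c : ℝ) (b : ℝ → ℝ → ℝ → ℂ) (f g : ℝ → ℂ) (k : ℝ) : ℂ :=
  Complex.I * sg k * (c : ℂ)⁻¹ * conv b f g k

namespace AdmissibleKernel

variable {b : ℝ → ℝ → ℝ → ℂ} {C : ℝ}

lemma integrable_pairing (h : AdmissibleKernel b C) {u f g : ℝ → ℂ} (hu : Measurable u)
    (hu2 : ∫⁻ x, ‖u x‖ₑ ^ 2 < ⊤) (hf : Reg f) (hg : Reg g) :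
    Integrable (fun p : ℝ × ℝ =>
      u (-p.1) * (b (-p.1) (p.1 - p.2) p.2 * f (p.1 - p.2) * g p.2)) := by
  have hm := measurable_conv_integrand h.meas hf.meas hg.meas
  refine ⟨(Measurable.mul (by fun_prop) hm).aestronglyMeasurable, ?_⟩
  rw [hasFiniteIntegral_iff_enorm]
  have hF := measurable_wmod measurable_w1 hf.meas
  have hG := measurable_wmod measurable_w1 hg.meas
  calc ∫⁻ p : ℝ × ℝ, ‖u (-p.1) * (b (-p.1) (p.1 - p.2) p.2 * f (p.1 - p.2) * g p.2)‖ₑ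
      ≤ ∫⁻ p : ℝ × ℝ, ENNReal.ofReal (2 * C) *
          (‖u (-p.1)‖ₑ * wmod w1 f (p.1 - p.2) * wmod w1 g p.2) := by
        gcongr with p
        rw [enorm_mul]
        have := enorm_conv_integrand_le (f := f) (g := g) h.bound_w1 h.two_nonneg
          (fun x => (w1_pos x).le) p.1 p.2
        calc _ ≤ ‖u (-p.1)‖ₑ * (ENNReal.ofReal (2 * C) *
              (wmod w1 f (p.1 - p.2) * wmod w1 g p.2)) := by gcongr
          _ = _ := by ring
    _ = ENNReal.ofReal (2 * C) * ∫⁻ p : ℝ × ℝ,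
          ‖u (-p.1)‖ₑ * wmod w1 f (p.1 - p.2) * wmod w1 g p.2 := by
        rw [lintegral_const_mul _ (by fun_prop)]
    _ < ⊤ := by
        refine ENNReal.mul_lt_top ENNReal.ofReal_lt_top ?_
        refine (lintegral_trilinear_le (F := fun x => ‖u x‖ₑ) (by fun_prop) hF hG).trans_lt ?_
        refine ENNReal.mul_lt_top (ENNReal.mul_lt_top ?_ ?_) hg.l1
        · exact ENNReal.rpow_lt_top_of_nonneg (by norm_num) hu2.ne
        · exact ENNReal.rpow_lt_top_of_nonneg (by norm_num) hf.l2.ne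

lemma integral_pairing (h : AdmissibleKernel b C) {u f g : ℝ → ℂ} (hu : Measurable u)
    (hu2 : ∫⁻ x, ‖u x‖ₑ ^ 2 < ⊤) (hf : Reg f) (hg : Reg g) :
    ∫ k : ℝ, u (-k) * conv b f g k =
      ∫ p : ℝ × ℝ, u (-p.1) * (b (-p.1) (p.1 - p.2) p.2 * f (p.1 - p.2) * g p.2) := by
  have hi := h.integrable_pairing hu hu2 hf hg
  rw [Measure.volume_eq_prod] at hi ⊢
  rw [integral_prod _ hi]
  congr 1
  ext k
  rw [conv, ← integral_const_mul]

lemma enorm_symbol_le {θ : ℝ → ℝ} {K : ℝ} (h : AdmissibleKernel b C) (hθ : EnergyWeight θ K)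
    (f : ℝ → ℂ) {x y z : ℝ} (h0 : x + y + z = 0) :
    ‖((sg x * θ x + sg y * θ y + sg z * θ z : ℝ) : ℂ) * (b x y z * (f x * f y * f z))‖ₑ ≤
      ENNReal.ofReal ((4 * K + 2) * C) *
        (wmod (fun x => √(θ x)) f x * wmod (fun x => √(θ x)) f y * wmod w2 f z +
          wmod w2 f x * wmod (fun x => √(θ x)) f y * wmod (fun x => √(θ x)) f z +
          wmod (fun x => √(θ x)) f x * wmod w2 f y * wmod (fun x => √(θ x)) f z) := by
  have hK := hθ.Knonneg
  have hC := h.nonneg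
  have hs := hθ.bound_symm h h0
  have h1 : ‖((sg x * θ x + sg y * θ y + sg z * θ z : ℝ) : ℂ)‖ₑ * ‖b x y z‖ₑ ≤
      ENNReal.ofReal ((4 * K + 2) * C * (w2 z * (√(θ x) * √(θ y)) +
        w2 x * (√(θ y) * √(θ z)) + w2 y * (√(θ x) * √(θ z)))) := by
    rw [← enorm_mul, ← ofReal_norm, norm_mul, Complex.norm_real, Real.norm_eq_abs]
    exact ENNReal.ofReal_le_ofReal hs
  rw [ENNReal.ofReal_mul (by positivity), ENNReal.ofReal_add
    (by have := (w2_pos z).le; have := (w2_pos x).le; positivity)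
    (by have := (w2_pos y).le; positivity),
    ENNReal.ofReal_add (by have := (w2_pos z).le; positivity)
      (by have := (w2_pos x).le; positivity),
    ENNReal.ofReal_mul (w2_pos _).le, ENNReal.ofReal_mul (w2_pos _).le,
    ENNReal.ofReal_mul (w2_pos _).le, ENNReal.ofReal_mul (Real.sqrt_nonneg _),
    ENNReal.ofReal_mul (Real.sqrt_nonneg _), ENNReal.ofReal_mul (Real.sqrt_nonneg _)] at h1
  rw [enorm_mul, enorm_mul, ← mul_assoc, enorm_mul, enorm_mul]
  refine (mul_le_mul_left h1 _).trans (le_of_eq ?_)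
  unfold wmod
  ring

/-- The weighted energy estimate. -/
lemma energy_le {θ : ℝ → ℝ} {K : ℝ} (h : AdmissibleKernel b C) (hθ : EnergyWeight θ K)
    {f : ℝ → ℂ} (hf : Reg f) (hθf : ∫⁻ x, wmod θ f x ^ 2 < ⊤) (c : ℝ) :
    ‖∫ k : ℝ, θ k * f (-k) * amp c b f f k‖ₑ ≤
      ENNReal.ofReal (|c⁻¹| * ((4 * K + 2) * C)) *
        ((∫⁻ x, wmod w2 f x) * ∫⁻ x, wmod (fun x => √(θ x)) f x ^ 2) := by
  have hfm := hf.meas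
  have hθm := hθ.meas
  set u : ℝ → ℂ := fun x => (θ x * sg x : ℝ) * f x with hu
  have hsm := measurable_sg
  have hum : Measurable u := by
    have : Measurable fun x => (θ x * sg x : ℝ) := hθm.mul hsm
    exact (Complex.measurable_ofReal.comp this).mul hfm
  -- Purely qualitative: this makes the integral converge before symmetrisation, and its size does
  -- not enter the estimate.
  have hu2 : ∫⁻ x, ‖u x‖ₑ ^ 2 < ⊤ := by
    refine lt_of_le_of_lt (lintegral_mono fun x => ?_) hθf
    gcongr
    rw [hu, wmod, enorm_mul, ← ofReal_norm, Complex.norm_real, Real.norm_eq_abs, abs_mul,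
      abs_of_nonneg (hθ.nonneg x)]
    gcongr
    exact mul_le_of_le_one_right (hθ.nonneg x) (abs_sg_le x)
  set Ψ : ℝ → ℝ → ℝ → ℂ := fun x y z => u x * (b x y z * f y * f z) with hΨ
  have hi : Integrable (fun p : ℝ × ℝ => Ψ (-p.1) (p.1 - p.2) p.2) :=
    h.integrable_pairing hum hu2 hf hf
  have e1 : ∫ k : ℝ, θ k * f (-k) * amp c b f f k
      = -(Complex.I * (c : ℂ)⁻¹) * ∫ p : ℝ × ℝ, Ψ (-p.1) (p.1 - p.2) p.2 := by
    rw [← h.integral_pairing hum hu2 hf hf, ← integral_const_mul]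
    congr 1
    ext k
    simp only [hu, amp, hθ.even, sg_neg]
    push_cast
    ring
  have i12 : Integrable (fun p : ℝ × ℝ => Ψ (p.1 - p.2) (-p.1) p.2) := by
    have := (measurePreserving_swapA.integrable_comp_emb swapA.measurableEmbedding).mpr hi
    refine this.congr (Eventually.of_forall fun p => ?_)
    simp [swapA_apply]
  have i13 : Integrable (fun p : ℝ × ℝ => Ψ p.2 (p.1 - p.2) (-p.1)) := by
    have := (measurePreserving_swapB.integrable_comp_emb swapB.measurableEmbedding).mpr hi
    refine this.congr (Eventually.of_forall fun p => ?_)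
    simp [swapB_apply, neg_add_eq_sub]
  -- The points `(-p.1, p.1 - p.2, p.2)` run over the plane `x + y + z = 0`, and exchanging two
  -- frequencies preserves the measure. The integral is thus a third of that of the symmetrised
  -- integrand, and only the latter is estimated in absolute value.
  have e2 : 3 * ∫ p : ℝ × ℝ, Ψ (-p.1) (p.1 - p.2) p.2
      = ∫ p : ℝ × ℝ, (Ψ (-p.1) (p.1 - p.2) p.2 + Ψ (p.1 - p.2) (-p.1) p.2
        + Ψ p.2 (p.1 - p.2) (-p.1)) := by
    have hadd : Integrable
        (fun p : ℝ × ℝ => Ψ (-p.1) (p.1 - p.2) p.2 + Ψ (p.1 - p.2) (-p.1) p.2) := hi.add i12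
    rw [integral_add hadd i13, integral_add hi i12, integral_swap12, integral_swap13]
    ring
  have e3 : ∀ x y z, Ψ x y z + Ψ y x z + Ψ z y x =
      ((sg x * θ x + sg y * θ y + sg z * θ z : ℝ) : ℂ) * (b x y z * (f x * f y * f z)) := by
    intro x y z
    simp only [hΨ, hu]
    rw [← h.swap12 x y z, ← h.swap13 x y z]
    push_cast
    ring
  set F := wmod (fun x => √(θ x)) f with hF
  set W := wmod w2 f with hW
  have hFm : Measurable F := measurable_wmod (by fun_prop) hfm
  have hWm : Measurable W := measurable_wmod measurable_w2 hfm
  have e4 : ‖3 * ∫ p : ℝ × ℝ, Ψ (-p.1) (p.1 - p.2) p.2‖ₑ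
      ≤ ENNReal.ofReal ((4 * K + 2) * C) * (3 * ((∫⁻ x, F x ^ 2) * ∫⁻ x, W x)) := by
    rw [e2]
    refine (enorm_integral_le_lintegral_enorm _).trans ?_
    calc _ ≤ ∫⁻ p : ℝ × ℝ, ENNReal.ofReal ((4 * K + 2) * C) *
          (F (-p.1) * F (p.1 - p.2) * W p.2 + W (-p.1) * F (p.1 - p.2) * F p.2 +
            F (-p.1) * W (p.1 - p.2) * F p.2) := by
          refine lintegral_mono fun p => ?_
          rw [e3]
          exact h.enorm_symbol_le hθ f (by ring)
      _ = ENNReal.ofReal ((4 * K + 2) * C) *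
          ((∫⁻ p : ℝ × ℝ, F (-p.1) * F (p.1 - p.2) * W p.2) +
            (∫⁻ p : ℝ × ℝ, W (-p.1) * F (p.1 - p.2) * F p.2) +
            ∫⁻ p : ℝ × ℝ, F (-p.1) * W (p.1 - p.2) * F p.2) := by
          rw [lintegral_const_mul _ (by fun_prop), lintegral_add_left (by fun_prop),
            lintegral_add_left (by fun_prop)]
      _ ≤ _ := by
          have hsq : (∫⁻ x, F x ^ 2) ^ (1 / 2 : ℝ) * (∫⁻ x, F x ^ 2) ^ (1 / 2 : ℝ)
              = ∫⁻ x, F x ^ 2 := by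
            rw [← ENNReal.rpow_add_of_nonneg _ _ (by norm_num) (by norm_num)]
            norm_num
          have t1 := lintegral_trilinear_le hFm hFm hWm
          have t2 := lintegral_trilinear_le₁ hFm hFm hWm
          have t3 := lintegral_trilinear_le₂ hFm hFm hWm
          rw [hsq] at t1 t2 t3
          gcongr
          calc _ ≤ (∫⁻ x, F x ^ 2) * (∫⁻ x, W x) + (∫⁻ x, F x ^ 2) * (∫⁻ x, W x)
                + (∫⁻ x, F x ^ 2) * (∫⁻ x, W x) := by gcongr
            _ = _ := by ring
  have e5 : ‖∫ p : ℝ × ℝ, Ψ (-p.1) (p.1 - p.2) p.2‖ₑ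
      ≤ ENNReal.ofReal ((4 * K + 2) * C) * ((∫⁻ x, F x ^ 2) * ∫⁻ x, W x) := by
    rw [enorm_mul, show ‖(3 : ℂ)‖ₑ = 3 by rw [← ofReal_norm]; simp,
      show ∀ a b : ℝ≥0∞, a * (3 * b) = 3 * (a * b) from fun a b => by ring] at e4
    exact (ENNReal.mul_le_mul_iff_right (by norm_num) (by norm_num)).mp e4
  rw [e1, enorm_mul, show ‖-(Complex.I * (c : ℂ)⁻¹)‖ₑ = ENNReal.ofReal |c⁻¹| by
    rw [← ofReal_norm]; simp, ENNReal.ofReal_mul (abs_nonneg _), mul_assoc]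
  gcongr
  rw [mul_comm (∫⁻ x, W x)]
  exact e5

/-- The `L²` estimate for differences. -/
lemma diff_le (h : AdmissibleKernel b C) {f g : ℝ → ℂ} (hf : Reg f) (hg : Reg g)
    (hf2 : ∫⁻ x, ‖f x‖ₑ ^ 2 < ⊤) (c : ℝ) :
    ‖∫ k : ℝ, f (-k) * amp c b f g k‖ₑ ≤
      ENNReal.ofReal (|c⁻¹| * (4 * C)) * ((∫⁻ x, wmod w2 g x) * ∫⁻ x, ‖f x‖ₑ ^ 2) := by
  have hfm := hf.meas
  have hC := h.nonneg
  set u : ℝ → ℂ := fun x => (sg x : ℝ) * f x with hu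
  have hsm := measurable_sg
  have hum : Measurable u := (Complex.measurable_ofReal.comp hsm).mul hfm
  have hu2 : ∫⁻ x, ‖u x‖ₑ ^ 2 < ⊤ := by
    refine lt_of_le_of_lt (lintegral_mono fun x => ?_) hf2
    gcongr
    rw [hu, enorm_mul, ← ofReal_norm, Complex.norm_real, Real.norm_eq_abs]
    exact mul_le_of_le_one_left (by positivity) (by simpa using abs_sg_le x)
  set Ψ : ℝ → ℝ → ℝ → ℂ := fun x y z => u x * (b x y z * f y * g z) with hΨ
  have hi : Integrable (fun p : ℝ × ℝ => Ψ (-p.1) (p.1 - p.2) p.2) :=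
    h.integrable_pairing hum hu2 hf hg
  have e1 : ∫ k : ℝ, f (-k) * amp c b f g k
      = -(Complex.I * (c : ℂ)⁻¹) * ∫ p : ℝ × ℝ, Ψ (-p.1) (p.1 - p.2) p.2 := by
    rw [← h.integral_pairing hum hu2 hf hg, ← integral_const_mul]
    congr 1
    ext k
    simp only [hu, amp, sg_neg]
    push_cast
    ring
  have i12 : Integrable (fun p : ℝ × ℝ => Ψ (p.1 - p.2) (-p.1) p.2) := by
    have := (measurePreserving_swapA.integrable_comp_emb swapA.measurableEmbedding).mpr hi
    refine this.congr (Eventually.of_forall fun p => ?_)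
    simp [swapA_apply]
  -- Only the first two frequencies carry the same function `f`, so the symmetrisation is over these
  -- two.
  have e2 : 2 * ∫ p : ℝ × ℝ, Ψ (-p.1) (p.1 - p.2) p.2
      = ∫ p : ℝ × ℝ, (Ψ (-p.1) (p.1 - p.2) p.2 + Ψ (p.1 - p.2) (-p.1) p.2) := by
    rw [integral_add hi i12, integral_swap12]
    ring
  have e3 : ∀ x y z, Ψ x y z + Ψ y x z =
      ((sg x + sg y : ℝ) : ℂ) * b x y z * (f x * f y * g z) := by
    intro x y z
    simp only [hΨ, hu]
    rw [← h.swap12 x y z]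
    push_cast
    ring
  set W := wmod w2 g with hW
  have hWm : Measurable W := measurable_wmod measurable_w2 hg.meas
  have e4 : ‖2 * ∫ p : ℝ × ℝ, Ψ (-p.1) (p.1 - p.2) p.2‖ₑ
      ≤ ENNReal.ofReal (4 * C) * ((∫⁻ x, ‖f x‖ₑ ^ 2) * ∫⁻ x, W x) := by
    rw [e2]
    refine (enorm_integral_le_lintegral_enorm _).trans ?_
    calc _ ≤ ∫⁻ p : ℝ × ℝ, ENNReal.ofReal (4 * C) *
          (‖f (-p.1)‖ₑ * ‖f (p.1 - p.2)‖ₑ * W p.2) := by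
          refine lintegral_mono fun p => ?_
          rw [e3]
          have := h.bound_sum_sign (x := -p.1) (y := p.1 - p.2) (z := p.2) (by ring)
          have h1 : ‖((sg (-p.1) + sg (p.1 - p.2) : ℝ) : ℂ) * b (-p.1) (p.1 - p.2) p.2‖ₑ
              ≤ ENNReal.ofReal (4 * C) * ENNReal.ofReal (w2 p.2) := by
            rw [← ENNReal.ofReal_mul (by positivity), ← ofReal_norm, norm_mul, Complex.norm_real]
            exact ENNReal.ofReal_le_ofReal this
          rw [enorm_mul, enorm_mul (_ * _) (g _), enorm_mul (f _) (f _), hW, wmod]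
          refine (mul_le_mul_left h1 _).trans (le_of_eq (by ring))
      _ = ENNReal.ofReal (4 * C) *
          ∫⁻ p : ℝ × ℝ, ‖f (-p.1)‖ₑ * ‖f (p.1 - p.2)‖ₑ * W p.2 := by
          rw [lintegral_const_mul _ (by fun_prop)]
      _ ≤ _ := by
          have hsq : (∫⁻ x, ‖f x‖ₑ ^ 2) ^ (1 / 2 : ℝ) * (∫⁻ x, ‖f x‖ₑ ^ 2) ^ (1 / 2 : ℝ)
              = ∫⁻ x, ‖f x‖ₑ ^ 2 := by
            rw [← ENNReal.rpow_add_of_nonneg _ _ (by norm_num) (by norm_num)]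
            norm_num
          have t1 := lintegral_trilinear_le (F := fun x => ‖f x‖ₑ) (G := fun x => ‖f x‖ₑ)
            (by fun_prop) (by fun_prop) hWm
          rw [hsq] at t1
          gcongr
  have e5 : ‖∫ p : ℝ × ℝ, Ψ (-p.1) (p.1 - p.2) p.2‖ₑ
      ≤ ‖2 * ∫ p : ℝ × ℝ, Ψ (-p.1) (p.1 - p.2) p.2‖ₑ := by
    rw [enorm_mul, show ‖(2 : ℂ)‖ₑ = 2 by rw [← ofReal_norm]; simp]
    exact le_mul_of_one_le_left (by positivity) (by norm_num)
  rw [e1, enorm_mul, show ‖-(Complex.I * (c : ℂ)⁻¹)‖ₑ = ENNReal.ofReal |c⁻¹| by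
    rw [← ofReal_norm]; simp, ENNReal.ofReal_mul (abs_nonneg _), mul_assoc]
  gcongr
  rw [mul_comm (∫⁻ x, W x)]
  exact e5.trans e4

end AdmissibleKernel

/-! ## Truncation in frequency -/

/-- The kernel `b` restricted to the frequencies at most `N`. -/
def trunc (N : ℝ) (b : ℝ → ℝ → ℝ → ℂ) (x y z : ℝ) : ℂ :=
  if |x| ≤ N ∧ |y| ≤ N ∧ |z| ≤ N then b x y z else 0

/-- The function `f` restricted to the frequencies at most `N`. -/
def cut (N : ℝ) (f : ℝ → ℂ) (x : ℝ) : ℂ := if |x| ≤ N then f x else 0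

/-- All three frequencies are truncated, inputs and output alike, which preserves the symmetries.
The constant `C` is unchanged, so every estimate for admissible kernels is uniform in `N`. -/
lemma AdmissibleKernel.trunc {b : ℝ → ℝ → ℝ → ℂ} {C : ℝ} (h : AdmissibleKernel b C) (N : ℝ) :
    AdmissibleKernel (trunc N b) C where
  nonneg := h.nonneg
  meas := by
    unfold SurfaceWave.trunc
    refine Measurable.ite ?_ h.meas measurable_const
    have e : {p : ℝ × ℝ × ℝ | |p.1| ≤ N ∧ |p.2.1| ≤ N ∧ |p.2.2| ≤ N}
      = {p | |p.1| ≤ N} ∩ ({p | |p.2.1| ≤ N} ∩ {p | |p.2.2| ≤ N}) := rfl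
    rw [e]
    exact (measurableSet_le (by fun_prop) (by fun_prop)).inter
      ((measurableSet_le (by fun_prop) (by fun_prop)).inter
        (measurableSet_le (by fun_prop) (by fun_prop)))
  swap12 x y z := by
    unfold SurfaceWave.trunc
    rw [h.swap12]
    congr 1
    simp only [eq_iff_iff]; tauto
  swap23 x y z := by
    unfold SurfaceWave.trunc
    rw [h.swap23]
    congr 1
    simp only [eq_iff_iff]; tauto
  neg x y z := by
    unfold SurfaceWave.trunc
    simp only [abs_neg, h.neg]
    split_ifs <;> simp
  bound x y z h0 h1 h2 := by
    unfold SurfaceWave.trunc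
    split_ifs
    · exact h.bound x y z h0 h1 h2
    · have := h.nonneg
      simp; positivity

lemma measurable_cut {f : ℝ → ℂ} (hf : Measurable f) (N : ℝ) : Measurable (cut N f) :=
  Measurable.ite (measurableSet_le (by fun_prop) (by fun_prop)) hf measurable_const

lemma conv_trunc_cut (N : ℝ) (b : ℝ → ℝ → ℝ → ℂ) (f g : ℝ → ℂ) :
    conv (trunc N b) (cut N f) (cut N g) = conv (trunc N b) f g := by
  ext k
  unfold conv
  congr 1
  ext m
  unfold trunc cut
  split_ifs <;> simp_all

lemma wmod_cut_le {φ : ℝ → ℝ} {M N : ℝ} (hφ : ∀ x, |x| ≤ N → φ x ≤ M) (f : ℝ → ℂ) (x : ℝ) :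
    wmod φ (cut N f) x ≤ ENNReal.ofReal M * ‖f x‖ₑ := by
  unfold wmod cut
  split_ifs with h
  · gcongr
    exact hφ x h
  · simp

lemma lintegral_wmod_cut_sq_le {φ : ℝ → ℝ} {M N : ℝ} (hφ : ∀ x, |x| ≤ N → φ x ≤ M)
    (f : ℝ → ℂ) :
    ∫⁻ x, wmod φ (cut N f) x ^ 2 ≤ ENNReal.ofReal M ^ 2 * ∫⁻ x, ‖f x‖ₑ ^ 2 := by
  rw [← lintegral_const_mul' _ _ (ENNReal.pow_ne_top ENNReal.ofReal_ne_top)]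
  refine lintegral_mono fun x => ?_
  rw [← mul_pow]
  gcongr
  exact wmod_cut_le hφ f x

lemma sq_lintegral_wmod_cut_le {φ : ℝ → ℝ} {M N : ℝ} (hφ : ∀ x, |x| ≤ N → φ x ≤ M)
    {f : ℝ → ℂ} (hf : Measurable f) :
    (∫⁻ x, wmod φ (cut N f) x) ^ 2 ≤
      ENNReal.ofReal M ^ 2 * ENNReal.ofReal (2 * N) * ∫⁻ x, ‖f x‖ₑ ^ 2 := by
  have h1 : ∀ x, wmod φ (cut N f) x
      ≤ ENNReal.ofReal M * ((Icc (-N) N).indicator (fun _ => 1) x * ‖f x‖ₑ) := by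
    intro x
    by_cases hx : |x| ≤ N
    · rw [indicator_of_mem (by exact abs_le.mp hx), one_mul]
      exact wmod_cut_le hφ f x
    · simp [wmod, cut, hx]
  have hi : Measurable ((Icc (-N) N).indicator (fun _ : ℝ => (1 : ℝ≥0∞))) :=
    measurable_const.indicator measurableSet_Icc
  calc (∫⁻ x, wmod φ (cut N f) x) ^ 2
      ≤ (ENNReal.ofReal M * ∫⁻ x, (Icc (-N) N).indicator (fun _ => 1) x * ‖f x‖ₑ) ^ 2 := by
        rw [← lintegral_const_mul _ (by fun_prop)]
        gcongr with x
        exact h1 x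
    _ ≤ ENNReal.ofReal M ^ 2 *
        ((∫⁻ x, (Icc (-N) N).indicator (fun _ : ℝ => (1 : ℝ≥0∞)) x ^ 2) *
          ∫⁻ x, ‖f x‖ₑ ^ 2) := by
        rw [mul_pow]
        gcongr
        exact sq_lintegral_mul_le (by fun_prop) (by fun_prop)
    _ = _ := by
        have : ∫⁻ x, (Icc (-N) N).indicator (fun _ : ℝ => (1 : ℝ≥0∞)) x ^ 2
            = ENNReal.ofReal (2 * N) := by
          have e : (fun x => (Icc (-N) N).indicator (fun _ : ℝ => (1 : ℝ≥0∞)) x ^ 2)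
              = (Icc (-N) N).indicator (fun _ => 1) := by
            ext x
            by_cases hx : x ∈ Icc (-N) N <;> simp [hx]
          rw [e, lintegral_indicator measurableSet_Icc]
          simp [two_mul]
        rw [this]
        ring

lemma w1_le_of_abs_le {N x : ℝ} (h : |x| ≤ N) : w1 x ≤ 1 + N := by unfold w1; linarith

lemma reg_cut {f : ℝ → ℂ} (hf : Measurable f) (hf2 : ∫⁻ x, ‖f x‖ₑ ^ 2 < ⊤) (N : ℝ) :
    Reg (cut N f) := by
  have hw : ∀ x, |x| ≤ N → w1 x ≤ 1 + N := fun x hx => w1_le_of_abs_le hx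
  refine ⟨measurable_cut hf N, ?_, ?_⟩
  · exact (lintegral_wmod_cut_sq_le hw f).trans_lt
      (ENNReal.mul_lt_top (ENNReal.pow_lt_top ENNReal.ofReal_lt_top) hf2)
  · have := (sq_lintegral_wmod_cut_le hw hf).trans_lt (ENNReal.mul_lt_top
      (ENNReal.mul_lt_top (ENNReal.pow_lt_top ENNReal.ofReal_lt_top) ENNReal.ofReal_lt_top) hf2)
    by_contra hc
    rw [not_lt, top_le_iff] at hc
    rw [hc] at this
    simp at this

/-- The truncated bilinear operator is bounded on `L²`. -/
lemma AdmissibleKernel.conv_trunc_sq_le {b : ℝ → ℝ → ℝ → ℂ} {C : ℝ} (h : AdmissibleKernel b C)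
    (N : ℝ) {f g : ℝ → ℂ} (hf : Measurable f) (hg : Measurable g)
    (hf2 : ∫⁻ x, ‖f x‖ₑ ^ 2 < ⊤) (hg2 : ∫⁻ x, ‖g x‖ₑ ^ 2 < ⊤) :
    ∫⁻ k, ‖conv (SurfaceWave.trunc N b) f g k‖ₑ ^ 2 ≤
      (ENNReal.ofReal (2 * C) ^ 2 * (ENNReal.ofReal (1 + N) ^ 2 *
        (ENNReal.ofReal (1 + N) ^ 2 * ENNReal.ofReal (2 * N)))) *
        ((∫⁻ x, ‖f x‖ₑ ^ 2) * ∫⁻ x, ‖g x‖ₑ ^ 2) := by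
  have hw : ∀ x, |x| ≤ N → w1 x ≤ 1 + N := fun x hx => w1_le_of_abs_le hx
  rw [← conv_trunc_cut]
  refine ((h.trunc N).conv_sq_le (reg_cut hf hf2 N) (reg_cut hg hg2 N)).trans ?_
  calc _ ≤ ENNReal.ofReal (2 * C) ^ 2 * ((ENNReal.ofReal (1 + N) ^ 2 * ∫⁻ x, ‖f x‖ₑ ^ 2) *
        (ENNReal.ofReal (1 + N) ^ 2 * ENNReal.ofReal (2 * N) * ∫⁻ x, ‖g x‖ₑ ^ 2)) := by
        gcongr
        · exact lintegral_wmod_cut_sq_le hw f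
        · exact sq_lintegral_wmod_cut_le hw hg
    _ = _ := by ring

/-- Kernels that agree on the frequencies at most `N` define operators that are close. -/
lemma AdmissibleKernel.conv_sub_sq_le {b b' : ℝ → ℝ → ℝ → ℂ} {C N : ℝ}
    (h : AdmissibleKernel b C) (h' : AdmissibleKernel b' C) (hN : 0 < N)
    (heq : ∀ x y z, |x| ≤ N → |y| ≤ N → |z| ≤ N → b x y z = b' x y z)
    {f : ℝ → ℂ} (hf : Reg f) :
    ∫⁻ k, ‖conv b f f k - conv b' f f k‖ₑ ^ 2 ≤
      ENNReal.ofReal (16 * C / N) ^ 2 *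
        ((∫⁻ x, wmod w2 f x ^ 2) * (∫⁻ x, wmod w2 f x) ^ 2) := by
  have hC := h.nonneg
  set a : ℝ → ℝ → ℝ → ℂ := fun x y z => b x y z - b' x y z with ha
  have hconv : ∀ᵐ k : ℝ, conv b f f k - conv b' f f k = conv a f f k := by
    filter_upwards [h.ae_integrable hf hf, h'.ae_integrable hf hf] with k i1 i2
    unfold conv
    rw [← integral_sub i1 i2]
    congr 1
    ext m
    simp only [ha]
    ring
  have hb : ∀ y z, ‖a (-(y + z)) y z‖ ≤ 16 * C / N * w2 y * w2 z := by
    intro y z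
    have hy := w1_pos y
    have hz := w1_pos z
    by_cases hs : |(-(y + z))| ≤ N ∧ |y| ≤ N ∧ |z| ≤ N
    · simp only [ha]
      rw [heq _ _ _ hs.1 hs.2.1 hs.2.2, sub_self, norm_zero]
      have := w2_pos y; have := w2_pos z
      positivity
    -- The kernels differ only where some frequency exceeds `N`, and there `|y| + |z| > N`.
    -- Inserting the factor `w1 y * w1 z / N ≥ 1` buys the `1/N` at the price of one more power of
    -- the input frequencies. The constant `16` is `4` from two kernel bounds `2C`, times `2 · 2`
    -- from `w1_sq_le`.
    · have hlow : N ≤ w1 y * w1 z := by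
        have h1 : |(-(y + z))| ≤ |y| + |z| := by rw [abs_neg]; exact abs_add_le y z
        have hay := abs_nonneg y
        have haz := abs_nonneg z
        have h2 : |y| + |z| ≤ w1 y * w1 z := by unfold w1; nlinarith
        by_contra hc
        push Not at hc
        exact hs ⟨by linarith, by linarith, by linarith⟩
      have e1 : ‖a (-(y + z)) y z‖ ≤ 4 * C * (w1 y * w1 z) := by
        refine (norm_sub_le _ _).trans ?_
        have := h.bound_w1 y z
        have := h'.bound_w1 y z
        linarith
      have e2 : 4 * C * (w1 y * w1 z) ≤ 4 * C * (w1 y * w1 z) * ((w1 y * w1 z) / N) := by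
        refine le_mul_of_one_le_right (by positivity) ?_
        rwa [le_div_iff₀ hN, one_mul]
      have e3 : w1 y ^ 2 * w1 z ^ 2 ≤ (2 * w2 y) * (2 * w2 z) :=
        mul_le_mul (w1_sq_le y) (w1_sq_le z) (by positivity) (by have := w2_pos y; positivity)
      calc _ ≤ _ := e1.trans e2
        _ = 4 * C / N * (w1 y ^ 2 * w1 z ^ 2) := by ring
        _ ≤ 4 * C / N * ((2 * w2 y) * (2 * w2 z)) := by gcongr
        _ = _ := by ring
  rw [lintegral_congr_ae (g := fun k => ‖conv a f f k‖ₑ ^ 2)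
    (by filter_upwards [hconv] with k hk; rw [hk])]
  exact lintegral_conv_sq_le' hb (by positivity) (fun x => (w2_pos x).le) measurable_w2
    hf.meas hf.meas

/-! ## The weights -/

/-- `1 + |k| (1 + k²)^σ`. -/
def wX (σ : ℝ) (k : ℝ) : ℝ := 1 + |k| * (1 + k ^ 2) ^ σ

/-- `θ(k) min(1, |k|/ρ)`: the weight `θ` with the frequencies below `ρ` damped. -/
def tailW (ρ : ℝ) (θ : ℝ → ℝ) (k : ℝ) : ℝ := θ k * min 1 (|k| / ρ)

/-- By convexity, the function lies below its chord on `[0, 1]`. -/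
lemma one_add_rpow_le {u q : ℝ} (hu0 : 0 ≤ u) (hu1 : u ≤ 1) (hq : 1 ≤ q) :
    (1 + u) ^ q ≤ 1 + 2 ^ q * u := by
  have h := (convexOn_rpow hq).2 (show (1 : ℝ) ∈ Ici 0 by simp) (show (2 : ℝ) ∈ Ici 0 by simp)
    (show 0 ≤ 1 - u by linarith) hu0 (by ring)
  simp only [smul_eq_mul, mul_one, Real.one_rpow] at h
  rw [show 1 - u + u * 2 = 1 + u by ring] at h
  nlinarith

/-- With `r = |x|` and `t = |z|`, one has `1 + (r+t)² ≤ (1 + t/r)² (1 + r²)`, and the chord bound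
with exponent `2σ` gives the relative growth `B t/r` for the power, `B = 2^(2σ)`. The factor `|k|`
contributes `t/r` more, and the product of the two increments is absorbed using `t ≤ r`; hence `2B +
1`. -/
lemma energyWeight_wX {σ : ℝ} (hσ : 1 ≤ σ) : EnergyWeight (wX σ) (2 * 2 ^ (2 * σ) + 1) where
  Knonneg := by positivity
  meas := by unfold wX; fun_prop
  nonneg x := by unfold wX; positivity
  mono x y h := by
    unfold wX
    have : x ^ 2 ≤ y ^ 2 := sq_le_sq.mpr h
    gcongr
  growth x z h := by
    unfold wX
    rw [abs_of_nonneg (add_nonneg (abs_nonneg x) (abs_nonneg z)), ← sq_abs x]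
    generalize |x| = r at *
    have ht := abs_nonneg z
    generalize |z| = t at *
    set B : ℝ := 2 ^ (2 * σ) with hB
    have hB0 : 0 < B := by positivity
    rcases eq_or_lt_of_le (ht.trans h) with hr | hr
    · subst hr
      have : t = 0 := le_antisymm h ht
      subst this
      simp
    have hu1 : t / r ≤ 1 := by rw [div_le_one hr]; exact h
    have hu0 : 0 ≤ t / r := by positivity
    have h1 : 1 + (r + t) ^ 2 ≤ (1 + t / r) ^ 2 * (1 + r ^ 2) := by
      have e : (1 + t / r) ^ 2 * (1 + r ^ 2) = (1 + t / r) ^ 2 + (r + t) ^ 2 := by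
        field_simp
      rw [e]
      nlinarith
    have h2 : (1 + (r + t) ^ 2) ^ σ ≤ (1 + B * (t / r)) * (1 + r ^ 2) ^ σ := by
      calc (1 + (r + t) ^ 2) ^ σ ≤ ((1 + t / r) ^ 2 * (1 + r ^ 2)) ^ σ := by gcongr
        _ = (1 + t / r) ^ (2 * σ) * (1 + r ^ 2) ^ σ := by
            rw [Real.mul_rpow (by positivity) (by positivity), ← Real.rpow_natCast,
              ← Real.rpow_mul (by positivity)]
            norm_num
        _ ≤ _ := by
            gcongr
            exact one_add_rpow_le hu0 hu1 (by linarith)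
    set P := (1 + r ^ 2) ^ σ with hP
    have hP0 : 0 < P := by positivity
    have h3 : (r + t) * (1 + (r + t) ^ 2) ^ σ * r ≤ (r + (2 * B + 1) * t) * (r * P) := by
      calc (r + t) * (1 + (r + t) ^ 2) ^ σ * r
          ≤ (r + t) * ((1 + B * (t / r)) * P) * r := by gcongr
        _ = (r + t) * (r + B * t) * P := by field_simp
        _ ≤ ((r + (2 * B + 1) * t) * r) * P := by
            refine mul_le_mul_of_nonneg_right ?_ hP0.le
            nlinarith [mul_nonneg (mul_nonneg hB0.le ht) (sub_nonneg.mpr h)]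
        _ = _ := by ring
    have h4 : 0 ≤ (2 * B + 1) * t := by positivity
    nlinarith

/-- The damping `min(1, |k|/ρ)` grows at most linearly, so passing from `|x|` to `|x| + |z|`
multiplies it by at most `1 + |z|/|x|`, whatever `ρ` is. The growth constant is therefore
independent of `ρ`, and tails can be propagated with a rate that does not deteriorate as `ρ → ∞`. -/
lemma EnergyWeight.tail {θ : ℝ → ℝ} {K : ℝ} (h : EnergyWeight θ K) {ρ : ℝ} (hρ : 0 < ρ) :
    EnergyWeight (tailW ρ θ) (2 * K + 1) where
  Knonneg := by have := h.Knonneg; positivity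
  meas := by have := h.meas; unfold tailW; fun_prop
  nonneg x := mul_nonneg (h.nonneg x) (by positivity)
  mono x y hxy := by
    unfold tailW
    have := h.nonneg y
    have := h.mono x y hxy
    gcongr
  growth x z hz := by
    unfold tailW
    have hK := h.Knonneg
    have h1 := h.growth x z hz
    have hx := abs_nonneg x
    have ht := abs_nonneg z
    rw [abs_of_nonneg (add_nonneg hx ht)]
    rcases eq_or_lt_of_le hx with h0 | hr
    · rw [← h0] at hz
      have hz0 : |z| = 0 := le_antisymm hz ht
      rw [← h0, hz0]; simp
    have h2 : min 1 ((|x| + |z|) / ρ) * |x| ≤ (|x| + |z|) * min 1 (|x| / ρ) := by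
      rw [min_mul_of_nonneg _ _ hx, mul_min_of_nonneg _ _ (by positivity)]
      exact min_le_min (by linarith) (le_of_eq (by ring))
    have hn := h.nonneg (|x| + |z|)
    have hnx := h.nonneg x
    have hm : 0 ≤ min 1 (|x| / ρ) := by positivity
    have h3 : θ (|x| + |z|) * min 1 ((|x| + |z|) / ρ) * |x| * |x|
        ≤ ((|x| + (2 * K + 1) * |z|) * (θ x * min 1 (|x| / ρ))) * |x| := by
      calc _ = (θ (|x| + |z|) * |x|) * (min 1 ((|x| + |z|) / ρ) * |x|) := by ring
        _ ≤ ((|x| + K * |z|) * θ x) * ((|x| + |z|) * min 1 (|x| / ρ)) :=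
            mul_le_mul h1 h2 (by positivity) (by positivity)
        _ = (|x| + K * |z|) * (|x| + |z|) * (θ x * min 1 (|x| / ρ)) := by ring
        _ ≤ ((|x| + (2 * K + 1) * |z|) * |x|) * (θ x * min 1 (|x| / ρ)) := by
            refine mul_le_mul_of_nonneg_right ?_ (by positivity)
            nlinarith [mul_nonneg (mul_nonneg hK ht) (sub_nonneg.mpr hz)]
        _ = _ := by ring
    exact le_of_mul_le_mul_right h3 hr

lemma tailW_le {θ : ℝ → ℝ} {ρ : ℝ} (h : ∀ x, 0 ≤ θ x) (x : ℝ) : tailW ρ θ x ≤ θ x :=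
  mul_le_of_le_one_right (h x) (min_le_left _ _)

lemma tailW_eq {θ : ℝ → ℝ} {ρ : ℝ} (hρ : 0 < ρ) {x : ℝ} (hx : ρ ≤ |x|) : tailW ρ θ x = θ x := by
  unfold tailW
  rw [min_eq_left (by rwa [le_div_iff₀ hρ, one_mul]), mul_one]

/-- The energy `∫ θ |f|²`. -/
def En (θ : ℝ → ℝ) (f : ℝ → ℂ) : ℝ≥0∞ := ∫⁻ x, wmod (fun x => √(θ x)) f x ^ 2

lemma En_eq {θ : ℝ → ℝ} (hθ : ∀ x, 0 ≤ θ x) (f : ℝ → ℂ) :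
    En θ f = ∫⁻ x, ENNReal.ofReal (θ x) * ‖f x‖ₑ ^ 2 := by
  unfold En wmod
  congr 1
  ext x
  rw [mul_pow, ← ENNReal.ofReal_pow (Real.sqrt_nonneg _), Real.sq_sqrt (hθ x)]

lemma En_mono {θ θ' : ℝ → ℝ} (h : ∀ x, θ x ≤ θ' x) (f : ℝ → ℂ) : En θ f ≤ En θ' f := by
  unfold En wmod
  gcongr with x
  exact Real.sqrt_le_sqrt (h x)

lemma En_congr (θ : ℝ → ℝ) {f g : ℝ → ℂ} (h : f =ᵐ[volume] g) : En θ f = En θ g := by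
  unfold En wmod
  apply lintegral_congr_ae
  filter_upwards [h] with x hx
  rw [hx]

lemma En_add_le {θ : ℝ → ℝ} (hθ : Measurable θ) {f g : ℝ → ℂ} (hf : Measurable f)
    (hg : Measurable g) : En θ (fun x => f x + g x) ≤ 2 * (En θ f + En θ g) := by
  have h1 : Measurable (wmod (fun x => √(θ x)) f) := measurable_wmod (by fun_prop) hf
  have h2 : Measurable (wmod (fun x => √(θ x)) g) := measurable_wmod (by fun_prop) hg
  unfold En
  rw [← lintegral_add_left (by fun_prop), ← lintegral_const_mul _ (by fun_prop)]
  refine lintegral_mono fun x => ?_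
  refine le_trans ?_ (add_sq_le_ennreal _ _)
  gcongr
  exact wmod_add_le _ _ _ _

lemma En_neg (θ : ℝ → ℝ) (f : ℝ → ℂ) : En θ (fun x => -f x) = En θ f := by
  simp [En, wmod_neg]

lemma En_sub_le {θ : ℝ → ℝ} (hθ : Measurable θ) {f g : ℝ → ℂ} (hf : Measurable f)
    (hg : Measurable g) : En θ (fun x => f x - g x) ≤ 2 * (En θ f + En θ g) := by
  have h := En_add_le hθ hf hg.neg
  simp only [Pi.neg_apply, ← sub_eq_add_neg] at h
  rwa [show En θ (-g) = En θ g from En_neg θ g] at h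

lemma lintegral_sq_le_En {σ : ℝ} (f : ℝ → ℂ) : ∫⁻ x, ‖f x‖ₑ ^ 2 ≤ En (wX σ) f := by
  unfold En wmod
  gcongr with x
  refine le_mul_of_one_le_left (by positivity) ?_
  rw [ENNReal.one_le_ofReal, Real.one_le_sqrt]
  unfold wX
  have : 0 ≤ |x| * (1 + x ^ 2) ^ σ := by positivity
  linarith

/-- The weight dominates `(1 + k²)^{σ+1/2}`. -/
lemma rpow_le_wX {σ : ℝ} (hσ : 0 ≤ σ) (x : ℝ) :
    (1 + x ^ 2) ^ (σ + 1 / 2) ≤ 2 ^ (σ + 1 / 2) * wX σ x := by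
  have h2 : (1 : ℝ) ≤ 2 ^ (σ + 1 / 2) := Real.one_le_rpow (by norm_num) (by linarith)
  rcases le_total |x| 1 with hx | hx
  · have : 1 + x ^ 2 ≤ 2 := by rw [← sq_abs]; nlinarith [abs_nonneg x]
    calc (1 + x ^ 2) ^ (σ + 1 / 2) ≤ 2 ^ (σ + 1 / 2) := by gcongr
      _ ≤ _ := by
        refine le_mul_of_one_le_right (by positivity) ?_
        unfold wX
        have : 0 ≤ |x| * (1 + x ^ 2) ^ σ := by positivity
        linarith
  · have h3 : (1 + x ^ 2) ^ (1 / 2 : ℝ) ≤ 2 ^ (σ + 1 / 2) * |x| := by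
      have e : 1 + x ^ 2 ≤ 2 * |x| ^ 2 := by rw [← sq_abs]; nlinarith
      calc (1 + x ^ 2) ^ (1 / 2 : ℝ) ≤ (2 * |x| ^ 2) ^ (1 / 2 : ℝ) := by gcongr
        _ = 2 ^ (1 / 2 : ℝ) * |x| := by
          rw [Real.mul_rpow (by norm_num) (by positivity), ← Real.sqrt_eq_rpow (|x| ^ 2),
            Real.sqrt_sq (abs_nonneg x)]
        _ ≤ _ := by
          gcongr
          · norm_num
          · linarith
    rw [Real.rpow_add (by positivity)]
    unfold wX
    have h4 : 0 ≤ (1 + x ^ 2) ^ σ := by positivity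
    nlinarith

lemma wmod_w2_sq_le {σ : ℝ} (hσ : 2 < σ) (f : ℝ → ℂ) :
    ∫⁻ x, wmod w2 f x ^ 2 ≤ ENNReal.ofReal (2 ^ (σ + 1 / 2)) * En (wX σ) f := by
  have hX : ∀ x, 0 ≤ wX σ x := (energyWeight_wX (by linarith)).nonneg
  rw [En_eq hX, ← lintegral_const_mul' _ _ ENNReal.ofReal_ne_top]
  refine lintegral_mono fun x => ?_
  unfold wmod
  rw [mul_pow, ← mul_assoc, ← ENNReal.ofReal_mul (by positivity),
    ← ENNReal.ofReal_pow (w2_pos x).le]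
  gcongr
  refine le_trans ?_ (rpow_le_wX (by linarith) x)
  unfold w2
  rw [← Real.rpow_natCast]
  apply Real.rpow_le_rpow_of_exponent_le
  · nlinarith
  · norm_num; linarith

/-- The constant in the embedding `X_σ ⊂ 𝓕 L¹((1+k²)dk)`. -/
lemma exists_l1_bound {σ : ℝ} (hσ : 2 < σ) : ∃ M : ℝ, 0 ≤ M ∧ ∀ f : ℝ → ℂ, Measurable f →
    ∫⁻ x, wmod w2 f x ≤ ENNReal.ofReal M * (En (wX σ) f) ^ (1 / 2 : ℝ) := by
  have hW := energyWeight_wX (σ := σ) (by linarith)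
  have hX : ∀ x, 0 < wX σ x := fun x => by unfold wX; positivity
  have hWm := hW.meas
  -- Cauchy–Schwarz needs `∫ w2² / wX < ∞`. By `rpow_le_wX` the integrand is of order `(1+x²)^(2 -
  -- (σ + 1/2)) = (1+x²)^(-(2σ-3)/2)`, integrable on the line exactly when `2σ - 3 > 1`, that is, `σ
  -- > 2`.
  have hint : Integrable (fun x : ℝ => (1 + ‖x‖ ^ 2) ^ (-(2 * σ - 3) / 2)) :=
    integrable_rpow_neg_one_add_norm_sq (by simp; linarith)
  set G : ℝ → ℝ := fun x => w2 x / √(wX σ x) with hG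
  have hGm : Measurable G := by have := measurable_w2; fun_prop
  have hG2 : ∫⁻ x, ENNReal.ofReal (G x) ^ 2 < ⊤ := by
    have hle : ∀ x, ENNReal.ofReal (G x) ^ 2 ≤ ENNReal.ofReal (2 ^ (σ + 1 / 2)) *
        ENNReal.ofReal ((1 + ‖x‖ ^ 2) ^ (-(2 * σ - 3) / 2)) := by
      intro x
      have h0 : 0 ≤ G x := div_nonneg (w2_pos x).le (Real.sqrt_nonneg _)
      rw [← ENNReal.ofReal_pow h0, ← ENNReal.ofReal_mul (by positivity)]
      apply ENNReal.ofReal_le_ofReal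
      rw [hG, div_pow, Real.sq_sqrt (hX x).le, div_le_iff₀ (hX x)]
      have h1 := rpow_le_wX (σ := σ) (by linarith) x
      have h2 : (1 + x ^ 2) ^ (-(2 * σ - 3) / 2) * (1 + x ^ 2) ^ (σ + 1 / 2) = w2 x ^ 2 := by
        rw [← Real.rpow_add (by positivity)]
        unfold w2
        rw [← Real.rpow_natCast (1 + x ^ 2) 2]
        congr 1
        push_cast
        ring
      rw [Real.norm_eq_abs, sq_abs, ← h2]
      have h3 : 0 ≤ (1 + x ^ 2) ^ (-(2 * σ - 3) / 2) := by positivity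
      nlinarith
    refine (lintegral_mono hle).trans_lt ?_
    rw [lintegral_const_mul' _ _ ENNReal.ofReal_ne_top]
    refine ENNReal.mul_lt_top ENNReal.ofReal_lt_top ?_
    have := hint.2
    rw [hasFiniteIntegral_iff_ofReal (Eventually.of_forall fun x => by positivity)] at this
    exact this
  set M := ((∫⁻ x, ENNReal.ofReal (G x) ^ 2) ^ (1 / 2 : ℝ)).toReal with hM
  have hMt : ENNReal.ofReal M = (∫⁻ x, ENNReal.ofReal (G x) ^ 2) ^ (1 / 2 : ℝ) :=
    ENNReal.ofReal_toReal (ENNReal.rpow_lt_top_of_nonneg (by norm_num) hG2.ne).ne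
  refine ⟨M, ENNReal.toReal_nonneg, fun f hf => ?_⟩
  rw [hMt, En]
  have hwm : Measurable (wmod (fun x => √(wX σ x)) f) := measurable_wmod (by fun_prop) hf
  refine le_trans (le_of_eq ?_) (lintegral_mul_le_sqrt (F := fun x => ENNReal.ofReal (G x))
    (G := wmod (fun x => √(wX σ x)) f) (by fun_prop) (by fun_prop))
  congr 1
  ext x
  unfold wmod
  rw [← mul_assoc, ← ENNReal.ofReal_mul (div_nonneg (w2_pos x).le (Real.sqrt_nonneg _))]
  have : √(wX σ x) ≠ 0 := (Real.sqrt_pos.mpr (hX x)).ne'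
  simp only [div_mul_cancel₀ _ this]

lemma reg_of_En {σ : ℝ} (hσ : 2 < σ) {f : ℝ → ℂ} (hf : Measurable f)
    (hE : En (wX σ) f < ⊤) : Reg f := by
  obtain ⟨M, hM, h⟩ := exists_l1_bound hσ
  have hle : ∀ x, wmod w1 f x ≤ 2 * wmod w2 f x := by
    intro x
    unfold wmod
    rw [← mul_assoc, show (2 : ℝ≥0∞) = ENNReal.ofReal 2 by simp,
      ← ENNReal.ofReal_mul (by norm_num)]
    gcongr
    exact w1_le x
  refine ⟨hf, ?_, ?_⟩
  · calc ∫⁻ x, wmod w1 f x ^ 2 ≤ ∫⁻ x, 4 * wmod w2 f x ^ 2 := by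
          gcongr with x
          refine (pow_le_pow_left₀ (by positivity) (hle x) 2).trans (le_of_eq (by ring))
      _ = 4 * ∫⁻ x, wmod w2 f x ^ 2 := lintegral_const_mul' _ _ (by norm_num)
      _ < ⊤ := ENNReal.mul_lt_top (by norm_num) ((wmod_w2_sq_le hσ f).trans_lt
          (ENNReal.mul_lt_top ENNReal.ofReal_lt_top hE))
  · calc ∫⁻ x, wmod w1 f x ≤ ∫⁻ x, 2 * wmod w2 f x := lintegral_mono hle
      _ = 2 * ∫⁻ x, wmod w2 f x := lintegral_const_mul' _ _ (by norm_num)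
      _ < ⊤ := ENNReal.mul_lt_top (by norm_num) ((h f hf).trans_lt
          (ENNReal.mul_lt_top ENNReal.ofReal_lt_top
            (ENNReal.rpow_lt_top_of_nonneg (by norm_num) hE.ne)))

/-! ## The evolution operator on `L²(ℝ; ℝ)` -/

/-- The quadratic nonlinearity `-𝓗 𝓑` as a bilinear operator. -/
def Qop (c : ℝ) (b : ℝ → ℝ → ℝ → ℂ) (v w : L2R) : L2R := ofHat (amp c b (fhat v) (fhat w))

lemma lintegral_fhat_sq_lt (w : L2R) : ∫⁻ x, ‖fhat w x‖ₑ ^ 2 < ⊤ := by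
  rw [lintegral_fhat_sq]
  exact ENNReal.mul_lt_top ENNReal.ofReal_lt_top (ENNReal.pow_lt_top enorm_lt_top)

lemma memLp_two_of_lintegral {f : ℝ → ℂ} (hf : Measurable f) (h : ∫⁻ x, ‖f x‖ₑ ^ 2 < ⊤) :
    MemLp f 2 := by
  refine ⟨hf.aestronglyMeasurable, ?_⟩
  rw [eLpNorm_lt_top_iff_lintegral_rpow_enorm_lt_top (by norm_num) (by norm_num)]
  simpa using h

lemma enorm_amp_le (c : ℝ) (b : ℝ → ℝ → ℝ → ℂ) (f g : ℝ → ℂ) (k : ℝ) :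
    ‖amp c b f g k‖ₑ ≤ ENNReal.ofReal |c⁻¹| * ‖conv b f g k‖ₑ := by
  unfold amp
  rw [enorm_mul]
  gcongr
  rw [← ofReal_norm]
  apply ENNReal.ofReal_le_ofReal
  rw [norm_mul, norm_mul, Complex.norm_I, one_mul, Complex.norm_real, Real.norm_eq_abs,
    ← Complex.ofReal_inv, Complex.norm_real, Real.norm_eq_abs]
  exact mul_le_of_le_one_left (abs_nonneg _) (abs_sg_le k)

lemma measurable_amp {b : ℝ → ℝ → ℝ → ℂ} {C : ℝ} (h : AdmissibleKernel b C) (c : ℝ)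
    {f g : ℝ → ℂ} (hf : Measurable f) (hg : Measurable g) : Measurable (amp c b f g) := by
  have h1 := measurable_conv h.meas hf hg
  have h2 : Measurable fun k => ((sg k : ℝ) : ℂ) := Complex.measurable_ofReal.comp measurable_sg
  unfold amp
  fun_prop

lemma lintegral_amp_sq_le (c : ℝ) (b : ℝ → ℝ → ℝ → ℂ) (f g : ℝ → ℂ) :
    ∫⁻ k, ‖amp c b f g k‖ₑ ^ 2 ≤ ENNReal.ofReal |c⁻¹| ^ 2 * ∫⁻ k, ‖conv b f g k‖ₑ ^ 2 := by
  rw [← lintegral_const_mul' _ _ (ENNReal.pow_ne_top ENNReal.ofReal_ne_top)]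
  refine lintegral_mono fun k => ?_
  rw [← mul_pow]
  gcongr
  exact enorm_amp_le c b f g k

lemma amp_conj {b : ℝ → ℝ → ℝ → ℂ} {C : ℝ} (h : AdmissibleKernel b C) (c : ℝ)
    {f g : ℝ → ℂ} (hf : ∀ k, f (-k) = conj (f k)) (hg : ∀ k, g (-k) = conj (g k)) (k : ℝ) :
    amp c b f g (-k) = conj (amp c b f g k) := by
  unfold amp
  rw [h.conv_conj hf hg, sg_neg]
  simp

lemma amp_congr {c : ℝ} {b : ℝ → ℝ → ℝ → ℂ} {f f' g g' : ℝ → ℂ} (hf : f =ᵐ[volume] f')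
    (hg : g =ᵐ[volume] g') : amp c b f g = amp c b f' g' := by
  unfold amp
  rw [conv_congr hf hg]

lemma fhat_Qop {b : ℝ → ℝ → ℝ → ℂ} {C : ℝ} (h : AdmissibleKernel b C) (c : ℝ) {v w : L2R}
    (hv : Reg (fhat v)) (hw : Reg (fhat w)) :
    fhat (Qop c b v w) =ᵐ[volume] amp c b (fhat v) (fhat w) := by
  apply fhat_ofHat
  · refine memLp_two_of_lintegral (measurable_amp h c hv.meas hw.meas) ?_
    refine (lintegral_amp_sq_le c b _ _).trans_lt (ENNReal.mul_lt_top
      (ENNReal.pow_lt_top ENNReal.ofReal_lt_top) ((h.conv_sq_le hv hw).trans_lt ?_))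
    exact ENNReal.mul_lt_top (ENNReal.pow_lt_top ENNReal.ofReal_lt_top)
      (ENNReal.mul_lt_top hv.l2 (ENNReal.pow_lt_top hw.l1))
  · exact amp_conj h c (fhat_neg v) (fhat_neg w)

section Trunc

variable {b : ℝ → ℝ → ℝ → ℂ} {C : ℝ}

lemma conv_trunc_cut_of_le {N N' : ℝ} (hN : N ≤ N') (b : ℝ → ℝ → ℝ → ℂ) (f g : ℝ → ℂ) :
    conv (trunc N b) (cut N' f) (cut N' g) = conv (trunc N b) f g := by
  rw [← conv_trunc_cut N b f g, ← conv_trunc_cut N b (cut N' f)]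
  have : ∀ f, cut N (cut N' f) = cut N f := by
    intro f
    ext x
    unfold cut
    by_cases h : |x| ≤ N
    · simp [h, h.trans hN]
    · simp [h]
  rw [this, this]

/-- The bound of the truncated bilinear operator. -/
def truncBound (c C N : ℝ) : ℝ≥0∞ :=
  ENNReal.ofReal |c⁻¹| ^ 2 * (ENNReal.ofReal (2 * C) ^ 2 * (ENNReal.ofReal (1 + N) ^ 2 *
        (ENNReal.ofReal (1 + N) ^ 2 * ENNReal.ofReal (2 * N)))) * ENNReal.ofReal (2 * Real.pi)

lemma truncBound_lt_top (c C N : ℝ) : truncBound c C N < ⊤ := by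
  unfold truncBound
  refine ENNReal.mul_lt_top (ENNReal.mul_lt_top (ENNReal.pow_lt_top ENNReal.ofReal_lt_top) ?_)
    ENNReal.ofReal_lt_top
  refine ENNReal.mul_lt_top (ENNReal.pow_lt_top ENNReal.ofReal_lt_top) ?_
  refine ENNReal.mul_lt_top (ENNReal.pow_lt_top ENNReal.ofReal_lt_top) ?_
  exact ENNReal.mul_lt_top (ENNReal.pow_lt_top ENNReal.ofReal_lt_top) ENNReal.ofReal_lt_top

lemma lintegral_amp_trunc_le (h : AdmissibleKernel b C) (c N : ℝ) (v w : L2R) :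
    ∫⁻ k, ‖amp c (trunc N b) (fhat v) (fhat w) k‖ₑ ^ 2 ≤
      truncBound c C N * ENNReal.ofReal (2 * Real.pi) * (‖v‖ₑ ^ 2 * ‖w‖ₑ ^ 2) := by
  refine (lintegral_amp_sq_le c _ _ _).trans ?_
  refine (mul_le_mul_right (h.conv_trunc_sq_le N (measurable_fhat v) (measurable_fhat w)
    (lintegral_fhat_sq_lt v) (lintegral_fhat_sq_lt w)) _).trans ?_
  rw [lintegral_fhat_sq, lintegral_fhat_sq]
  unfold truncBound
  exact le_of_eq (by ring)

lemma fhat_Qop_trunc (h : AdmissibleKernel b C) (c N : ℝ) (v w : L2R) :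
    fhat (Qop c (trunc N b) v w) =ᵐ[volume] amp c (trunc N b) (fhat v) (fhat w) := by
  apply fhat_ofHat
  · refine memLp_two_of_lintegral (measurable_amp (h.trunc N) c (measurable_fhat v)
      (measurable_fhat w)) ?_
    refine (lintegral_amp_trunc_le h c N v w).trans_lt ?_
    exact ENNReal.mul_lt_top (ENNReal.mul_lt_top (truncBound_lt_top c C N) ENNReal.ofReal_lt_top)
      (ENNReal.mul_lt_top (ENNReal.pow_lt_top enorm_lt_top) (ENNReal.pow_lt_top enorm_lt_top))
  · exact amp_conj (h.trunc N) c (fhat_neg v) (fhat_neg w)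

lemma enorm_sq_le_of_fhat {w : L2R} {B : ℝ≥0∞}
    (hB : ∫⁻ k, ‖fhat w k‖ₑ ^ 2 ≤ ENNReal.ofReal (2 * Real.pi) * B) : ‖w‖ₑ ^ 2 ≤ B := by
  rw [lintegral_fhat_sq] at hB
  exact (ENNReal.mul_le_mul_iff_right (by simp [Real.pi_pos]) ENNReal.ofReal_ne_top).mp hB

lemma norm_sq_le_toReal {w : L2R} {B : ℝ≥0∞} (hB : ‖w‖ₑ ^ 2 ≤ B) (hB' : B < ⊤) :
    ‖w‖ ^ 2 ≤ B.toReal := by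
  have := ENNReal.toReal_mono hB'.ne hB
  simpa using this

lemma norm_Qop_trunc_le (h : AdmissibleKernel b C) (c N : ℝ) (v w : L2R) :
    ‖Qop c (trunc N b) v w‖ ≤ √(truncBound c C N).toReal * ‖v‖ * ‖w‖ := by
  have h1 : ‖Qop c (trunc N b) v w‖ₑ ^ 2 ≤ truncBound c C N * (‖v‖ₑ ^ 2 * ‖w‖ₑ ^ 2) := by
    apply enorm_sq_le_of_fhat
    rw [lintegral_congr_ae (g := fun k => ‖amp c (trunc N b) (fhat v) (fhat w) k‖ₑ ^ 2)]
    · exact (lintegral_amp_trunc_le h c N v w).trans (le_of_eq (by ring))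
    · filter_upwards [fhat_Qop_trunc h c N v w] with k hk
      rw [hk]
  have h2 := norm_sq_le_toReal h1 (ENNReal.mul_lt_top (truncBound_lt_top c C N)
    (ENNReal.mul_lt_top (ENNReal.pow_lt_top enorm_lt_top) (ENNReal.pow_lt_top enorm_lt_top)))
  simp only [ENNReal.toReal_mul, ENNReal.toReal_pow, toReal_enorm] at h2
  refine (sq_le_sq₀ (norm_nonneg _) (by positivity)).mp (h2.trans (le_of_eq ?_))
  rw [mul_pow, mul_pow, Real.sq_sqrt ENNReal.toReal_nonneg, mul_assoc]

lemma Qop_comm (h : AdmissibleKernel b C) (c : ℝ) (v w : L2R) : Qop c b v w = Qop c b w v := by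
  unfold Qop amp
  rw [h.conv_comm]

lemma cut_add (N : ℝ) (f g : ℝ → ℂ) :
    cut N (fun x => f x + g x) = fun x => cut N f x + cut N g x := by
  ext x
  unfold cut
  split_ifs <;> simp

lemma Qop_trunc_add_left (h : AdmissibleKernel b C) (c N : ℝ) (v₁ v₂ w : L2R) :
    Qop c (trunc N b) (v₁ + v₂) w = Qop c (trunc N b) v₁ w + Qop c (trunc N b) v₂ w := by
  apply fhat_injective
  have r := fun v : L2R => reg_cut (measurable_fhat v) (lintegral_fhat_sq_lt v) N
  filter_upwards [fhat_Qop_trunc h c N (v₁ + v₂) w, fhat_Qop_trunc h c N v₁ w,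
    fhat_Qop_trunc h c N v₂ w, fhat_add (Qop c (trunc N b) v₁ w) (Qop c (trunc N b) v₂ w),
    (h.trunc N).conv_add_left (r v₁) (r v₂) (r w)] with k h1 h2 h3 h4 h5
  rw [h4, h1, h2, h3, amp_congr (fhat_add v₁ v₂) EventuallyEq.rfl]
  unfold amp
  rw [← conv_trunc_cut, cut_add, h5, conv_trunc_cut, conv_trunc_cut]
  ring

lemma Qop_trunc_smul (h : AdmissibleKernel b C) (c N l : ℝ) (v : L2R) :
    Qop c (trunc N b) (l • v) (l • v) = (l ^ 2) • Qop c (trunc N b) v v := by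
  apply fhat_injective
  filter_upwards [fhat_Qop_trunc h c N (l • v) (l • v), fhat_Qop_trunc h c N v v,
    fhat_smul (l ^ 2) (Qop c (trunc N b) v v)] with k h1 h2 h3
  rw [h1, h3, h2, amp_congr (fhat_smul l v) (fhat_smul l v)]
  unfold amp conv
  have : ∀ m, trunc N b (-k) (k - m) m * (l * fhat v (k - m)) * (l * fhat v m)
      = (l : ℂ) ^ 2 * (trunc N b (-k) (k - m) m * fhat v (k - m) * fhat v m) := by
    intro m; ring
  simp_rw [this]
  rw [integral_const_mul]
  push_cast
  ring

lemma norm_Qop_trunc_sub_le (h : AdmissibleKernel b C) (c N : ℝ) (v w : L2R) :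
    ‖Qop c (trunc N b) v v - Qop c (trunc N b) w w‖
      ≤ √(truncBound c C N).toReal * (‖v‖ + ‖w‖) * ‖v - w‖ := by
  have e : Qop c (trunc N b) v v - Qop c (trunc N b) w w
      = Qop c (trunc N b) (v - w) v + Qop c (trunc N b) (v - w) w := by
    have h1 := Qop_trunc_add_left h c N (v - w) w v
    have h2 := Qop_trunc_add_left h c N (v - w) w w
    rw [sub_add_cancel] at h1 h2
    rw [h1, Qop_comm (h.trunc N) c w v, h2]
    abel
  rw [e]
  refine (norm_add_le _ _).trans ?_
  have h1 := norm_Qop_trunc_le h c N (v - w) v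
  have h2 := norm_Qop_trunc_le h c N (v - w) w
  refine (add_le_add h1 h2).trans (le_of_eq (by ring))

end Trunc

/-- Radial retraction onto the ball of radius `ρ`. -/
def retr {E : Type*} [NormedAddCommGroup E] [NormedSpace ℝ E] (ρ : ℝ) (w : E) : E :=
  (ρ / max ρ ‖w‖) • w

section Retr

variable {E : Type*} [NormedAddCommGroup E] [NormedSpace ℝ E] {ρ : ℝ}

lemma norm_retr_le (hρ : 0 < ρ) (w : E) : ‖retr ρ w‖ ≤ ρ := by
  unfold retr
  have hm : 0 < max ρ ‖w‖ := lt_max_of_lt_left hρ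
  rw [norm_smul, Real.norm_eq_abs, abs_of_pos (by positivity), div_mul_eq_mul_div,
    div_le_iff₀ hm]
  gcongr
  exact le_max_right _ _

lemma retr_eq (hρ : 0 < ρ) {w : E} (hw : ‖w‖ ≤ ρ) : retr ρ w = w := by
  unfold retr
  rw [max_eq_left hw, div_self hρ.ne', one_smul]

lemma norm_retr_sub_le (hρ : 0 < ρ) (v w : E) : ‖retr ρ v - retr ρ w‖ ≤ 2 * ‖v - w‖ := by
  unfold retr
  set p := max ρ ‖v‖
  set q := max ρ ‖w‖
  have hp : 0 < p := lt_max_of_lt_left hρ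
  have hq : 0 < q := lt_max_of_lt_left hρ
  have hρp : ρ ≤ p := le_max_left _ _
  have hwq : ‖w‖ ≤ q := le_max_right _ _
  have e : (ρ / p) • v - (ρ / q) • w = (ρ / p) • (v - w) + (ρ * (q - p) / (p * q)) • w := by
    rw [smul_sub, sub_add, ← sub_smul]
    congr 2
    field_simp
    ring
  have hqp : |q - p| ≤ ‖v - w‖ := by
    refine (abs_max_sub_max_le_max ρ ‖w‖ ρ ‖v‖).trans ?_
    rw [sub_self, abs_zero, max_eq_right (abs_nonneg _), norm_sub_rev]
    exact abs_norm_sub_norm_le w v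
  rw [e]
  refine (norm_add_le _ _).trans ?_
  rw [norm_smul, norm_smul, Real.norm_eq_abs, Real.norm_eq_abs, abs_of_pos (by positivity),
    abs_div, abs_mul, abs_of_pos hρ, abs_of_pos (by positivity : 0 < p * q)]
  have h1 : ρ / p ≤ 1 := (div_le_one hp).mpr hρp
  have h2 : ρ * |q - p| / (p * q) * ‖w‖ ≤ ‖v - w‖ := by
    calc ρ * |q - p| / (p * q) * ‖w‖ = (ρ / p) * (‖w‖ / q) * |q - p| := by field_simp
      _ ≤ 1 * 1 * ‖v - w‖ := by
        gcongr
        exact (div_le_one hq).mpr hwq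
      _ = _ := by ring
  nlinarith [norm_nonneg (v - w)]

end Retr

lemma abs_retr_coef_le {E : Type*} [NormedAddCommGroup E] {ρ : ℝ} (hρ : 0 < ρ) (w : E) : |ρ / max ρ ‖w‖| ≤ 1 := by
  have hm : 0 < max ρ ‖w‖ := lt_max_of_lt_left hρ
  rw [abs_of_pos (by positivity), div_le_one hm]
  exact le_max_left _ _

/-- Global solutions for bounded Lipschitz vector fields. -/
lemma exists_solution_of_lipschitz {E : Type*} [NormedAddCommGroup E] [NormedSpace ℝ E]
    [CompleteSpace E] {F : E → E} {K : NNReal} {L : NNReal} (hF : LipschitzWith K F)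
    (hL : ∀ x, ‖F x‖ ≤ L) (x₀ : E) {T : ℝ} (hT : 0 ≤ T) :
    ∃ u : ℝ → E, u 0 = x₀ ∧ ∀ t ∈ Icc 0 T, HasDerivWithinAt u (F (u t)) (Icc 0 T) t := by
  -- As `‖F‖ ≤ L`, a solution cannot leave the ball of radius `L T` before time `T`, so the local
  -- theorem already gives existence on all of `[0, T]`.
  have h : IsPicardLindelof (fun _ => F) (⟨0, left_mem_Icc.mpr hT⟩ : Icc 0 T) x₀
      (L * ⟨T, hT⟩) 0 L K :=
    { lipschitzOnWith := fun t _ => hF.lipschitzOnWith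
      continuousOn := fun x _ => continuousOn_const
      norm_le := fun t _ x _ => hL x
      mul_max_le := by simp [hT]; exact le_rfl }
  exact h.exists_eq_forall_mem_Icc_hasDerivWithinAt (by simp)

/-- The truncated equation with retracted nonlinearity is globally solvable. -/
lemma exists_trunc_solution {b : ℝ → ℝ → ℝ → ℂ} {C : ℝ} (h : AdmissibleKernel b C) (c N : ℝ)
    {ρ : ℝ} (hρ : 0 < ρ) (w₀ : L2R) {T : ℝ} (hT : 0 ≤ T) :
    ∃ u : ℝ → L2R, u 0 = w₀ ∧ ∀ t ∈ Icc 0 T,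
      HasDerivWithinAt u (Qop c (trunc N b) (retr ρ (u t)) (retr ρ (u t))) (Icc 0 T) t := by
  set B := √(truncBound c C N).toReal with hB
  have hB0 : 0 ≤ B := Real.sqrt_nonneg _
  refine exists_solution_of_lipschitz
    (F := fun w : L2R => Qop c (trunc N b) (retr ρ w) (retr ρ w))
    (K := ⟨B * (ρ + ρ) * 2, by positivity⟩) (L := ⟨B * ρ * ρ, by positivity⟩) ?_ ?_ w₀ hT
  · refine LipschitzWith.of_dist_le_mul fun v w => ?_
    rw [dist_eq_norm, dist_eq_norm]
    refine (norm_Qop_trunc_sub_le h c N _ _).trans ?_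
    change _ ≤ B * (ρ + ρ) * 2 * ‖v - w‖
    rw [mul_assoc (B * (ρ + ρ))]
    have := norm_retr_le hρ v
    have := norm_retr_le hρ w
    have := norm_retr_sub_le hρ v w
    gcongr
  · intro w
    refine (norm_Qop_trunc_le h c N _ _).trans ?_
    have := norm_retr_le hρ w
    change _ ≤ B * ρ * ρ
    gcongr

/-! ## Fourier multipliers and the derivative of the energy -/

/-- Evenness of the real symbol keeps the transform Hermitian, so the operator maps real functions
to real functions. -/
lemma exists_multiplier {μ : ℝ → ℝ} (hμ : Measurable μ) (heven : ∀ k, μ (-k) = μ k) {B : ℝ}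
    (hB : ∀ k, |μ k| ≤ B) :
    ∃ M : L2R →L[ℝ] L2R, ∀ w, fhat (M w) =ᵐ[volume] fun k => μ k * fhat w k := by
  have hB0 : 0 ≤ B := (abs_nonneg _).trans (hB 0)
  have hle : ∀ w : L2R, ∫⁻ k, ‖(μ k : ℂ) * fhat w k‖ₑ ^ 2
      ≤ ENNReal.ofReal (2 * Real.pi) * (ENNReal.ofReal B ^ 2 * ‖w‖ₑ ^ 2) := by
    intro w
    calc _ ≤ ∫⁻ k, ENNReal.ofReal B ^ 2 * ‖fhat w k‖ₑ ^ 2 := by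
          refine lintegral_mono fun k => ?_
          rw [← mul_pow, enorm_mul]
          gcongr
          rw [← ofReal_norm, Complex.norm_real]
          exact ENNReal.ofReal_le_ofReal (hB k)
      _ = _ := by
          rw [lintegral_const_mul' _ _ (ENNReal.pow_ne_top ENNReal.ofReal_ne_top),
            lintegral_fhat_sq]
          ring
  have key : ∀ w : L2R, fhat (ofHat fun k => μ k * fhat w k) =ᵐ[volume]
      fun k => μ k * fhat w k := by
    intro w
    apply fhat_ofHat
    · refine memLp_two_of_lintegral
        ((Complex.measurable_ofReal.comp hμ).mul (measurable_fhat w)) ((hle w).trans_lt ?_)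
      exact ENNReal.mul_lt_top ENNReal.ofReal_lt_top (ENNReal.mul_lt_top
        (ENNReal.pow_lt_top ENNReal.ofReal_lt_top) (ENNReal.pow_lt_top enorm_lt_top))
    · intro k
      rw [heven, fhat_neg]
      simp
  let L : L2R →ₗ[ℝ] L2R :=
    { toFun := fun w => ofHat fun k => μ k * fhat w k
      map_add' := by
        intro v w
        apply fhat_injective
        filter_upwards [key (v + w), key v, key w, fhat_add v w,
          fhat_add (ofHat fun k => μ k * fhat v k) (ofHat fun k => μ k * fhat w k)]
          with k h1 h2 h3 h4 h5
        rw [h1, h5, h2, h3, h4]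
        ring
      map_smul' := by
        intro a w
        apply fhat_injective
        filter_upwards [key (a • w), key w, fhat_smul a w,
          fhat_smul a (ofHat fun k => μ k * fhat w k)] with k h1 h2 h3 h4
        simp only [RingHom.id_apply]
        rw [h1, h4, h2, h3]
        ring }
  refine ⟨L.mkContinuous B fun w => ?_, key⟩
  have h1 : ‖L w‖ₑ ^ 2 ≤ ENNReal.ofReal B ^ 2 * ‖w‖ₑ ^ 2 := by
    apply enorm_sq_le_of_fhat
    rw [lintegral_congr_ae (g := fun k => ‖(μ k : ℂ) * fhat w k‖ₑ ^ 2)]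
    · exact hle w
    · filter_upwards [key w] with k hk
      change ‖fhat (ofHat fun k => μ k * fhat w k) k‖ₑ ^ 2 = _
      rw [hk]
  have h2 := norm_sq_le_toReal h1 (ENNReal.mul_lt_top
    (ENNReal.pow_lt_top ENNReal.ofReal_lt_top) (ENNReal.pow_lt_top enorm_lt_top))
  simp only [ENNReal.toReal_mul, ENNReal.toReal_pow, toReal_enorm, ENNReal.toReal_ofReal hB0]
    at h2
  rw [← mul_pow] at h2
  exact (sq_le_sq₀ (norm_nonneg _) (by positivity)).mp h2

/-- The multiplier whose norm is the truncated energy. -/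
lemma exists_energy_multiplier {θ : ℝ → ℝ} {K : ℝ} (hθ : EnergyWeight θ K) {N : ℝ} (hN : 0 ≤ N) :
    ∃ M : L2R →L[ℝ] L2R,
      (∀ w, fhat (M w) =ᵐ[volume] fun k => ((if |k| ≤ N then √(θ k) else 0 : ℝ) : ℂ) * fhat w k) ∧
      ∀ w, En θ (cut N (fhat w)) = ENNReal.ofReal (2 * Real.pi) * ‖M w‖ₑ ^ 2 := by
  have hθm := hθ.meas
  obtain ⟨M, hM⟩ := exists_multiplier (μ := fun k => if |k| ≤ N then √(θ k) else 0)
    (Measurable.ite (measurableSet_le (by fun_prop) (by fun_prop)) (by fun_prop)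
      measurable_const) (fun k => by simp only [abs_neg, hθ.even]) (B := √(θ N)) (fun k => by
      split_ifs with h
      · rw [abs_of_nonneg (Real.sqrt_nonneg _)]
        exact Real.sqrt_le_sqrt (hθ.mono _ _ (by rwa [abs_of_nonneg hN]))
      · simp)
  refine ⟨M, hM, fun w => ?_⟩
  rw [← lintegral_fhat_sq, En]
  apply lintegral_congr_ae
  filter_upwards [hM w] with k hk
  rw [hk, wmod, cut]
  split_ifs
  · rw [enorm_mul, ← ofReal_norm (((√(θ k) : ℝ) : ℂ)), Complex.norm_real, Real.norm_eq_abs,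
      abs_of_nonneg (Real.sqrt_nonneg _)]
  · simp

lemma En_cut_lt_top {θ : ℝ → ℝ} {K : ℝ} (hθ : EnergyWeight θ K) {N : ℝ} (hN : 0 ≤ N) (w : L2R) :
    En θ (cut N (fhat w)) < ⊤ := by
  obtain ⟨M, -, hM⟩ := exists_energy_multiplier hθ hN
  rw [hM]
  exact ENNReal.mul_lt_top ENNReal.ofReal_lt_top (ENNReal.pow_lt_top enorm_lt_top)

/-- The energy of the frequencies at most `N'` is `2π ‖M u‖²` with `M` bounded on `L²`, so it is
differentiable without any regularity of `u`. Cutting at `N' ≥ N` does not alter the truncated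
nonlinearity, hence the symmetrised estimate applies to the cut function. The scalar `l` leaves room
for the retraction. -/
lemma hasDerivWithinAt_energy {b : ℝ → ℝ → ℝ → ℂ} {C : ℝ} (h : AdmissibleKernel b C)
    {θ : ℝ → ℝ} {K : ℝ} (hθ : EnergyWeight θ K) {N N' : ℝ} (hN' : 0 ≤ N') (hNN : N ≤ N')
    (c l : ℝ) {u : ℝ → L2R} {S : Set ℝ} {t : ℝ}
    (hu : HasDerivWithinAt u (l • Qop c (trunc N b) (u t) (u t)) S t) :
    ∃ d, HasDerivWithinAt (fun s => (En θ (cut N' (fhat (u s)))).toReal) d S t ∧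
      |d| ≤ |l| * (2 * (|c⁻¹| * ((4 * K + 2) * C)) *
        (∫⁻ x, wmod w2 (cut N' (fhat (u t))) x).toReal *
        (En θ (cut N' (fhat (u t)))).toReal) := by
  obtain ⟨M, hM, hE⟩ := exists_energy_multiplier hθ hN'
  have hK := hθ.Knonneg
  have hC := h.nonneg
  have hpi := Real.pi_pos
  have hEr : ∀ w, (En θ (cut N' (fhat w))).toReal = 2 * Real.pi * ‖M w‖ ^ 2 := by
    intro w
    rw [hE, ENNReal.toReal_mul, ENNReal.toReal_ofReal (by positivity)]
    simp
  simp_rw [hEr]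
  set f := fhat (u t) with hf
  set q := Qop c (trunc N b) (u t) (u t) with hq
  have hd := (((M.hasFDerivAt (x := u t)).comp_hasDerivWithinAt t hu).norm_sq).const_mul
    (2 * Real.pi)
  refine ⟨_, hd, ?_⟩
  have hr := reg_cut (measurable_fhat (u t)) (lintegral_fhat_sq_lt (u t)) N'
  have hlt : ∫⁻ x, wmod θ (cut N' f) x ^ 2 < ⊤ :=
    (lintegral_wmod_cut_sq_le (M := θ N') (fun x hx => hθ.mono _ _ (by rwa [abs_of_nonneg hN']))
      f).trans_lt (ENNReal.mul_lt_top (ENNReal.pow_lt_top ENNReal.ofReal_lt_top)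
        (lintegral_fhat_sq_lt (u t)))
  have hen := (h.trunc N).energy_le hθ hr hlt c
  have hin : inner ℝ (M (u t)) (M q)
      = (2 * Real.pi)⁻¹ * (∫ k : ℝ, θ k * cut N' f (-k) *
          amp c (trunc N b) (cut N' f) (cut N' f) k).re := by
    rw [inner_eq_integral_fhat]
    congr 2
    apply integral_congr_ae
    have hneg : ∀ᵐ k : ℝ, fhat (M (u t)) (-k)
        = ((if |-k| ≤ N' then √(θ (-k)) else 0 : ℝ) : ℂ) * fhat (u t) (-k) :=
      (Measure.measurePreserving_neg volume).quasiMeasurePreserving.ae (hM (u t))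
    filter_upwards [hneg, hM q, fhat_Qop_trunc h c N (u t) (u t)] with k h1 h2 h3
    rw [h1, h2, h3, abs_neg, hθ.even]
    unfold amp
    rw [conv_trunc_cut_of_le hNN, cut, abs_neg]
    split_ifs with hk
    · have : (√(θ k) : ℂ) * √(θ k) = θ k := by
        rw [← Complex.ofReal_mul, Real.mul_self_sqrt (hθ.nonneg k)]
      rw [← this]
      ring
    · simp
  have hAfin : ∫⁻ x, wmod w2 (cut N' f) x < ⊤ := by
    have hw : ∀ x, |x| ≤ N' → w2 x ≤ 1 + N' ^ 2 := fun x hx => by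
      unfold w2; have := sq_le_sq' (by linarith [abs_nonneg x, neg_abs_le x]) ((le_abs_self x).trans hx); linarith
    have := (sq_lintegral_wmod_cut_le hw (measurable_fhat (u t))).trans_lt (ENNReal.mul_lt_top
      (ENNReal.mul_lt_top (ENNReal.pow_lt_top ENNReal.ofReal_lt_top) ENNReal.ofReal_lt_top)
        (lintegral_fhat_sq_lt (u t)))
    by_contra hc
    rw [not_lt, top_le_iff] at hc
    rw [hc] at this
    simp at this
  have hnorm : ‖∫ k : ℝ, θ k * cut N' f (-k) *
      amp c (trunc N b) (cut N' f) (cut N' f) k‖ ≤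
      |c⁻¹| * ((4 * K + 2) * C) * ((∫⁻ x, wmod w2 (cut N' f) x).toReal *
        (2 * Real.pi * ‖M (u t)‖ ^ 2)) := by
    have := ENNReal.toReal_mono (ENNReal.mul_lt_top ENNReal.ofReal_lt_top
      (ENNReal.mul_lt_top hAfin (En_cut_lt_top hθ hN' (u t)))).ne hen
    rw [toReal_enorm, ENNReal.toReal_mul, ENNReal.toReal_mul,
      ENNReal.toReal_ofReal (by positivity)] at this
    rw [← hEr]
    exact this
  have hre := (Complex.abs_re_le_norm (∫ k : ℝ, θ k * cut N' f (-k) *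
      amp c (trunc N b) (cut N' f) (cut N' f) k)).trans hnorm
  simp only [Function.comp, map_smul, inner_smul_right]
  rw [hin]
  rw [show 2 * Real.pi * (2 * (l * ((2 * Real.pi)⁻¹ * (∫ k : ℝ, θ k * cut N' f (-k) *
      amp c (trunc N b) (cut N' f) (cut N' f) k).re))) = l * (2 * (∫ k : ℝ, θ k * cut N' f (-k) *
      amp c (trunc N b) (cut N' f) (cut N' f) k).re) by field_simp, abs_mul, abs_mul, abs_two]
  refine mul_le_mul_of_nonneg_left ?_ (abs_nonneg l)
  linarith

/-! ## A priori bounds for the truncated equation -/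

lemma cut_norm_le (N : ℝ) (f : ℝ → ℂ) (x : ℝ) : ‖cut N f x‖ₑ ≤ ‖f x‖ₑ := by
  unfold cut
  split_ifs <;> simp

lemma En_cut_le (θ : ℝ → ℝ) (N : ℝ) (f : ℝ → ℂ) : En θ (cut N f) ≤ En θ f := by
  unfold En wmod
  gcongr with x
  exact cut_norm_le N f x

lemma En_le_of_cut {θ : ℝ → ℝ} (hθ : Measurable θ) {f : ℝ → ℂ} (hf : Measurable f) {B : ℝ≥0∞}
    {N₀ : ℝ} (h : ∀ N, N₀ ≤ N → En θ (cut N f) ≤ B) : En θ f ≤ B := by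
  have hlim : Tendsto (fun n : ℕ => En θ (cut (n : ℝ) f)) atTop (𝓝 (En θ f)) := by
    unfold En
    refine lintegral_tendsto_of_tendsto_of_monotone ?_ ?_ ?_
    · intro n
      exact ((measurable_wmod (by fun_prop) (measurable_cut hf _)).pow_const 2).aemeasurable
    · refine Eventually.of_forall fun x n m hnm => ?_
      unfold wmod cut
      have : (n : ℝ) ≤ m := by exact_mod_cast hnm
      by_cases h : |x| ≤ n
      · simp [h, h.trans this]
      · simp [h]
    · refine Eventually.of_forall fun x => ?_
      refine tendsto_const_nhds.congr' ?_
      filter_upwards [eventually_ge_atTop ⌈|x|⌉₊] with n hn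
      have : |x| ≤ n := (Nat.le_ceil _).trans (by exact_mod_cast hn)
      simp [wmod, cut, this]
  refine le_of_tendsto hlim ?_
  filter_upwards [eventually_ge_atTop ⌈N₀⌉₊] with n hn
  exact h n ((Nat.le_ceil _).trans (by exact_mod_cast hn))

lemma hasDerivWithinAt_Ici_of_Icc {E : Type*} [NormedAddCommGroup E] [NormedSpace ℝ E]
    {u : ℝ → E} {u' : E} {T t : ℝ} (ht : t ∈ Ico 0 T)
    (h : HasDerivWithinAt u u' (Icc 0 T) t) : HasDerivWithinAt u u' (Ici t) t :=
  h.mono_of_mem_nhdsWithin (Icc_mem_nhdsGE_of_mem ht)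

/-- A constant bounding `∫ (1+k²)|f|` by the square root of the energy. -/
def l1Const {σ : ℝ} (hσ : 2 < σ) : ℝ := (exists_l1_bound hσ).choose

lemma l1Const_nonneg {σ : ℝ} (hσ : 2 < σ) : 0 ≤ l1Const hσ := (exists_l1_bound hσ).choose_spec.1

lemma lintegral_w2_le {σ : ℝ} (hσ : 2 < σ) {f : ℝ → ℂ} (hf : Measurable f) :
    ∫⁻ x, wmod w2 f x ≤ ENNReal.ofReal (l1Const hσ) * (En (wX σ) f) ^ (1 / 2 : ℝ) :=
  (exists_l1_bound hσ).choose_spec.2 f hf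

lemma lintegral_w2_le_of_En_le {σ : ℝ} (hσ : 2 < σ) {f : ℝ → ℂ} (hf : Measurable f) {E : ℝ}
    (hE : 0 ≤ E) (h : En (wX σ) f ≤ ENNReal.ofReal E) :
    ∫⁻ x, wmod w2 f x ≤ ENNReal.ofReal (l1Const hσ * √E) := by
  refine (lintegral_w2_le hσ hf).trans ?_
  rw [ENNReal.ofReal_mul (l1Const_nonneg hσ), Real.sqrt_eq_rpow,
    ← ENNReal.ofReal_rpow_of_nonneg hE (by norm_num)]
  gcongr

lemma toReal_lintegral_w2_le {σ : ℝ} (hσ : 2 < σ) {f : ℝ → ℂ} (hf : Measurable f)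
    (h : En (wX σ) f < ⊤) :
    (∫⁻ x, wmod w2 f x).toReal ≤ l1Const hσ * √(En (wX σ) f).toReal := by
  have h1 := lintegral_w2_le_of_En_le hσ hf (E := (En (wX σ) f).toReal) ENNReal.toReal_nonneg
    (by rw [ENNReal.ofReal_toReal h.ne])
  exact ENNReal.toReal_le_of_le_ofReal
    (mul_nonneg (l1Const_nonneg hσ) (Real.sqrt_nonneg _)) h1

/-- The constant of the energy estimate for weights with growth constant `K`. -/
def energyConst (c C K : ℝ) {σ : ℝ} (hσ : 2 < σ) : ℝ :=
  2 * (|c⁻¹| * ((4 * K + 2) * C)) * l1Const hσ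

lemma norm_sq_le_of_En {σ : ℝ} {w : L2R} {E : ℝ} (hE : 0 ≤ E)
    (h : En (wX σ) (fhat w) ≤ ENNReal.ofReal E) : ‖w‖ ^ 2 ≤ E := by
  have h1 : ‖w‖ₑ ^ 2 ≤ ENNReal.ofReal E := by
    apply enorm_sq_le_of_fhat
    refine ((lintegral_sq_le_En (σ := σ) (fhat w)).trans h).trans ?_
    refine le_mul_of_one_le_left (by positivity) ?_
    rw [ENNReal.one_le_ofReal]
    linarith [Real.pi_gt_three]
  have := norm_sq_le_toReal h1 ENNReal.ofReal_lt_top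
  rwa [ENNReal.toReal_ofReal hE] at this

section Apriori

variable {b : ℝ → ℝ → ℝ → ℂ} {C : ℝ} {σ : ℝ}

lemma energy_deriv_bound (h : AdmissibleKernel b C) (hσ : 2 < σ) {θ : ℝ → ℝ} {K : ℝ}
    (hθ : EnergyWeight θ K) {N N' : ℝ} (hN' : 0 ≤ N') (hNN : N ≤ N')
    (c l : ℝ) (hl : |l| ≤ 1) {u : ℝ → L2R} {S : Set ℝ} {t : ℝ}
    (hu : HasDerivWithinAt u (l • Qop c (trunc N b) (u t) (u t)) S t) :
    ∃ d, HasDerivWithinAt (fun s => (En θ (cut N' (fhat (u s)))).toReal) d S t ∧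
      |d| ≤ energyConst c C K hσ * √(En (wX σ) (cut N' (fhat (u t)))).toReal *
        (En θ (cut N' (fhat (u t)))).toReal := by
  obtain ⟨d, hd, hle⟩ := hasDerivWithinAt_energy h hθ hN' hNN c l hu
  refine ⟨d, hd, hle.trans ?_⟩
  have hK := hθ.Knonneg
  have hC := h.nonneg
  have hX : EnergyWeight (wX σ) _ := energyWeight_wX (by linarith)
  have h1 := toReal_lintegral_w2_le hσ (measurable_cut (measurable_fhat (u t)) N')
    (En_cut_lt_top hX hN' (u t))
  set A := (∫⁻ x, wmod w2 (cut N' (fhat (u t))) x).toReal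
  set y := (En θ (cut N' (fhat (u t)))).toReal
  have hy : 0 ≤ y := ENNReal.toReal_nonneg
  have hA : 0 ≤ A := ENNReal.toReal_nonneg
  calc _ ≤ 1 * (2 * (|c⁻¹| * ((4 * K + 2) * C)) * A * y) := by gcongr
    _ ≤ 1 * (2 * (|c⁻¹| * ((4 * K + 2) * C)) *
        (l1Const hσ * √(En (wX σ) (cut N' (fhat (u t)))).toReal) * y) := by gcongr
    _ = _ := by unfold energyConst; ring

/-- The growth constant of the weight `wX`. -/
def growthX (σ : ℝ) : ℝ := 2 * 2 ^ (2 * σ) + 1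

/-- Lifespan for data with energy at most `E`. -/
def lifespan (c C : ℝ) (hσ : 2 < σ) (E : ℝ) : ℝ :=
  3 * E / (energyConst c C (growthX σ) hσ * √(4 * E) * (4 * E) + 1)

lemma energyConst_nonneg (h : AdmissibleKernel b C) (hσ : 2 < σ) (c : ℝ) {K : ℝ} (hK : 0 ≤ K) :
    0 ≤ energyConst c C K hσ := by
  have := h.nonneg
  have := l1Const_nonneg hσ
  unfold energyConst
  positivity

lemma growthX_nonneg (σ : ℝ) : 0 ≤ growthX σ := by unfold growthX; positivity

lemma lifespan_pos (h : AdmissibleKernel b C) (hσ : 2 < σ) (c : ℝ) {E : ℝ} (hE : 0 < E) :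
    0 < lifespan c C hσ E := by
  have := energyConst_nonneg h hσ c (growthX_nonneg σ)
  unfold lifespan
  positivity

/-- The growth rate of weighted energies. -/
def tailRate (c C : ℝ) (hσ : 2 < σ) (E : ℝ) : ℝ :=
  energyConst c C (2 * growthX σ + 1) hσ * √(4 * E)

/-- Solutions of the truncated equation, with bounds uniform in the truncation. -/
lemma exists_trunc_solution_bounds (h : AdmissibleKernel b C) (hσ : 2 < σ) (c : ℝ) {E : ℝ}
    (hE : 0 < E) (N : ℝ) {w₀ : L2R} (hw₀ : En (wX σ) (fhat w₀) ≤ ENNReal.ofReal E) :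
    ∃ u : ℝ → L2R, u 0 = w₀ ∧
      (∀ t ∈ Icc 0 (lifespan c C hσ E), HasDerivWithinAt u (Qop c (trunc N b) (u t) (u t))
        (Icc 0 (lifespan c C hσ E)) t) ∧
      (∀ t ∈ Icc 0 (lifespan c C hσ E), En (wX σ) (fhat (u t)) ≤ ENNReal.ofReal (4 * E)) ∧
      ∀ ρ > 0, ∀ t ∈ Icc 0 (lifespan c C hσ E), En (tailW ρ (wX σ)) (fhat (u t)) ≤
        ENNReal.ofReal (Real.exp (tailRate c C hσ E * lifespan c C hσ E)) *
          En (tailW ρ (wX σ)) (fhat w₀) := by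
  have hT := lifespan_pos h hσ c hE
  set T := lifespan c C hσ E with hTdef
  have hX : EnergyWeight (wX σ) (growthX σ) := energyWeight_wX (by linarith)
  -- The energy dominates `‖u‖²`, so the retraction onto this ball is inactive as long as the energy
  -- is at most `4E`.
  set ρ₀ := √(4 * E) with hρ₀
  have hρ₀pos : 0 < ρ₀ := by positivity
  obtain ⟨u, hu0, hu⟩ := exists_trunc_solution h c N hρ₀pos w₀ hT.le
  -- The nonlinearity is homogeneous of degree two, so the retraction merely multiplies it by the
  -- scalar `l t`, of modulus at most `1`. The energy estimates thus hold before the retraction is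
  -- known to be inactive.
  set l : ℝ → ℝ := fun t => (ρ₀ / max ρ₀ ‖u t‖) ^ 2 with hl
  have hl1 : ∀ t, |l t| ≤ 1 := by
    intro t
    rw [hl, abs_pow]
    exact pow_le_one₀ (abs_nonneg _) (abs_retr_coef_le hρ₀pos (u t))
  have hu' : ∀ t ∈ Icc 0 T,
      HasDerivWithinAt u (l t • Qop c (trunc N b) (u t) (u t)) (Icc 0 T) t := by
    intro t ht
    have := hu t ht
    rwa [retr, Qop_trunc_smul h] at this
  set D := energyConst c C (growthX σ) hσ with hD
  have hD0 : 0 ≤ D := energyConst_nonneg h hσ c (growthX_nonneg σ)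
  -- `D √(4E) 4E` bounds the growth rate of the energy while it is at most `4E`, and the lifespan is
  -- such that `P T = 3E`: the line `E + P t` rises from `E` to `4E` on `[0, T]`. The `+ 1` provides
  -- the strict inequality of slopes that keeps the energy below this line.
  set P := D * √(4 * E) * (4 * E) + 1 with hP
  have hPpos : 0 < P := by positivity
  have hPT : P * T = 3 * E := by
    rw [hTdef, lifespan, ← hD, ← hP]
    field_simp
  -- the bound for the truncated energy
  have hcut : ∀ N', max N 0 ≤ N' → ∀ t ∈ Icc 0 T,
      (En (wX σ) (cut N' (fhat (u t)))).toReal ≤ 4 * E := by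
    intro N' hN'
    have hN0 : 0 ≤ N' := (le_max_right _ _).trans hN'
    have hNN : N ≤ N' := (le_max_left _ _).trans hN'
    have hd : ∀ t, ∃ d, t ∈ Icc 0 T →
        HasDerivWithinAt (fun s => (En (wX σ) (cut N' (fhat (u s)))).toReal) d (Icc 0 T) t ∧
        |d| ≤ D * √(En (wX σ) (cut N' (fhat (u t)))).toReal *
        (En (wX σ) (cut N' (fhat (u t)))).toReal := by
      intro t
      by_cases ht : t ∈ Icc 0 T
      · obtain ⟨d, hd⟩ := energy_deriv_bound h hσ hX hN0 hNN c (l t) (hl1 t) (hu' t ht)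
        exact ⟨d, fun _ => hd⟩
      · exact ⟨0, fun h => absurd h ht⟩
    choose y' hy' using hd
    set y : ℝ → ℝ := fun s => (En (wX σ) (cut N' (fhat (u s)))).toReal with hy
    have hbar := image_le_of_deriv_right_lt_deriv_boundary (f := y) (f' := y') (a := 0) (b := T)
      (B := fun t => E + P * t) (B' := fun _ => P)
      (fun t ht => (hy' t ht).1.continuousWithinAt)
      (fun t ht => hasDerivWithinAt_Ici_of_Icc ht (hy' t (Ico_subset_Icc_self ht)).1)
      (by
        simp only [mul_zero, add_zero, hy, hu0]
        exact ENNReal.toReal_le_of_le_ofReal hE.le ((En_cut_le _ _ _).trans hw₀))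
      (fun t => by simpa using ((hasDerivAt_id t).const_mul P).const_add E)
      (fun t ht heq => by
        have h1 := (hy' t (Ico_subset_Icc_self ht)).2
        have h2 : y t ≤ 4 * E := by
          rw [heq]
          have : P * t ≤ P * T := by gcongr; exact ht.2.le
          linarith
        have h0 : 0 ≤ y t := ENNReal.toReal_nonneg
        have h3 : D * √(y t) * y t ≤ D * √(4 * E) * (4 * E) := by gcongr
        linarith [le_abs_self (y' t)])
    intro t ht
    refine (hbar ht).trans ?_
    have : P * t ≤ P * T := by gcongr; exact ht.2
    linarith
  have hXb : ∀ t ∈ Icc 0 T, En (wX σ) (fhat (u t)) ≤ ENNReal.ofReal (4 * E) := by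
    intro t ht
    refine En_le_of_cut hX.meas (measurable_fhat _) (N₀ := max N 0) fun N' hN' => ?_
    rw [← ENNReal.ofReal_toReal (En_cut_lt_top hX ((le_max_right _ _).trans hN') (u t)).ne]
    exact ENNReal.ofReal_le_ofReal (hcut N' hN' t ht)
  have hretr : ∀ t ∈ Icc 0 T, retr ρ₀ (u t) = u t := by
    intro t ht
    apply retr_eq hρ₀pos
    rw [hρ₀]
    exact Real.le_sqrt_of_sq_le (norm_sq_le_of_En (by positivity) (hXb t ht))
  refine ⟨u, hu0, fun t ht => ?_, hXb, fun ρ hρ t ht => ?_⟩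
  · have := hu t ht
    rwa [hretr t ht] at this
  · have htail : EnergyWeight (tailW ρ (wX σ)) (2 * growthX σ + 1) := hX.tail hρ
    refine En_le_of_cut htail.meas (measurable_fhat _) (N₀ := max N 0) fun N' hN' => ?_
    have hN0 : 0 ≤ N' := (le_max_right _ _).trans hN'
    have hNN : N ≤ N' := (le_max_left _ _).trans hN'
    set Λ := tailRate c C hσ E with hΛ
    have hΛ0 : 0 ≤ Λ := by
      have := energyConst_nonneg h hσ c (K := 2 * growthX σ + 1)
        (by have := growthX_nonneg σ; positivity)
      rw [hΛ, tailRate]; positivity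
    have hd : ∀ s, ∃ d, s ∈ Icc 0 T →
        HasDerivWithinAt (fun s => (En (tailW ρ (wX σ)) (cut N' (fhat (u s)))).toReal) d
          (Icc 0 T) s ∧
        |d| ≤ Λ * (En (tailW ρ (wX σ)) (cut N' (fhat (u s)))).toReal := by
      intro s
      by_cases hs : s ∈ Icc 0 T
      · obtain ⟨d, hd, hd2⟩ := energy_deriv_bound h hσ htail hN0 hNN c (l s) (hl1 s) (hu' s hs)
        refine ⟨d, fun _ => ⟨hd, hd2.trans ?_⟩⟩
        have h1 := hcut N' hN' s hs
        have h2 := energyConst_nonneg h hσ c (K := 2 * growthX σ + 1)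
          (by have := growthX_nonneg σ; positivity)
        rw [hΛ, tailRate]
        have h3 : 0 ≤ (En (tailW ρ (wX σ)) (cut N' (fhat (u s)))).toReal := ENNReal.toReal_nonneg
        gcongr
      · exact ⟨0, fun h => absurd h hs⟩
    choose y' hy' using hd
    set y : ℝ → ℝ := fun s => (En (tailW ρ (wX σ)) (cut N' (fhat (u s)))).toReal with hy
    -- The full energy being bounded by `4E`, the inequality for the tail energy is linear and
    -- homogeneous, so tails grow at most exponentially from their initial value.
    have hg := norm_le_gronwallBound_of_norm_deriv_right_le (f := y) (f' := y') (a := 0) (b := T)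
      (δ := y 0) (K := Λ) (ε := 0)
      (fun t ht => (hy' t ht).1.continuousWithinAt)
      (fun t ht => hasDerivWithinAt_Ici_of_Icc ht (hy' t (Ico_subset_Icc_self ht)).1)
      (by rw [Real.norm_eq_abs, abs_of_nonneg ENNReal.toReal_nonneg])
      (fun t ht => by
        rw [Real.norm_eq_abs, Real.norm_eq_abs, add_zero]
        rw [abs_of_nonneg (show 0 ≤ y t from ENNReal.toReal_nonneg)]
        exact (hy' t (Ico_subset_Icc_self ht)).2) t ht
    rw [gronwallBound_ε0, Real.norm_eq_abs,
      abs_of_nonneg (show 0 ≤ y t from ENNReal.toReal_nonneg), sub_zero] at hg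
    have hy0 : 0 ≤ y 0 := ENNReal.toReal_nonneg
    have hg2 : y t ≤ Real.exp (Λ * T) * y 0 := by
      refine hg.trans ?_
      rw [mul_comm]
      gcongr
      exact ht.2
    rw [← ENNReal.ofReal_toReal (En_cut_lt_top htail hN0 (u t)).ne]
    refine (ENNReal.ofReal_le_ofReal hg2).trans ?_
    rw [ENNReal.ofReal_mul (Real.exp_pos _).le]
    gcongr
    simp only [hy, hu0]
    rw [ENNReal.ofReal_toReal (En_cut_lt_top htail hN0 w₀).ne]
    exact En_cut_le _ _ _

end Apriori

/-! ## Differences of solutions -/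

section Diff

variable {b b' : ℝ → ℝ → ℝ → ℂ} {C : ℝ} {σ : ℝ}

lemma Reg.congr {f g : ℝ → ℂ} (hf : Reg f) (hg : Measurable g) (h : g =ᵐ[volume] f) : Reg g := by
  refine ⟨hg, ?_, ?_⟩
  · rw [lintegral_congr_ae (g := fun x => wmod w1 f x ^ 2)]
    · exact hf.l2
    · filter_upwards [h] with x hx
      simp [wmod, hx]
  · rw [lintegral_congr_ae (g := fun x => wmod w1 f x)]
    · exact hf.l1
    · filter_upwards [h] with x hx
      simp [wmod, hx]

lemma reg_add {v w : L2R} (hv : Reg (fhat v)) (hw : Reg (fhat w)) : Reg (fhat (v + w)) :=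
  (hv.add hw).congr (measurable_fhat _) (fhat_add v w)

lemma reg_sub {v w : L2R} (hv : Reg (fhat v)) (hw : Reg (fhat w)) : Reg (fhat (v - w)) :=
  (hv.add hw.neg).congr (measurable_fhat _) (by simpa [sub_eq_add_neg] using fhat_sub v w)

lemma Qop_add_left (h : AdmissibleKernel b C) (c : ℝ) {v₁ v₂ w : L2R} (h1 : Reg (fhat v₁))
    (h2 : Reg (fhat v₂)) (hw : Reg (fhat w)) :
    Qop c b (v₁ + v₂) w = Qop c b v₁ w + Qop c b v₂ w := by
  apply fhat_injective
  filter_upwards [fhat_Qop h c (reg_add h1 h2) hw, fhat_Qop h c h1 hw,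
    fhat_Qop h c h2 hw, fhat_add (Qop c b v₁ w) (Qop c b v₂ w),
    h.conv_add_left h1 h2 hw] with k e1 e2 e3 e4 e5
  rw [e4, e1, e2, e3, amp_congr (fhat_add v₁ v₂) EventuallyEq.rfl]
  unfold amp
  rw [e5]
  ring

/-- The identity `v² - w² = (v-w)(v+w)`; the difference occupies the first slot, as `diff_le`
requires. -/
lemma Qop_sub (h : AdmissibleKernel b C) (c : ℝ) {v w : L2R} (hv : Reg (fhat v))
    (hw : Reg (fhat w)) :
    Qop c b v v - Qop c b w w = Qop c b (v - w) (v + w) := by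
  have hs := reg_sub hv hw
  have h1 := Qop_add_left h c hs hw hv
  have h2 := Qop_add_left h c hs hw hw
  rw [sub_add_cancel] at h1 h2
  rw [Qop_comm h c (v - w), Qop_add_left h c hv hw hs, Qop_comm h c v (v - w),
    Qop_comm h c w (v - w), h1, Qop_comm h c w v, h2]
  abel

lemma En_fhat_add_le {E : ℝ} (hσ : 2 < σ) {v w : L2R}
    (hv : En (wX σ) (fhat v) ≤ ENNReal.ofReal E) (hw : En (wX σ) (fhat w) ≤ ENNReal.ofReal E) :
    En (wX σ) (fhat (v + w)) ≤ ENNReal.ofReal (4 * E) := by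
  rw [En_congr _ (fhat_add v w), ENNReal.ofReal_mul (by norm_num)]
  refine (En_add_le (energyWeight_wX (by linarith)).meas (measurable_fhat v)
    (measurable_fhat w)).trans ?_
  calc _ ≤ 2 * (ENNReal.ofReal E + ENNReal.ofReal E) := by gcongr
    _ = _ := by
      rw [show ENNReal.ofReal 4 = 4 by simp]
      ring

lemma En_fhat_sub_le {θ : ℝ → ℝ} (hθ : Measurable θ) (v w : L2R) :
    En θ (fhat (v - w)) ≤ 2 * (En θ (fhat v) + En θ (fhat w)) := by
  rw [En_congr _ (fhat_sub v w)]
  exact En_sub_le hθ (measurable_fhat v) (measurable_fhat w)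

lemma reg_fhat_of_En (hσ : 2 < σ) {w : L2R} {E : ℝ}
    (hw : En (wX σ) (fhat w) ≤ ENNReal.ofReal E) : Reg (fhat w) :=
  reg_of_En hσ (measurable_fhat w) (hw.trans_lt ENNReal.ofReal_lt_top)

/-- The rate of the `L²` estimate for differences. -/
def diffRate (c C : ℝ) (hσ : 2 < σ) (E : ℝ) : ℝ := |c⁻¹| * (4 * C) * (l1Const hσ * √(4 * E))

/-- The weight `1 + k²` of `diff_le` falls on `v + w`, whose energy is at most `4E`. For `v - w` the
`L²` norm is enough, so no derivative is lost. -/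
lemma abs_inner_diff_le (h : AdmissibleKernel b C) (hσ : 2 < σ) (c : ℝ) {E : ℝ} (hE : 0 ≤ E)
    {v w : L2R} (hv : En (wX σ) (fhat v) ≤ ENNReal.ofReal E)
    (hw : En (wX σ) (fhat w) ≤ ENNReal.ofReal E) :
    |inner ℝ (v - w) (Qop c b v v - Qop c b w w)| ≤ diffRate c C hσ E * ‖v - w‖ ^ 2 := by
  have rv := reg_fhat_of_En hσ hv
  have rw' := reg_fhat_of_En hσ hw
  have hC := h.nonneg
  have hl := l1Const_nonneg hσ
  have hpi := Real.pi_pos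
  rw [Qop_sub h c rv rw', inner_eq_integral_fhat]
  have e1 : ∫ k : ℝ, fhat (v - w) (-k) * fhat (Qop c b (v - w) (v + w)) k
      = ∫ k : ℝ, fhat (v - w) (-k) * amp c b (fhat (v - w)) (fhat (v + w)) k := by
    apply integral_congr_ae
    filter_upwards [fhat_Qop h c (reg_sub rv rw') (reg_add rv rw')] with k hk
    rw [hk]
  rw [e1]
  have h1 := h.diff_le (reg_sub rv rw') (reg_add rv rw') (lintegral_fhat_sq_lt (v - w)) c
  have h2 := lintegral_w2_le_of_En_le hσ (measurable_fhat (v + w)) (by positivity)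
    (En_fhat_add_le hσ hv hw)
  set I := ∫ k : ℝ, fhat (v - w) (-k) * amp c b (fhat (v - w)) (fhat (v + w)) k
  have h3 : ‖I‖ₑ ≤ ENNReal.ofReal (|c⁻¹| * (4 * C)) * (ENNReal.ofReal (l1Const hσ * √(4 * E)) *
      (ENNReal.ofReal (2 * Real.pi) * ‖v - w‖ₑ ^ 2)) := by
    refine h1.trans ?_
    rw [lintegral_fhat_sq]
    gcongr
  have h4 : ‖I‖ ≤ |c⁻¹| * (4 * C) * (l1Const hσ * √(4 * E) * (2 * Real.pi * ‖v - w‖ ^ 2)) := by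
    have hfin : ENNReal.ofReal (|c⁻¹| * (4 * C)) * (ENNReal.ofReal (l1Const hσ * √(4 * E)) *
      (ENNReal.ofReal (2 * Real.pi) * ‖v - w‖ₑ ^ 2)) ≠ ⊤ :=
      (ENNReal.mul_lt_top ENNReal.ofReal_lt_top (ENNReal.mul_lt_top ENNReal.ofReal_lt_top
        (ENNReal.mul_lt_top ENNReal.ofReal_lt_top (ENNReal.pow_lt_top enorm_lt_top)))).ne
    have := ENNReal.toReal_mono hfin h3
    rw [toReal_enorm, ENNReal.toReal_mul, ENNReal.toReal_mul, ENNReal.toReal_mul,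
      ENNReal.toReal_ofReal (by positivity), ENNReal.toReal_ofReal (by positivity),
      ENNReal.toReal_ofReal (by positivity), ENNReal.toReal_pow, toReal_enorm] at this
    exact this
  rw [abs_mul, abs_of_pos (by positivity : 0 < (2 * Real.pi)⁻¹)]
  calc (2 * Real.pi)⁻¹ * |I.re| ≤ (2 * Real.pi)⁻¹ * ‖I‖ := by
        gcongr; exact Complex.abs_re_le_norm I
    _ ≤ (2 * Real.pi)⁻¹ *
        (|c⁻¹| * (4 * C) * (l1Const hσ * √(4 * E) * (2 * Real.pi * ‖v - w‖ ^ 2))) := by gcongr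
    _ = _ := by unfold diffRate; field_simp

/-- The constant in the comparison of kernels that agree at low frequencies. -/
def truncErr (c C : ℝ) (hσ : 2 < σ) (E : ℝ) : ℝ :=
  |c⁻¹| * (16 * C) * (√(2 ^ (σ + 1 / 2) * E) * (l1Const hσ * √E))

lemma norm_sq_le_of_lintegral {w : L2R} {B : ℝ} (hB : 0 ≤ B)
    (h : ∫⁻ k, ‖fhat w k‖ₑ ^ 2 ≤ ENNReal.ofReal B) : ‖w‖ ^ 2 ≤ B := by
  have h1 : ‖w‖ₑ ^ 2 ≤ ENNReal.ofReal B := by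
    apply enorm_sq_le_of_fhat
    refine h.trans (le_mul_of_one_le_left (by positivity) ?_)
    rw [ENNReal.one_le_ofReal]
    linarith [Real.pi_gt_three]
  have := norm_sq_le_toReal h1 ENNReal.ofReal_lt_top
  rwa [ENNReal.toReal_ofReal hB] at this

lemma two_mul_ofReal (a : ℝ) : (2 : ℝ≥0∞) * ENNReal.ofReal a = ENNReal.ofReal (2 * a) := by
  rw [ENNReal.ofReal_mul zero_le_two]
  simp

lemma norm_Qop_sub_kernel_le (h : AdmissibleKernel b C) (h' : AdmissibleKernel b' C)
    (hσ : 2 < σ) (c : ℝ) {E N : ℝ} (hE : 0 ≤ E) (hN : 0 < N)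
    (heq : ∀ x y z, |x| ≤ N → |y| ≤ N → |z| ≤ N → b x y z = b' x y z)
    {w : L2R} (hw : En (wX σ) (fhat w) ≤ ENNReal.ofReal E) :
    ‖Qop c b w w - Qop c b' w w‖ ≤ truncErr c C hσ E / N := by
  have r := reg_fhat_of_En hσ hw
  have hC := h.nonneg
  have hl := l1Const_nonneg hσ
  have h0 : 0 ≤ truncErr c C hσ E / N := by unfold truncErr; positivity
  refine (sq_le_sq₀ (norm_nonneg _) h0).mp (norm_sq_le_of_lintegral (by positivity) ?_)
  have e1 : ∫⁻ k, ‖fhat (Qop c b w w - Qop c b' w w) k‖ₑ ^ 2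
      ≤ ∫⁻ k, ENNReal.ofReal |c⁻¹| ^ 2 * ‖conv b (fhat w) (fhat w) k
        - conv b' (fhat w) (fhat w) k‖ₑ ^ 2 := by
    apply lintegral_mono_ae
    filter_upwards [fhat_sub (Qop c b w w) (Qop c b' w w), fhat_Qop h c r r,
      fhat_Qop h' c r r] with k k1 k2 k3
    rw [k1, k2, k3, ← mul_pow]
    gcongr
    unfold amp
    rw [← mul_sub, enorm_mul]
    gcongr
    rw [← ofReal_norm]
    apply ENNReal.ofReal_le_ofReal
    rw [norm_mul, norm_mul, Complex.norm_I, one_mul, Complex.norm_real, Real.norm_eq_abs,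
      ← Complex.ofReal_inv, Complex.norm_real, Real.norm_eq_abs]
    exact mul_le_of_le_one_left (abs_nonneg _) (abs_sg_le k)
  refine e1.trans ?_
  rw [lintegral_const_mul' _ _ (ENNReal.pow_ne_top ENNReal.ofReal_ne_top)]
  have e2 : ∫⁻ x, wmod w2 (fhat w) x ^ 2 ≤ ENNReal.ofReal (2 ^ (σ + 1 / 2) * E) := by
    refine (wmod_w2_sq_le hσ (fhat w)).trans ?_
    rw [ENNReal.ofReal_mul (by positivity)]
    gcongr
  have e3 := lintegral_w2_le_of_En_le hσ (measurable_fhat w) hE hw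
  refine (mul_le_mul_right ((h.conv_sub_sq_le h' hN heq r).trans
    (mul_le_mul_right (mul_le_mul' e2 (pow_le_pow_left₀ (by positivity) e3 2)) _)) _).trans ?_
  rw [← ENNReal.ofReal_pow (abs_nonneg _), ← ENNReal.ofReal_pow (by positivity),
    ← ENNReal.ofReal_pow (by positivity), ← ENNReal.ofReal_mul (by positivity),
    ← ENNReal.ofReal_mul (by positivity), ← ENNReal.ofReal_mul (by positivity)]
  apply ENNReal.ofReal_le_ofReal
  unfold truncErr
  have hs := Real.sq_sqrt (show 0 ≤ (2 : ℝ) ^ (σ + 1 / 2) * E by positivity)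
  apply le_of_eq
  generalize (2 : ℝ) ^ (σ + 1 / 2) * E = X at hs ⊢
  linear_combination (-(|c⁻¹| ^ 2 * (16 * C / N) ^ 2 * (l1Const hσ * √E) ^ 2)) * hs

/-- The constant in the Hölder continuity of the nonlinearity. -/
def holderConst (c C : ℝ) (hσ : 2 < σ) (E : ℝ) : ℝ :=
  |c⁻¹| ^ 2 * ((2 * C) ^ 2 * (2 * (√(2 ^ (σ + 1 / 2) * (4 * E)) * √(2 * Real.pi)) *
    (2 * (l1Const hσ * √(4 * E))) ^ 2))

/-- The direct bound on `Q(v-w, v+w)` needs a weighted norm of `v-w`. Since `w1² ≤ 2 w2`,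
Cauchy–Schwarz splits `∫ w1² |f|²` between a norm controlled by the energy and the plain `L²` norm:
on sets of bounded energy the nonlinearity is Hölder continuous of exponent `1/2` in `L²`. -/
lemma norm_Qop_sub_sq_le (h : AdmissibleKernel b C) (hσ : 2 < σ) (c : ℝ) {E : ℝ} (hE : 0 ≤ E)
    {v w : L2R} (hv : En (wX σ) (fhat v) ≤ ENNReal.ofReal E)
    (hw : En (wX σ) (fhat w) ≤ ENNReal.ofReal E) :
    ‖Qop c b v v - Qop c b w w‖ ^ 2 ≤ holderConst c C hσ E * ‖v - w‖ := by
  have rv := reg_fhat_of_En hσ hv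
  have rw' := reg_fhat_of_En hσ hw
  have hC := h.nonneg
  have hl := l1Const_nonneg hσ
  have hpi := Real.pi_pos
  have hs := reg_sub rv rw'
  have ha := reg_add rv rw'
  rw [Qop_sub h c rv rw']
  refine norm_sq_le_of_lintegral (by unfold holderConst; positivity) ?_
  rw [lintegral_congr_ae (g := fun k => ‖amp c b (fhat (v - w)) (fhat (v + w)) k‖ₑ ^ 2)
    (by filter_upwards [fhat_Qop h c hs ha] with k hk; rw [hk])]
  refine (lintegral_amp_sq_le c b _ _).trans ?_
  refine (mul_le_mul_right (h.conv_sq_le hs ha) _).trans ?_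
  have hEs : En (wX σ) (fhat (v - w)) ≤ ENNReal.ofReal (4 * E) := by
    rw [ENNReal.ofReal_mul (by norm_num)]
    refine (En_fhat_sub_le (energyWeight_wX (by linarith)).meas v w).trans ?_
    calc _ ≤ 2 * (ENNReal.ofReal E + ENNReal.ofReal E) := by gcongr
      _ = _ := by
        rw [show ENNReal.ofReal 4 = 4 by simp]
        ring
  have e1 : ∫⁻ x, wmod w1 (fhat (v - w)) x ^ 2 ≤
      ENNReal.ofReal (2 * (√(2 ^ (σ + 1 / 2) * (4 * E)) * √(2 * Real.pi)) * ‖v - w‖) := by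
    have hm := measurable_fhat (v - w)
    have hwm := measurable_wmod measurable_w2 hm
    have i1 : ∫⁻ x, wmod w1 (fhat (v - w)) x ^ 2
        ≤ 2 * ∫⁻ x, wmod w2 (fhat (v - w)) x * ‖fhat (v - w) x‖ₑ := by
      rw [← lintegral_const_mul _ (by fun_prop)]
      refine lintegral_mono fun x => ?_
      unfold wmod
      rw [mul_pow, ← ENNReal.ofReal_pow (w1_pos x).le, sq ‖_‖ₑ, mul_assoc, ← mul_assoc 2]
      rw [two_mul_ofReal]
      gcongr
      exact w1_sq_le x
    refine i1.trans ?_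
    refine (mul_le_mul_right (lintegral_mul_le_sqrt (by fun_prop) (by fun_prop)) _).trans ?_
    have i2 : (∫⁻ x, wmod w2 (fhat (v - w)) x ^ 2) ^ (1 / 2 : ℝ)
        ≤ ENNReal.ofReal √(2 ^ (σ + 1 / 2) * (4 * E)) := by
      rw [Real.sqrt_eq_rpow, ← ENNReal.ofReal_rpow_of_nonneg (by positivity) (by norm_num),
        ENNReal.ofReal_mul (by positivity)]
      gcongr
      exact (wmod_w2_sq_le hσ _).trans (by gcongr)
    have i3 : (∫⁻ x, ‖fhat (v - w) x‖ₑ ^ 2) ^ (1 / 2 : ℝ)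
        = ENNReal.ofReal (√(2 * Real.pi) * ‖v - w‖) := by
      have : ENNReal.ofReal (2 * Real.pi) * ‖v - w‖ₑ ^ 2
          = ENNReal.ofReal ((√(2 * Real.pi) * ‖v - w‖) ^ 2) := by
        rw [mul_pow, Real.sq_sqrt (by positivity),
          ENNReal.ofReal_mul (p := 2 * Real.pi) (by positivity),
          ENNReal.ofReal_pow (norm_nonneg _), ofReal_norm]
      rw [lintegral_fhat_sq, this, ENNReal.ofReal_rpow_of_nonneg (by positivity) (by norm_num),
        ← Real.sqrt_eq_rpow, Real.sqrt_sq (by positivity)]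
    rw [i3]
    refine (mul_le_mul_right (mul_le_mul_left i2 _) _).trans (le_of_eq ?_)
    rw [← ENNReal.ofReal_mul (by positivity), two_mul_ofReal]
    congr 1
    ring
  have e2 : ∫⁻ x, wmod w1 (fhat (v + w)) x ≤ ENNReal.ofReal (2 * (l1Const hσ * √(4 * E))) := by
    rw [ENNReal.ofReal_mul (by norm_num)]
    calc _ ≤ ∫⁻ x, ENNReal.ofReal 2 * wmod w2 (fhat (v + w)) x := by
          refine lintegral_mono fun x => ?_
          unfold wmod
          rw [← mul_assoc, ← ENNReal.ofReal_mul (by norm_num)]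
          gcongr
          exact w1_le x
      _ = ENNReal.ofReal 2 * ∫⁻ x, wmod w2 (fhat (v + w)) x :=
          lintegral_const_mul' _ _ ENNReal.ofReal_ne_top
      _ ≤ _ := by
          gcongr
          exact lintegral_w2_le_of_En_le hσ (measurable_fhat _) (by positivity)
            (En_fhat_add_le hσ hv hw)
  refine (mul_le_mul_right (mul_le_mul_right
    (mul_le_mul' e1 (pow_le_pow_left₀ (by positivity) e2 2)) _) _).trans ?_
  rw [← ENNReal.ofReal_pow (abs_nonneg _), ← ENNReal.ofReal_pow (by positivity),
    ← ENNReal.ofReal_pow (by positivity), ← ENNReal.ofReal_mul (by positivity),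
    ← ENNReal.ofReal_mul (by positivity), ← ENNReal.ofReal_mul (by positivity)]
  apply ENNReal.ofReal_le_ofReal
  unfold holderConst
  apply le_of_eq
  ring

/-- Stability in `L²`, with a defect `κ` between the two nonlinearities. -/
lemma norm_sub_sq_le (h : AdmissibleKernel b C) (hσ : 2 < σ) (c : ℝ) {E T κ : ℝ} (hE : 0 ≤ E)
    {u v g : ℝ → L2R}
    (hu : ∀ t ∈ Icc 0 T, HasDerivWithinAt u (Qop c b (u t) (u t)) (Icc 0 T) t)
    (hv : ∀ t ∈ Icc 0 T, HasDerivWithinAt v (g t) (Icc 0 T) t)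
    (hg : ∀ t ∈ Icc 0 T, ‖Qop c b (v t) (v t) - g t‖ ≤ κ)
    (huE : ∀ t ∈ Icc 0 T, En (wX σ) (fhat (u t)) ≤ ENNReal.ofReal E)
    (hvE : ∀ t ∈ Icc 0 T, En (wX σ) (fhat (v t)) ≤ ENNReal.ofReal E) :
    ∀ t ∈ Icc 0 T, ‖u t - v t‖ ^ 2 ≤
      (‖u 0 - v 0‖ ^ 2 + κ ^ 2) * Real.exp ((2 * diffRate c C hσ E + 1) * T) := by
  intro t ht
  have hC := h.nonneg
  have hD : 0 ≤ diffRate c C hσ E := by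
    have := l1Const_nonneg hσ
    unfold diffRate; positivity
  set y : ℝ → ℝ := fun t => ‖u t - v t‖ ^ 2 with hy
  set y' : ℝ → ℝ := fun t => 2 * inner ℝ (u t - v t) (Qop c b (u t) (u t) - g t) with hy'
  have hder : ∀ t ∈ Icc 0 T, HasDerivWithinAt y (y' t) (Icc 0 T) t := fun t ht =>
    ((hu t ht).sub (hv t ht)).norm_sq
  -- From `2 ‖u-v‖ κ ≤ ‖u-v‖² + κ²` come the `+ 1` in the rate and the forcing term `κ²`.
  have hg := norm_le_gronwallBound_of_norm_deriv_right_le (f := y) (f' := y') (a := 0) (b := T)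
      (δ := y 0) (K := 2 * diffRate c C hσ E + 1) (ε := κ ^ 2)
      (fun t ht => (hder t ht).continuousWithinAt)
      (fun t ht => hasDerivWithinAt_Ici_of_Icc ht (hder t (Ico_subset_Icc_self ht)))
      (by rw [Real.norm_eq_abs, abs_of_nonneg (by positivity)])
      (fun t ht => by
        have ht' := Ico_subset_Icc_self ht
        have h1 := abs_inner_diff_le h hσ c hE (huE t ht') (hvE t ht')
        have h2 : |inner ℝ (u t - v t) (Qop c b (v t) (v t) - g t)| ≤ ‖u t - v t‖ * κ :=
          (abs_real_inner_le_norm _ _).trans (by gcongr; exact hg t ht')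
        have h3 : inner ℝ (u t - v t) (Qop c b (u t) (u t) - g t)
            = inner ℝ (u t - v t) (Qop c b (u t) (u t) - Qop c b (v t) (v t))
              + inner ℝ (u t - v t) (Qop c b (v t) (v t) - g t) := by
          rw [← inner_add_right]
          congr 1
          abel
        rw [Real.norm_eq_abs, Real.norm_eq_abs, abs_of_nonneg (show 0 ≤ y t by positivity)]
        simp only [hy, hy']
        rw [h3, abs_mul, abs_two]
        have h4 := abs_add_le (inner ℝ (u t - v t) (Qop c b (u t) (u t) - Qop c b (v t) (v t)))
          (inner ℝ (u t - v t) (Qop c b (v t) (v t) - g t))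
        nlinarith [sq_nonneg (‖u t - v t‖ - κ)]) t ht
  rw [Real.norm_eq_abs, abs_of_nonneg (show 0 ≤ y t by positivity), sub_zero,
    gronwallBound_of_K_ne_0 (by positivity)] at hg
  set K := 2 * diffRate c C hσ E + 1 with hK
  have hK1 : 1 ≤ K := by linarith
  have hexp : Real.exp (K * t) ≤ Real.exp (K * T) := by
    gcongr
    exact ht.2
  have hexp1 : 1 ≤ Real.exp (K * t) := Real.one_le_exp (by have := ht.1; positivity)
  have hdiv : κ ^ 2 / K ≤ κ ^ 2 := div_le_self (by positivity) hK1
  refine hg.trans ?_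
  have hy0 : 0 ≤ y 0 := by positivity
  calc y 0 * Real.exp (K * t) + κ ^ 2 / K * (Real.exp (K * t) - 1)
      ≤ y 0 * Real.exp (K * T) + κ ^ 2 * Real.exp (K * T) := by
        gcongr
        linarith
    _ = _ := by ring

end Diff

/-- Limits of differentiable curves with uniformly convergent derivatives. -/
lemma hasDerivWithinAt_of_tendsto {F : Type*} [NormedAddCommGroup F] [NormedSpace ℝ F]
    {un G : ℕ → ℝ → F} {u q : ℝ → F} {S : Set ℝ} (hS : Convex ℝ S) {η : ℕ → ℝ}
    (hd : ∀ n, ∀ t ∈ S, HasDerivWithinAt (un n) (G n t) S t)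
    (hu : ∀ t ∈ S, Tendsto (fun n => un n t) atTop (𝓝 (u t)))
    (hη : Tendsto η atTop (𝓝 0)) (hG : ∀ n, ∀ t ∈ S, ‖G n t - q t‖ ≤ η n)
    (hq : ContinuousOn q S) {t : ℝ} (ht : t ∈ S) : HasDerivWithinAt u (q t) S t := by
  rw [hasDerivWithinAt_iff_isLittleO, Asymptotics.isLittleO_iff]
  intro ε hε
  have hqt := Metric.continuousWithinAt_iff.mp (hq t ht) ε hε
  obtain ⟨r, hr, hqr⟩ := hqt
  filter_upwards [inter_mem_nhdsWithin S (Metric.ball_mem_nhds t hr)] with s hs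
  have hconv : Convex ℝ (S ∩ Metric.ball t r) := hS.inter (convex_ball t r)
  have key : ∀ n, ‖(un n s - s • q t) - (un n t - t • q t)‖ ≤ (η n + ε) * ‖s - t‖ := by
    intro n
    refine Convex.norm_image_sub_le_of_norm_hasDerivWithin_le
      (f := fun x => un n x - x • q t) (f' := fun x => G n x - q t) (s := S ∩ Metric.ball t r)
      (fun x hx => ?_) (fun x hx => ?_) hconv ⟨ht, Metric.mem_ball_self hr⟩ hs
    · have h1 := (hd n x hx.1).mono (inter_subset_left (t := Metric.ball t r))
      have h2 := ((hasDerivAt_id x).smul_const (q t)).hasDerivWithinAt (s := S ∩ Metric.ball t r)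
      simpa using h1.fun_sub h2
    · have h1 := hG n x hx.1
      have h2 := (hqr hx.1 hx.2).le
      rw [dist_eq_norm] at h2
      calc ‖G n x - q t‖ = ‖(G n x - q x) + (q x - q t)‖ := by congr 1; abel
        _ ≤ _ := (norm_add_le _ _).trans (add_le_add h1 h2)
  have hlim : Tendsto (fun n => ‖(un n s - s • q t) - (un n t - t • q t)‖) atTop
      (𝓝 ‖(u s - s • q t) - (u t - t • q t)‖) :=
    (((hu s hs.1).sub_const _).sub ((hu t ht).sub_const _)).norm
  have hlim2 : Tendsto (fun n => (η n + ε) * ‖s - t‖) atTop (𝓝 ((0 + ε) * ‖s - t‖)) :=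
    (hη.add_const ε).mul_const _
  have := le_of_tendsto_of_tendsto' hlim hlim2 key
  rw [zero_add] at this
  have e : u s - u t - (s - t) • q t = (u s - s • q t) - (u t - t • q t) := by
    rw [sub_smul]
    abel
  rw [e]
  exact this

section Limit

variable {b : ℝ → ℝ → ℝ → ℂ} {C : ℝ} {σ : ℝ}

/-- Lower semicontinuity of the energy: each cut energy is continuous on `L²`, and the cut is then
removed by monotone convergence. -/
lemma En_le_of_tendsto {θ : ℝ → ℝ} {K : ℝ} (hθ : EnergyWeight θ K) {wn : ℕ → L2R} {w : L2R}
    (hw : Tendsto wn atTop (𝓝 w)) {B : ℝ≥0∞} (hB : ∀ n, En θ (fhat (wn n)) ≤ B) :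
    En θ (fhat w) ≤ B := by
  refine En_le_of_cut hθ.meas (measurable_fhat w) (N₀ := 0) fun N hN => ?_
  obtain ⟨M, -, hM⟩ := exists_energy_multiplier hθ hN
  have hc : Continuous fun x : L2R => ENNReal.ofReal (2 * Real.pi) * ‖M x‖ₑ ^ 2 :=
    (ENNReal.continuous_const_mul ENNReal.ofReal_ne_top).comp
      ((ENNReal.continuous_pow 2).comp (continuous_enorm.comp M.continuous))
  rw [hM]
  refine le_of_tendsto' ((hc.tendsto w).comp hw) fun n => ?_
  simp only [Function.comp_apply]
  rw [← hM]
  exact (En_cut_le _ _ _).trans (hB n)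

lemma continuousOn_Qop (h : AdmissibleKernel b C) (hσ : 2 < σ) (c : ℝ) {E : ℝ} (hE : 0 ≤ E)
    {u : ℝ → L2R} {S : Set ℝ} (hu : ContinuousOn u S)
    (huE : ∀ t ∈ S, En (wX σ) (fhat (u t)) ≤ ENNReal.ofReal E) :
    ContinuousOn (fun t => Qop c b (u t) (u t)) S := by
  intro t ht
  rw [ContinuousWithinAt, tendsto_iff_norm_sub_tendsto_zero]
  have h1 : Tendsto (fun s => √(holderConst c C hσ E * ‖u s - u t‖)) (𝓝[S] t) (𝓝 0) := by
    have h2 := tendsto_iff_norm_sub_tendsto_zero.mp (hu t ht)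
    have h3 := ((h2.const_mul (holderConst c C hσ E)).sqrt)
    simpa using h3
  refine squeeze_zero' (Eventually.of_forall fun s => norm_nonneg _) ?_ h1
  filter_upwards [self_mem_nhdsWithin] with s hs
  exact Real.le_sqrt_of_sq_le (norm_Qop_sub_sq_le h hσ c hE (huE s hs) (huE t ht))

lemma tendsto_div_succ (a : ℝ) : Tendsto (fun n : ℕ => a / ((n : ℝ) + 1)) atTop (𝓝 0) := by
  have := (tendsto_one_div_add_atTop_nhds_zero_nat (𝕜 := ℝ)).const_mul a
  simpa [div_eq_mul_inv] using this

lemma truncErr_nonneg (h : AdmissibleKernel b C) (c : ℝ) (hσ : 2 < σ) (E : ℝ) :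
    0 ≤ truncErr c C hσ E := by
  have := h.nonneg
  have := l1Const_nonneg hσ
  unfold truncErr
  positivity

/-- Local existence, with bounds for the energy and for its high-frequency part. -/
lemma exists_solution_bounds (h : AdmissibleKernel b C) (hσ : 2 < σ) (c : ℝ) {E : ℝ}
    (hE : 0 < E) {w₀ : L2R} (hw₀ : En (wX σ) (fhat w₀) ≤ ENNReal.ofReal E) :
    ∃ u : ℝ → L2R, u 0 = w₀ ∧
      (∀ t ∈ Icc 0 (lifespan c C hσ E), HasDerivWithinAt u (Qop c b (u t) (u t))
        (Icc 0 (lifespan c C hσ E)) t) ∧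
      (∀ t ∈ Icc 0 (lifespan c C hσ E), En (wX σ) (fhat (u t)) ≤ ENNReal.ofReal (4 * E)) ∧
      ∀ ρ > 0, ∀ t ∈ Icc 0 (lifespan c C hσ E), En (tailW ρ (wX σ)) (fhat (u t)) ≤
        ENNReal.ofReal (Real.exp (tailRate c C hσ E * lifespan c C hσ E)) *
          En (tailW ρ (wX σ)) (fhat w₀) := by
  have hT := lifespan_pos h hσ c hE
  have hex := fun n : ℕ => exists_trunc_solution_bounds h hσ c hE ((n : ℝ) + 1) hw₀
  set T := lifespan c C hσ E with hTdef
  choose un hun0 hund hunE hunt using hex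
  have h0T : (0 : ℝ) ∈ Icc 0 T := ⟨le_rfl, hT.le⟩
  have hX : EnergyWeight (wX σ) (growthX σ) := energyWeight_wX (by linarith)
  have hτ := truncErr_nonneg h c hσ (4 * E)
  have h4E : 0 ≤ 4 * E := by positivity
  set A := truncErr c C hσ (4 * E) * √(Real.exp ((2 * diffRate c C hσ (4 * E) + 1) * T)) with hA
  have hA0 : 0 ≤ A := by positivity
  -- The solution with the larger cutoff is regarded as an approximate solution of the equation with
  -- the smaller one. The defect is `O(1/(n+1))` because both kernels agree on frequencies at most
  -- `n + 1`, and the initial data coincide.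
  have hdiff : ∀ n m : ℕ, n ≤ m → ∀ t ∈ Icc 0 T, ‖un n t - un m t‖ ≤ A / (n + 1) := by
    intro n m hnm t ht
    have hn : (0 : ℝ) < n + 1 := by positivity
    have key := norm_sub_sq_le (h.trunc (n + 1)) hσ c h4E (hund n) (hund m)
      (κ := truncErr c C hσ (4 * E) / (n + 1))
      (fun s hs => norm_Qop_sub_kernel_le (h.trunc _) (h.trunc _) hσ c h4E hn
        (fun x y z hx hy hz => by
          have hnm' : (n : ℝ) + 1 ≤ m + 1 := by gcongr
          rw [trunc, trunc, if_pos ⟨hx, hy, hz⟩,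
            if_pos ⟨hx.trans hnm', hy.trans hnm', hz.trans hnm'⟩]) (hunE m s hs))
      (hunE n) (hunE m) t ht
    refine (sq_le_sq₀ (norm_nonneg _) (by positivity)).mp (key.trans (le_of_eq ?_))
    rw [hun0, hun0, sub_self, norm_zero, hA, div_pow, div_pow, mul_pow, Real.sq_sqrt (Real.exp_pos _).le]
    ring
  have hA1 : Tendsto (fun n : ℕ => A / ((n : ℝ) + 1)) atTop (𝓝 0) :=
    tendsto_div_succ A
  have hlim : ∀ t, ∃ x, t ∈ Icc 0 T → Tendsto (fun n => un n t) atTop (𝓝 x) := by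
    intro t
    by_cases ht : t ∈ Icc 0 T
    · have hc : CauchySeq fun n => un n t := by
        refine cauchySeq_of_le_tendsto_0' (fun n : ℕ => A / ((n : ℝ) + 1)) ?_ hA1
        intro n m hnm
        rw [dist_eq_norm]
        exact hdiff n m hnm t ht
      obtain ⟨x, hx⟩ := cauchySeq_tendsto_of_complete hc
      exact ⟨x, fun _ => hx⟩
    · exact ⟨0, fun h => absurd h ht⟩
  choose u hu using hlim
  have hdiffu : ∀ n : ℕ, ∀ t ∈ Icc 0 T, ‖un n t - u t‖ ≤ A / (n + 1) := by
    intro n t ht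
    refine le_of_tendsto ((tendsto_const_nhds.sub (hu t ht)).norm) ?_
    filter_upwards [eventually_ge_atTop n] with m hm
    exact hdiff n m hm t ht
  have huE : ∀ t ∈ Icc 0 T, En (wX σ) (fhat (u t)) ≤ ENNReal.ofReal (4 * E) := fun t ht =>
    En_le_of_tendsto hX (hu t ht) fun n => hunE n t ht
  have hucont : ContinuousOn u (Icc 0 T) := by
    have hunif : TendstoUniformlyOn un u atTop (Icc 0 T) := by
      rw [Metric.tendstoUniformlyOn_iff]
      intro ε hε
      filter_upwards [hA1.eventually (gt_mem_nhds hε)] with n hn t ht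
      rw [dist_comm, dist_eq_norm]
      exact (hdiffu n t ht).trans_lt hn
    exact hunif.continuousOn (Eventually.of_forall fun n t ht =>
      (hund n t ht).continuousWithinAt).frequently
  refine ⟨u, ?_, ?_, huE, ?_⟩
  · refine tendsto_nhds_unique (hu 0 h0T) ?_
    simp only [hun0]
    exact tendsto_const_nhds
  · intro t ht
    refine hasDerivWithinAt_of_tendsto (convex_Icc 0 T) hund hu (q := fun t => Qop c b (u t) (u t))
      -- The derivatives converge uniformly: the first term is the error of the truncated kernel
      -- along `un n`, the second the Hölder bound between `un n` and its limit.
      (η := fun n : ℕ => truncErr c C hσ (4 * E) / ((n : ℝ) + 1)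
        + √(holderConst c C hσ (4 * E) * (A / ((n : ℝ) + 1)))) ?_ ?_
      (continuousOn_Qop h hσ c h4E hucont huE) ht
    · have h1 : Tendsto (fun n : ℕ => truncErr c C hσ (4 * E) / ((n : ℝ) + 1)) atTop (𝓝 0) :=
        tendsto_div_succ _
      have h2 := (hA1.const_mul (holderConst c C hσ (4 * E))).sqrt
      simpa using h1.add h2
    · intro n s hs
      have hn : (0 : ℝ) < n + 1 := by positivity
      have h1 := norm_Qop_sub_kernel_le (h.trunc (n + 1)) h hσ c h4E hn
        (fun x y z hx hy hz => by rw [trunc, if_pos ⟨hx, hy, hz⟩]) (hunE n s hs)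
      have h2 := norm_Qop_sub_sq_le h hσ c h4E (hunE n s hs) (huE s hs)
      have hH : 0 ≤ holderConst c C hσ (4 * E) := by
        have := h.nonneg
        have := l1Const_nonneg hσ
        have := Real.pi_pos
        unfold holderConst; positivity
      have h3 : ‖Qop c b (un n s) (un n s) - Qop c b (u s) (u s)‖
          ≤ √(holderConst c C hσ (4 * E) * (A / ((n : ℝ) + 1))) := by
        refine Real.le_sqrt_of_sq_le (h2.trans ?_)
        gcongr
        exact hdiffu n s hs
      exact (norm_sub_le_norm_sub_add_norm_sub _ (Qop c b (un n s) (un n s)) _).trans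
        (add_le_add h1 h3)
  · intro ρ hρ t ht
    exact En_le_of_tendsto (hX.tail hρ) (hu t ht) fun n => hunt n ρ hρ t ht

end Limit

/-! ## Well-posedness for admissible kernels -/

section Norms

variable {σ : ℝ}

lemma wX_nonneg (σ k : ℝ) : 0 ≤ wX σ k := by unfold wX; positivity

/-- The `1` in the weight is the `L²` norm by Plancherel, and `|k|(1+k²)^σ` comes from squaring the
symbol `|k|^(1/2)`. The energy is thus equivalent to the square of the norm of `X_σ`. -/
lemma En_wX_eq (σ : ℝ) (w : L2R) : En (wX σ) (fhat w) =
    ENNReal.ofReal (2 * Real.pi) * ‖w‖ₑ ^ 2 + sobolevNorm σ (halfDerivHat w) ^ 2 := by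
  have e1 : sobolevNorm σ (halfDerivHat w) ^ 2
      = ∫⁻ k : ℝ, ENNReal.ofReal (|k| * (1 + k ^ 2) ^ σ) * ‖fhat w k‖ₑ ^ 2 := by
    rw [sobolevNorm, ← ENNReal.rpow_natCast, ← ENNReal.rpow_mul]
    norm_num
    apply lintegral_congr_ae
    filter_upwards [fhat_ae w] with k hk
    rw [halfDerivHat, ← hk, enorm_mul, mul_pow, ← mul_assoc, mul_comm (ENNReal.ofReal |k|)]
    congr 2
    rw [← ofReal_norm, Complex.norm_real, Real.norm_eq_abs, abs_of_nonneg (Real.sqrt_nonneg _),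
      ← ENNReal.ofReal_pow (Real.sqrt_nonneg _), Real.sq_sqrt (abs_nonneg _)]
  rw [e1, ← lintegral_fhat_sq, En_eq (wX_nonneg σ),
    ← lintegral_add_left ((measurable_fhat w).enorm.pow_const 2)]
  refine lintegral_congr fun k => ?_
  rw [wX, ENNReal.ofReal_add zero_le_one (by positivity), add_mul, ENNReal.ofReal_one, one_mul]

lemma En_le_invNorm (σ : ℝ) (w : L2R) :
    En (wX σ) (fhat w) ≤ ENNReal.ofReal (2 * Real.pi) * invNorm σ w ^ 2 := by
  rw [En_wX_eq, invNorm]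
  have h1 : 1 ≤ ENNReal.ofReal (2 * Real.pi) := by
    rw [ENNReal.one_le_ofReal]
    linarith [Real.pi_gt_three]
  set a := ‖w‖ₑ
  set s := sobolevNorm σ (halfDerivHat w)
  calc ENNReal.ofReal (2 * Real.pi) * a ^ 2 + s ^ 2
      ≤ ENNReal.ofReal (2 * Real.pi) * a ^ 2 + ENNReal.ofReal (2 * Real.pi) * s ^ 2 := by
        gcongr
        exact le_mul_of_one_le_left (by positivity) h1
    _ = ENNReal.ofReal (2 * Real.pi) * (a ^ 2 + s ^ 2) := by rw [mul_add]
    _ ≤ _ := by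
        gcongr
        calc a ^ 2 + s ^ 2 ≤ a ^ 2 + s ^ 2 + 2 * a * s := le_self_add
          _ = (a + s) ^ 2 := by ring

lemma invNorm_sq_le (σ : ℝ) (w : L2R) : invNorm σ w ^ 2 ≤ 2 * En (wX σ) (fhat w) := by
  rw [En_wX_eq, invNorm]
  refine (add_sq_le_ennreal _ _).trans ?_
  gcongr
  refine le_mul_of_one_le_left (by positivity) ?_
  rw [ENNReal.one_le_ofReal]
  linarith [Real.pi_gt_three]

lemma enorm_le_invNorm (σ : ℝ) (w : L2R) : ‖w‖ₑ ≤ invNorm σ w := le_self_add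

lemma mem_invImage_iff {w : L2R} : w ∈ invImage σ ↔ En (wX σ) (fhat w) < ⊤ := by
  rw [En_wX_eq, ENNReal.add_lt_top]
  constructor
  · exact fun h => ⟨ENNReal.mul_lt_top ENNReal.ofReal_lt_top (ENNReal.pow_lt_top enorm_lt_top),
      ENNReal.pow_lt_top h⟩
  · intro h
    by_contra h'
    have h'' : sobolevNorm σ (halfDerivHat w) = ⊤ := not_lt_top_iff.mp h'
    rw [h''] at h
    simp at h

lemma tendsto_invNorm {α : Type*} {l : Filter α} {v : α → L2R}
    (h : Tendsto (fun a => En (wX σ) (fhat (v a))) l (𝓝 0)) :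
    Tendsto (fun a => invNorm σ (v a)) l (𝓝 0) := by
  have h1 : Tendsto (fun a => (2 * En (wX σ) (fhat (v a))) ^ (1 / 2 : ℝ)) l (𝓝 0) := by
    have h2 : Tendsto (fun a => 2 * En (wX σ) (fhat (v a))) l (𝓝 0) := by
      have := ENNReal.Tendsto.const_mul (a := 2) h (Or.inr (by simp))
      simpa using this
    have h3 := h2.ennrpow_const (1 / 2 : ℝ)
    rwa [ENNReal.zero_rpow_of_pos (by norm_num)] at h3
  refine tendsto_of_tendsto_of_tendsto_of_le_of_le tendsto_const_nhds h1
    (fun a => zero_le) (fun a => ?_)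
  have := ENNReal.rpow_le_rpow (invNorm_sq_le σ (v a)) (z := 1 / 2) (by norm_num)
  rw [← ENNReal.rpow_natCast, ← ENNReal.rpow_mul] at this
  norm_num at this
  simpa using this

/-- Below `ρ` the weight is at most `wX σ ρ`, so `L²` convergence suffices there; above `ρ` the tail
weight is the full weight. Convergence in `X_σ` is always obtained in this way, from `L²`
convergence and uniformly small tails. -/
lemma En_split {ρ : ℝ} (hσ : 2 < σ) (hρ : 0 < ρ) (v : L2R) : En (wX σ) (fhat v) ≤
    ENNReal.ofReal (wX σ ρ) * (ENNReal.ofReal (2 * Real.pi) * ‖v‖ₑ ^ 2)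
      + En (tailW ρ (wX σ)) (fhat v) := by
  have hX : EnergyWeight (wX σ) (growthX σ) := energyWeight_wX (by linarith)
  have hm := measurable_fhat v
  rw [← lintegral_fhat_sq, En_eq (wX_nonneg σ), En_eq (hX.tail hρ).nonneg,
    ← lintegral_const_mul _ (by fun_prop), ← lintegral_add_left (by fun_prop)]
  refine lintegral_mono fun x => ?_
  rw [← add_mul]
  gcongr
  rcases le_total |x| ρ with hx | hx
  · refine le_trans (ENNReal.ofReal_le_ofReal (hX.mono x ρ ?_)) le_self_add
    rwa [abs_of_pos hρ]
  · rw [tailW_eq hρ hx]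
    exact le_add_self

/-- Dominated convergence: at each frequency the damped weight tends to `0` as `ρ → ∞`. -/
lemma exists_tail_le (hσ : 2 < σ) {f : ℝ → ℂ} (hf : Measurable f) (hE : En (wX σ) f < ⊤)
    {ε : ℝ≥0∞} (hε : 0 < ε) : ∃ ρ > 0, En (tailW ρ (wX σ)) f ≤ ε := by
  have hX : EnergyWeight (wX σ) (growthX σ) := energyWeight_wX (by linarith)
  have hXm := hX.meas
  have hlim : Tendsto (fun n : ℕ => En (tailW ((n : ℝ) + 1) (wX σ)) f) atTop (𝓝 0) := by
    have e : ∀ n : ℕ, En (tailW ((n : ℝ) + 1) (wX σ)) f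
        = ∫⁻ x, ENNReal.ofReal (tailW ((n : ℝ) + 1) (wX σ) x) * ‖f x‖ₑ ^ 2 := fun n =>
      En_eq (hX.tail (by positivity)).nonneg f
    simp_rw [e]
    have hE' := hE
    rw [En_eq (wX_nonneg σ)] at hE'
    have := tendsto_lintegral_of_dominated_convergence (μ := volume)
      (F := fun (n : ℕ) x => ENNReal.ofReal (tailW ((n : ℝ) + 1) (wX σ) x) * ‖f x‖ₑ ^ 2)
      (f := fun _ => 0) (fun x => ENNReal.ofReal (wX σ x) * ‖f x‖ₑ ^ 2)
      (fun n => by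
        have := (hX.tail (ρ := (n : ℝ) + 1) (by positivity)).meas
        fun_prop)
      (fun n => Eventually.of_forall fun x => by
        dsimp only
        gcongr
        exact tailW_le (wX_nonneg σ) x)
      hE'.ne
      (Eventually.of_forall fun x => by
        have h1 : Tendsto (fun n : ℕ => tailW ((n : ℝ) + 1) (wX σ) x) atTop (𝓝 0) := by
          have h2 := tendsto_div_succ |x|
          have h3 := (tendsto_const_nhds (x := (1 : ℝ))).min h2
          have h4 := h3.const_mul (wX σ x)
          simpa [tailW] using h4
        have h5 := ENNReal.tendsto_ofReal h1
        have h6 := ENNReal.Tendsto.mul_const (b := ‖f x‖ₑ ^ 2) h5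
          (Or.inr (ENNReal.pow_ne_top enorm_ne_top))
        simpa using h6)
    simpa using this
  obtain ⟨n, hn⟩ := ((ENNReal.tendsto_nhds_zero.mp hlim) ε hε).exists
  exact ⟨(n : ℝ) + 1, by positivity, hn⟩

end Norms

section Equation

variable {b : ℝ → ℝ → ℝ → ℂ} {C : ℝ} {σ : ℝ} {c : ℝ}

lemma hat_Qop (h : AdmissibleKernel b C) (c : ℝ) {w : L2R} (hw : Reg (fhat w)) :
    hat (Qop c b w w) =ᵐ[volume] amp c b (hat w) (hat w) := by
  rw [← amp_congr (fhat_ae w) (fhat_ae w)]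
  exact (fhat_ae _).symm.trans (fhat_Qop h c hw hw)

lemma hat_neg_ae (w : L2R) : hat (-w) =ᵐ[volume] fun k => -hat w k := by
  filter_upwards [fhat_ae w, fhat_ae (-w), fhat_neg_ae w] with k h1 h2 h3
  rw [← h1, ← h2, h3]

lemma neg_eq_Qop (h : AdmissibleKernel b C) {w g k : L2R} (hw : Reg (fhat w))
    (hg : IsAmplitudeB b c w g) (hk : IsHilbertTransform g k) : -k = Qop c b w w := by
  apply hat_injective
  filter_upwards [hg, hk, hat_neg_ae k, hat_Qop h c hw] with x h1 h2 h3 h4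
  rw [h3, h4, h2, h1.2, amp, conv]
  ring

lemma exists_amplitude (h : AdmissibleKernel b C) (c : ℝ) {w : L2R} (hw : Reg (fhat w)) :
    ∃ g k : L2R, IsAmplitudeB b c w g ∧ IsHilbertTransform g k ∧ -k = Qop c b w w := by
  have hconv := conv_congr (b := b) (fhat_ae w) (fhat_ae w)
  have hg : hat (ofHat fun k => (c : ℂ)⁻¹ * conv b (fhat w) (fhat w) k)
      =ᵐ[volume] fun k => (c : ℂ)⁻¹ * conv b (fhat w) (fhat w) k := by
    refine hat_ofHat ((h.memLp_conv hw hw).const_mul _) fun k => ?_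
    rw [h.conv_conj (fhat_neg w) (fhat_neg w), map_mul, map_inv₀, Complex.conj_ofReal]
  refine ⟨ofHat fun k => (c : ℂ)⁻¹ * conv b (fhat w) (fhat w) k, -Qop c b w w, ?_, ?_,
    neg_neg _⟩
  · filter_upwards [hg, h.ae_integrable hw hw] with k h1 h2
    refine ⟨h2.congr ?_, ?_⟩
    · have h3 := (fhat_ae w)
      have h4 : ∀ᵐ m : ℝ, fhat w (k - m) = hat w (k - m) :=
        (quasiMeasurePreserving_sub_left volume k).ae h3
      filter_upwards [h3, h4] with m h5 h6
      rw [h5, h6]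
    · rw [h1, hconv, conv]
  · filter_upwards [hg, hat_neg_ae (Qop c b w w), hat_Qop h c hw] with k h1 h2 h3
    rw [h1, h2, h3, hconv, amp]
    ring

end Equation

/-! ### Uniqueness, existence and continuous dependence -/

section WellPosed

variable {b : ℝ → ℝ → ℝ → ℂ} {C : ℝ} {σ : ℝ} {c T : ℝ}

/-- Continuity in `X_σ` bounds the energy near each time, and compactness of `[0, T]` makes the
bound uniform. -/
lemma IsSolution.exists_bound {w : ℝ → L2R} (hσ : 2 < σ) (hw : IsSolution b c σ T w) :
    ∃ E : ℝ, 0 ≤ E ∧ ∀ t ∈ Icc 0 T, En (wX σ) (fhat (w t)) ≤ ENNReal.ofReal E := by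
  have hX : EnergyWeight (wX σ) (growthX σ) := energyWeight_wX (by linarith)
  refine (isCompact_Icc (a := (0 : ℝ)) (b := T)).induction_on
    (p := fun S => ∃ E : ℝ, 0 ≤ E ∧ ∀ t ∈ S, En (wX σ) (fhat (w t)) ≤ ENNReal.ofReal E)
    ⟨0, le_rfl, by simp⟩ ?_ ?_ ?_
  · rintro s t hst ⟨E, hE, h⟩
    exact ⟨E, hE, fun x hx => h x (hst hx)⟩
  · rintro s t ⟨E, hE, h⟩ ⟨E', hE', h'⟩
    refine ⟨max E E', le_max_of_le_left hE, fun x hx => ?_⟩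
    rcases hx with hx | hx
    · exact (h x hx).trans (ENNReal.ofReal_le_ofReal (le_max_left _ _))
    · exact (h' x hx).trans (ENNReal.ofReal_le_ofReal (le_max_right _ _))
  · intro s hs
    have h1 := ENNReal.tendsto_nhds_zero.mp (hw.cont s hs) 1 one_pos
    refine ⟨_, h1, (2 * (ENNReal.ofReal (2 * Real.pi) * 1 ^ 2
      + En (wX σ) (fhat (w s)))).toReal, ENNReal.toReal_nonneg, fun t ht => ?_⟩
    have hfin : 2 * (ENNReal.ofReal (2 * Real.pi) * 1 ^ 2 + En (wX σ) (fhat (w s))) ≠ ⊤ := by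
      have := (mem_invImage_iff.mp (hw.mem s hs)).ne
      finiteness
    rw [ENNReal.ofReal_toReal hfin]
    have e : En (wX σ) (fhat (w t)) = En (wX σ) (fun x => fhat (w t - w s) x + fhat (w s) x) := by
      have := fhat_add (w t - w s) (w s)
      rw [sub_add_cancel] at this
      exact En_congr _ this
    rw [e]
    refine (En_add_le hX.meas (measurable_fhat _) (measurable_fhat _)).trans ?_
    gcongr
    refine (En_le_invNorm _ _).trans ?_
    gcongr
    exact ht

lemma IsSolution.hasDerivWithinAt (h : AdmissibleKernel b C) (hσ : 2 < σ) {w : ℝ → L2R}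
    (hw : IsSolution b c σ T w) {s : ℝ} (hs : s ∈ Icc 0 T) :
    HasDerivWithinAt w (Qop c b (w s) (w s)) (Icc 0 T) s := by
  obtain ⟨g, k, hg, hk, hd⟩ := hw.eqn s hs
  rwa [neg_eq_Qop h (reg_of_En hσ (measurable_fhat _) (mem_invImage_iff.mp (hw.mem s hs))) hg hk]
    at hd

lemma IsSolution.eqOn (h : AdmissibleKernel b C) (hσ : 2 < σ) {v w : ℝ → L2R}
    (hv : IsSolution b c σ T v) (hw : IsSolution b c σ T w) (h0 : v 0 = w 0) :
    EqOn v w (Icc 0 T) := by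
  obtain ⟨E, hE, hvE⟩ := hv.exists_bound hσ
  obtain ⟨E', hE', hwE⟩ := hw.exists_bound hσ
  intro t ht
  have key := norm_sub_sq_le h hσ c (E := max E E') (κ := 0) (le_max_of_le_left hE)
    (fun s hs => hv.hasDerivWithinAt h hσ hs) (fun s hs => hw.hasDerivWithinAt h hσ hs)
    (fun s hs => by simp)
    (fun s hs => (hvE s hs).trans (ENNReal.ofReal_le_ofReal (le_max_left _ _)))
    (fun s hs => (hwE s hs).trans (ENNReal.ofReal_le_ofReal (le_max_right _ _))) t ht
  rw [h0, sub_self, norm_zero] at key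
  have h2 : ‖v t - w t‖ ^ 2 ≤ 0 := by simpa using key
  have h3 : ‖v t - w t‖ = 0 := by nlinarith [norm_nonneg (v t - w t)]
  exact sub_eq_zero.mp (norm_eq_zero.mp h3)

/-- Factor in the propagation of high-frequency energies over the lifespan. -/
def tailFactor (c C : ℝ) (hσ : 2 < σ) (E : ℝ) : ℝ≥0∞ :=
  ENNReal.ofReal (Real.exp (tailRate c C hσ E * lifespan c C hσ E))

lemma exists_isSolution (h : AdmissibleKernel b C) (hσ : 2 < σ) (c : ℝ) {E : ℝ}
    (hE : 0 < E) {w₀ : L2R} (hw₀ : En (wX σ) (fhat w₀) ≤ ENNReal.ofReal E) :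
    ∃ u : ℝ → L2R, u 0 = w₀ ∧ IsSolution b c σ (lifespan c C hσ E) u ∧
      (∀ t ∈ Icc 0 (lifespan c C hσ E), En (wX σ) (fhat (u t)) ≤ ENNReal.ofReal (4 * E)) ∧
      ∀ ρ > 0, ∀ t ∈ Icc 0 (lifespan c C hσ E), En (tailW ρ (wX σ)) (fhat (u t)) ≤
        tailFactor c C hσ E * En (tailW ρ (wX σ)) (fhat w₀) := by
  obtain ⟨u, hu0, hud, huE, hut⟩ := exists_solution_bounds h hσ c hE hw₀
  have hX : EnergyWeight (wX σ) (growthX σ) := energyWeight_wX (by linarith)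
  refine ⟨u, hu0, ⟨fun s hs => ?_, fun s hs => ?_, fun s hs => ?_⟩, huE, hut⟩
  · exact mem_invImage_iff.mpr ((huE s hs).trans_lt ENNReal.ofReal_lt_top)
  · apply tendsto_invNorm
    rw [ENNReal.tendsto_nhds_zero]
    intro ε hε
    set Λ := tailFactor c C hσ E with hΛ
    have hΛtop : Λ ≠ ⊤ := ENNReal.ofReal_ne_top
    have hutΛ : ∀ ρ > 0, ∀ t ∈ Icc 0 (lifespan c C hσ E), En (tailW ρ (wX σ)) (fhat (u t)) ≤
        Λ * En (tailW ρ (wX σ)) (fhat w₀) := hut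
    -- One `ρ` serves all times, since tails grow at most by the factor `Λ`. The `4 Λ` is `2 (Λ +
    -- Λ)`, for the tail of a difference of two values of `u`.
    obtain ⟨ρ, hρ, hρε⟩ := exists_tail_le hσ (measurable_fhat w₀)
      (hw₀.trans_lt ENNReal.ofReal_lt_top) (ε := (ε / 2) / (4 * Λ))
      (ENNReal.div_pos (ENNReal.half_pos hε.ne').ne' (by finiteness))
    have hcont := (hud s hs).continuousWithinAt
    have hlow : Tendsto (fun s' => ENNReal.ofReal (wX σ ρ) *
        (ENNReal.ofReal (2 * Real.pi) * ‖u s' - u s‖ₑ ^ 2)) (𝓝[Icc 0 (lifespan c C hσ E)] s)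
        (𝓝 0) := by
      have h1 : Continuous fun x : L2R => ENNReal.ofReal (wX σ ρ) *
          (ENNReal.ofReal (2 * Real.pi) * ‖x - u s‖ₑ ^ 2) :=
        (ENNReal.continuous_const_mul ENNReal.ofReal_ne_top).comp
          ((ENNReal.continuous_const_mul ENNReal.ofReal_ne_top).comp
            ((ENNReal.continuous_pow 2).comp (continuous_enorm.comp (by fun_prop))))
      have h2 := (h1.tendsto (u s)).comp hcont
      simpa [Function.comp_def] using h2
    filter_upwards [ENNReal.tendsto_nhds_zero.mp hlow (ε / 2) (ENNReal.half_pos hε.ne'),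
      self_mem_nhdsWithin] with s' hs' hmem
    refine (En_split hσ hρ _).trans ?_
    rw [← ENNReal.add_halves ε]
    refine add_le_add hs' ?_
    calc _ ≤ 2 * (En (tailW ρ (wX σ)) (fhat (u s')) + En (tailW ρ (wX σ)) (fhat (u s))) :=
          En_fhat_sub_le (hX.tail hρ).meas _ _
      _ ≤ 2 * (Λ * ((ε / 2) / (4 * Λ)) + Λ * ((ε / 2) / (4 * Λ))) := by
          gcongr
          · exact (hutΛ ρ hρ s' hmem).trans (by gcongr)
          · exact (hutΛ ρ hρ s hs).trans (by gcongr)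
      _ = (4 * Λ) * ((ε / 2) / (4 * Λ)) := by ring
      _ ≤ ε / 2 := ENNReal.mul_div_le
  · obtain ⟨g, k, hg, hk, he⟩ := exists_amplitude h c (reg_fhat_of_En hσ (huE s hs))
    refine ⟨g, k, hg, hk, ?_⟩
    rw [he]
    exact hud s hs

/-- By uniqueness an arbitrary solution is the constructed one, and inherits the bounds obtained
along the approximation; no energy estimate is performed on the solution itself. -/
lemma IsSolution.bounds (h : AdmissibleKernel b C) (hσ : 2 < σ) {E : ℝ} (hE : 0 < E)
    {w : ℝ → L2R} (hw : IsSolution b c σ (lifespan c C hσ E) w)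
    (hw₀ : En (wX σ) (fhat (w 0)) ≤ ENNReal.ofReal E) :
    (∀ t ∈ Icc 0 (lifespan c C hσ E), En (wX σ) (fhat (w t)) ≤ ENNReal.ofReal (4 * E)) ∧
      ∀ ρ > 0, ∀ t ∈ Icc 0 (lifespan c C hσ E), En (tailW ρ (wX σ)) (fhat (w t)) ≤
        tailFactor c C hσ E * En (tailW ρ (wX σ)) (fhat (w 0)) := by
  obtain ⟨u, hu0, hu, huE, hut⟩ := exists_isSolution h hσ c hE hw₀
  have heq := hw.eqOn h hσ hu hu0.symm
  refine ⟨fun t ht => ?_, fun ρ hρ t ht => ?_⟩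
  · rw [heq ht]; exact huE t ht
  · rw [heq ht]; exact hut ρ hρ t ht

/-- The cutoff `ρ` is chosen from the tail of `w 0` alone. A nearby datum has a comparable tail,
both tails propagate with the factor `Λ`, and the frequencies below `ρ` are governed by the `L²`
stability estimate. -/
lemma continuous_dependence (h : AdmissibleKernel b C) (hσ : 2 < σ) {E : ℝ} (hE : 0 < E)
    {w : ℝ → L2R} (hw : IsSolution b c σ (lifespan c C hσ E) w)
    (hw₀ : En (wX σ) (fhat (w 0)) ≤ ENNReal.ofReal E) {ε : ℝ≥0∞} (hε : 0 < ε) :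
    ∃ δ : ℝ≥0∞, 0 < δ ∧ ∀ w' : ℝ → L2R, IsSolution b c σ (lifespan c C hσ E) w' →
      En (wX σ) (fhat (w' 0)) ≤ ENNReal.ofReal E → invNorm σ (w' 0 - w 0) < δ →
        ∀ s ∈ Icc 0 (lifespan c C hσ E), En (wX σ) (fhat (w' s - w s)) ≤ ε := by
  have hX : EnergyWeight (wX σ) (growthX σ) := energyWeight_wX (by linarith)
  set Λ := tailFactor c C hσ E with hΛ
  have hΛtop : Λ ≠ ⊤ := ENNReal.ofReal_ne_top
  set G := ENNReal.ofReal (Real.exp ((2 * diffRate c C hσ (4 * E) + 1) * lifespan c C hσ E))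
    with hG
  have hGtop : G ≠ ⊤ := ENNReal.ofReal_ne_top
  obtain ⟨hwE, hwt⟩ := hw.bounds h hσ hE hw₀
  obtain ⟨ρ, hρ, hρε⟩ := exists_tail_le hσ (measurable_fhat (w 0))
    (hw₀.trans_lt ENNReal.ofReal_lt_top) (ε := (ε / 2) / (6 * Λ))
    (ENNReal.div_pos (ENNReal.half_pos hε.ne').ne' (by finiteness))
  set P := ENNReal.ofReal (2 * Real.pi) with hP
  have hPtop : P ≠ ⊤ := ENNReal.ofReal_ne_top
  -- The first term collects the low frequencies, amplified by `G` through `L²` stability. The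
  -- second is the part of the tail of `w'` due to `w' 0 - w 0`, with `4 = 2 · 2` from two uses of
  -- `(a+b)² ≤ 2(a²+b²)`. The tail of `w 0` itself enters with `2 (2Λ + Λ) = 6Λ`.
  set D := ENNReal.ofReal (wX σ ρ) * P * G + 4 * Λ * P with hD
  have hDtop : D ≠ ⊤ := by rw [hD]; finiteness
  have hlim : Tendsto (fun x : ℝ≥0∞ => D * x ^ 2) (𝓝 0) (𝓝 0) := by
    have h1 : Continuous fun x : ℝ≥0∞ => D * x ^ 2 :=
      (ENNReal.continuous_const_mul hDtop).comp (ENNReal.continuous_pow 2)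
    simpa using h1.tendsto 0
  have hev := ENNReal.tendsto_nhds_zero.mp hlim (ε / 2) (ENNReal.half_pos hε.ne')
  obtain ⟨δ, hδ, hδε⟩ := ENNReal.nhds_zero_basis.eventually_iff.mp hev
  refine ⟨δ, hδ, fun w' hw' hw'0 hlt s hs => ?_⟩
  obtain ⟨hw'E, hw't⟩ := hw'.bounds h hσ hE hw'0
  set x := invNorm σ (w' 0 - w 0) with hx
  have key := norm_sub_sq_le h hσ c (E := 4 * E) (κ := 0) (by positivity)
    (fun s hs => hw'.hasDerivWithinAt h hσ hs) (fun s hs => hw.hasDerivWithinAt h hσ hs)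
    (fun s hs => by simp) hw'E hwE s hs
  have hsq : ‖w' s - w s‖ₑ ^ 2 ≤ G * x ^ 2 := by
    calc ‖w' s - w s‖ₑ ^ 2 = ENNReal.ofReal (‖w' s - w s‖ ^ 2) := by
          rw [ENNReal.ofReal_pow (norm_nonneg _), ofReal_norm]
      _ ≤ ENNReal.ofReal (‖w' 0 - w 0‖ ^ 2 *
          Real.exp ((2 * diffRate c C hσ (4 * E) + 1) * lifespan c C hσ E)) := by
          apply ENNReal.ofReal_le_ofReal
          simpa using key
      _ = G * ‖w' 0 - w 0‖ₑ ^ 2 := by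
          rw [ENNReal.ofReal_mul (by positivity), ENNReal.ofReal_pow (norm_nonneg _),
            ofReal_norm, mul_comm]
      _ ≤ _ := by
          gcongr
          exact enorm_le_invNorm σ _
  have htail : En (tailW ρ (wX σ)) (fhat (w' 0)) ≤
      2 * (P * x ^ 2 + En (tailW ρ (wX σ)) (fhat (w 0))) := by
    have e : En (tailW ρ (wX σ)) (fhat (w' 0))
        = En (tailW ρ (wX σ)) (fun x => fhat (w' 0 - w 0) x + fhat (w 0) x) := by
      have := fhat_add (w' 0 - w 0) (w 0)
      rw [sub_add_cancel] at this
      exact En_congr _ this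
    rw [e]
    refine (En_add_le (hX.tail hρ).meas (measurable_fhat _) (measurable_fhat _)).trans ?_
    gcongr
    exact (En_mono (tailW_le (wX_nonneg σ)) _).trans (En_le_invNorm _ _)
  set y := En (tailW ρ (wX σ)) (fhat (w 0)) with hy
  calc En (wX σ) (fhat (w' s - w s))
      ≤ ENNReal.ofReal (wX σ ρ) * (P * ‖w' s - w s‖ₑ ^ 2)
        + En (tailW ρ (wX σ)) (fhat (w' s - w s)) := En_split hσ hρ _
    _ ≤ ENNReal.ofReal (wX σ ρ) * (P * (G * x ^ 2))
        + 2 * (Λ * (2 * (P * x ^ 2 + y)) + Λ * y) := by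
        gcongr
        refine (En_fhat_sub_le (hX.tail hρ).meas _ _).trans ?_
        gcongr
        · exact (hw't ρ hρ s hs).trans (by gcongr)
        · exact hwt ρ hρ s hs
    _ = D * x ^ 2 + (6 * Λ) * y := by rw [hD]; ring
    _ ≤ ε / 2 + (6 * Λ) * ((ε / 2) / (6 * Λ)) := by
        gcongr
        exact hδε hlt
    _ ≤ ε / 2 + ε / 2 := by
        gcongr
        exact ENNReal.mul_div_le
    _ = ε := ENNReal.add_halves ε

/-- The amplitude equation with an admissible kernel is locally well-posed. -/
theorem AdmissibleKernel.locallyWellPosed (h : AdmissibleKernel b C) (hσ : 2 < σ) (c : ℝ) :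
    LocallyWellPosed b c σ where
  unique _ _ _ _ hv hw h0 := hv.eqOn h hσ hw h0
  exist R hR := by
    have hE : 0 < 2 * Real.pi * R ^ 2 := by positivity
    have hbd : ∀ w : L2R, invNorm σ w ≤ ENNReal.ofReal R →
        En (wX σ) (fhat w) ≤ ENNReal.ofReal (2 * Real.pi * R ^ 2) := by
      intro w hw
      refine (En_le_invNorm σ w).trans ?_
      rw [ENNReal.ofReal_mul (p := 2 * Real.pi) (by positivity), ENNReal.ofReal_pow hR.le]
      gcongr
    refine ⟨lifespan c C hσ (2 * Real.pi * R ^ 2), lifespan_pos h hσ c hE,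
      fun w₀ _ hw₀ => ?_, fun w hw hw₀ ε hε => ?_⟩
    · obtain ⟨u, hu0, hu, -⟩ := exists_isSolution h hσ c hE (hbd w₀ hw₀)
      exact ⟨u, hu, hu0⟩
    -- `ε` may be infinite; the strict inequality `ε₁²/2 < ε₁²` needs a finite value.
    · set ε₁ := min ε 1 with hε₁
      have hε₁0 : 0 < ε₁ := lt_min hε one_pos
      have hε₁top : ε₁ ≠ ⊤ := ((min_le_right _ _).trans_lt ENNReal.one_lt_top).ne
      have hsq0 : ε₁ ^ 2 ≠ 0 := pow_ne_zero 2 hε₁0.ne'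
      have hpos : 0 < ε₁ ^ 2 / 2 / 2 := ENNReal.half_pos (ENNReal.half_pos hsq0).ne'
      obtain ⟨δ, hδ, hδε⟩ := continuous_dependence h hσ hE hw (hbd _ hw₀) hpos
      refine ⟨δ, hδ, fun w' hw' hw'0 hlt s hs => ?_⟩
      have h1 := hδε w' hw' (hbd _ hw'0) hlt s hs
      have h2 : invNorm σ (w' s - w s) ^ 2 < ε₁ ^ 2 := by
        calc _ ≤ 2 * En (wX σ) (fhat (w' s - w s)) := invNorm_sq_le _ _
          _ ≤ 2 * (ε₁ ^ 2 / 2 / 2) := by gcongr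
          _ = ε₁ ^ 2 / 2 := ENNReal.mul_div_cancel (by simp) (by simp)
          _ < ε₁ ^ 2 := ENNReal.half_lt_self hsq0 (by finiteness)
      exact (lt_of_not_ge fun hle => h2.not_ge (by gcongr)).trans_le (min_le_left _ _)

end WellPosed

/-! ## Bounds for square integrable solutions of second order systems -/

section Window

lemma lintegral_Ioi_add_le (φ : ℝ → ℝ≥0∞) {z : ℝ} (hz : 0 ≤ z) :
    ∫⁻ t in Ioi 0, φ (z + t) ≤ ∫⁻ t in Ioi 0, φ t := by
  rw [← lintegral_indicator measurableSet_Ioi, ← lintegral_indicator measurableSet_Ioi,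
    ← lintegral_add_left_eq_self (fun t => (Ioi (0 : ℝ)).indicator φ t) z]
  refine lintegral_mono fun t => ?_
  by_cases ht : t ∈ Ioi (0 : ℝ)
  · have : z + t ∈ Ioi (0 : ℝ) := by
      simp only [mem_Ioi] at ht ⊢
      linarith
    rw [indicator_of_mem ht, indicator_of_mem this]
  · rw [indicator_of_notMem ht]
    exact zero_le

variable {f g : ℝ → ℝ≥0∞} {K : ℝ≥0∞}

lemma sq_le_of_window (hg : Measurable g)
    (h : ∀ z > 0, f z ≤ K * ∫⁻ t in Ioc 0 1, g (z + t)) {z : ℝ} (hz : 0 < z) :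
    f z ^ 2 ≤ K ^ 2 * ∫⁻ t in Ioc 0 1, g (z + t) ^ 2 := by
  have h1 := sq_lintegral_mul_le (μ := volume.restrict (Ioc (0 : ℝ) 1))
    (F := fun t => g (z + t)) (G := fun _ => 1) (by fun_prop) (by fun_prop)
  simp only [mul_one, one_pow, lintegral_const, Measure.restrict_apply MeasurableSet.univ,
    univ_inter, Real.volume_Ioc, sub_zero, ENNReal.ofReal_one] at h1
  calc f z ^ 2 ≤ (K * ∫⁻ t in Ioc 0 1, g (z + t)) ^ 2 := by gcongr; exact h z hz
    _ = K ^ 2 * (∫⁻ t in Ioc 0 1, g (z + t)) ^ 2 := by rw [mul_pow]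
    _ ≤ _ := by gcongr

lemma sq_le_lintegral_of_window (hg : Measurable g)
    (h : ∀ z > 0, f z ≤ K * ∫⁻ t in Ioc 0 1, g (z + t)) {z : ℝ} (hz : 0 < z) :
    f z ^ 2 ≤ K ^ 2 * ∫⁻ t in Ioi 0, g t ^ 2 := by
  refine (sq_le_of_window hg h hz).trans ?_
  exact mul_le_mul_right ((lintegral_mono_set Ioc_subset_Ioi_self).trans
    (lintegral_Ioi_add_le (fun t => g t ^ 2) hz.le)) _

/-- Fubini: an average over unit windows does not increase the `L²` norm on the half-line, apart
from the factor `K`. Together with the pointwise bound above, a window estimate yields both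
boundedness and square integrability. -/
lemma lintegral_sq_le_of_window (hg : Measurable g)
    (h : ∀ z > 0, f z ≤ K * ∫⁻ t in Ioc 0 1, g (z + t)) :
    ∫⁻ z in Ioi 0, f z ^ 2 ≤ K ^ 2 * ∫⁻ t in Ioi 0, g t ^ 2 := by
  calc ∫⁻ z in Ioi 0, f z ^ 2
      ≤ ∫⁻ z in Ioi 0, K ^ 2 * ∫⁻ t in Ioc 0 1, g (z + t) ^ 2 :=
        setLIntegral_mono' measurableSet_Ioi fun z hz => sq_le_of_window hg h hz
    _ = K ^ 2 * ∫⁻ z in Ioi 0, ∫⁻ t in Ioc 0 1, g (z + t) ^ 2 := by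
        rw [lintegral_const_mul]
        exact Measurable.lintegral_prod_right' (f := fun p : ℝ × ℝ => g (p.1 + p.2) ^ 2)
          (by fun_prop)
    _ = K ^ 2 * ∫⁻ t in Ioc 0 1, ∫⁻ z in Ioi 0, g (t + z) ^ 2 := by
        rw [lintegral_lintegral_swap (by
          apply Measurable.aemeasurable
          unfold Function.uncurry
          fun_prop)]
        simp_rw [add_comm]
    _ ≤ K ^ 2 * ∫⁻ t in Ioc (0 : ℝ) 1, ∫⁻ z in Ioi 0, g z ^ 2 := by
        gcongr 1
        exact setLIntegral_mono' measurableSet_Ioc fun t ht =>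
          lintegral_Ioi_add_le (fun t => g t ^ 2) ht.1.le
    _ = _ := by simp

end Window

/-! ### Window estimates for `X'' = A X' + B X` -/

section SecondOrder

variable {E : Type*} [NormedAddCommGroup E] [NormedSpace ℝ E] [CompleteSpace E]

lemma enorm_sub_le_lintegral {Φ Φ' : ℝ → E} (hd : ∀ t ∈ Icc (0 : ℝ) 1, HasDerivAt Φ (Φ' t) t)
    (hc : Continuous Φ') : ‖Φ 1 - Φ 0‖ₑ ≤ ∫⁻ t in Ioc 0 1, ‖Φ' t‖ₑ := by
  rw [← intervalIntegral.integral_eq_sub_of_hasDerivAt (f := Φ) (f' := Φ') (a := 0) (b := 1)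
    (fun t ht => hd t (by rwa [uIcc_of_le zero_le_one] at ht)) (hc.intervalIntegrable 0 1),
    intervalIntegral.integral_of_le zero_le_one]
  exact enorm_integral_le_lintegral_enorm _

variable {X Y : ℝ → E} {A B : E →L[ℝ] E}

/-- The fundamental theorem of calculus for `(1-t) X(z+t)`, which passes from `X(z)` to `0`. -/
lemma enorm_le_window (hX : Continuous X) (hY : Continuous Y)
    (hXd : ∀ s > 0, HasDerivAt X (Y s) s) {z : ℝ} (hz : 0 < z) :
    ‖X z‖ₑ ≤ 1 * ∫⁻ t in Ioc 0 1, (‖X (z + t)‖ₑ + ‖Y (z + t)‖ₑ) := by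
  have h := enorm_sub_le_lintegral (Φ := fun t => (1 - t) • X (z + t))
    (Φ' := fun t => (1 - t) • Y (z + t) + (-1 : ℝ) • X (z + t)) (fun t ht => by
      have h1 : HasDerivAt (fun t => X (z + t)) (Y (z + t)) t :=
        (hXd (z + t) (by linarith [ht.1])).comp_const_add z t
      have h2 : HasDerivAt (fun t : ℝ => 1 - t) (-1) t := by
        simpa using (hasDerivAt_id t).const_sub 1
      exact h2.smul h1) (by fun_prop)
  simp only [sub_self, zero_smul, sub_zero, one_smul, add_zero, zero_sub, enorm_neg] at h
  rw [one_mul]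
  refine h.trans (setLIntegral_mono' measurableSet_Ioc fun t ht => ?_)
  refine (enorm_add_le _ _).trans ?_
  rw [neg_one_smul, enorm_neg, add_comm]
  gcongr
  rw [enorm_smul]
  refine mul_le_of_le_one_left (by positivity) ?_
  rw [← ofReal_norm, Real.norm_eq_abs, ENNReal.ofReal_le_one, abs_le]
  constructor <;> linarith [ht.1, ht.2]

/-- Let `p(t) = 1 - 3t² + 2t³`, so that `p(0) = 1` and `p(1) = p'(0) = p'(1) = 0`. Because `(Y - A
X)' = B X`, the derivative of `p (Y - A X) - p' X` is `p B X - p' A X - p'' X`: the terms in `Y`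
cancel. The derivative `Y` is thus controlled by `X` alone, and `6` bounds `p`, `p'` and `p''` on
`[0, 1]`. -/
lemma enorm_sub_le_window (hX : Continuous X) (hXd : ∀ s > 0, HasDerivAt X (Y s) s)
    (hYd : ∀ s > 0, HasDerivAt Y (A (Y s) + B (X s)) s) {z : ℝ} (hz : 0 < z) :
    ‖Y z - A (X z)‖ₑ ≤ ENNReal.ofReal (6 * (‖A‖ + ‖B‖ + 1)) *
      ∫⁻ t in Ioc 0 1, ‖X (z + t)‖ₑ := by
  have h := enorm_sub_le_lintegral
    (Φ := fun t => (1 - 3 * t ^ 2 + 2 * t ^ 3) • (Y (z + t) - A (X (z + t)))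
      - (6 * t ^ 2 - 6 * t) • X (z + t))
    (Φ' := fun t => (1 - 3 * t ^ 2 + 2 * t ^ 3) • B (X (z + t))
      - (6 * t ^ 2 - 6 * t) • A (X (z + t)) - (12 * t - 6) • X (z + t)) (fun t ht => by
      have hs : z + t > 0 := by linarith [ht.1]
      have h1 : HasDerivAt (fun t => X (z + t)) (Y (z + t)) t :=
        (hXd (z + t) hs).comp_const_add z t
      have h2 : HasDerivAt (fun t => Y (z + t)) (A (Y (z + t)) + B (X (z + t))) t :=
        (hYd (z + t) hs).comp_const_add z t
      have h3 : HasDerivAt (fun t => A (X (z + t))) (A (Y (z + t))) t :=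
        A.hasFDerivAt.comp_hasDerivAt t h1
      have h4 : HasDerivAt (fun t : ℝ => 1 - 3 * t ^ 2 + 2 * t ^ 3) (6 * t ^ 2 - 6 * t) t := by
        have := ((((hasDerivAt_pow 2 t).const_mul 3).const_sub 1).add
          ((hasDerivAt_pow 3 t).const_mul 2))
        refine this.congr_deriv ?_
        push_cast
        ring
      have h5 : HasDerivAt (fun t : ℝ => 6 * t ^ 2 - 6 * t) (12 * t - 6) t := by
        have := ((hasDerivAt_pow 2 t).const_mul 6).sub ((hasDerivAt_id t).const_mul 6)
        refine this.congr_deriv ?_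
        push_cast
        ring
      refine ((h4.smul (h2.sub h3)).sub (h5.smul h1)).congr_deriv ?_
      simp only [Pi.sub_apply, smul_sub, smul_add]
      abel) (by fun_prop)
  have e : ((1 : ℝ) - 3 * 1 ^ 2 + 2 * 1 ^ 3) • (Y (z + 1) - A (X (z + 1)))
      - ((6 : ℝ) * 1 ^ 2 - 6 * 1) • X (z + 1)
      - (((1 : ℝ) - 3 * 0 ^ 2 + 2 * 0 ^ 3) • (Y (z + 0) - A (X (z + 0)))
      - ((6 : ℝ) * 0 ^ 2 - 6 * 0) • X (z + 0)) = -(Y z - A (X z)) := by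
    norm_num
  rw [e, enorm_neg] at h
  refine h.trans ?_
  rw [← lintegral_const_mul' _ _ ENNReal.ofReal_ne_top]
  refine setLIntegral_mono' measurableSet_Ioc fun t ht => ?_
  rw [← ofReal_norm, ← ofReal_norm, ← ENNReal.ofReal_mul (by positivity)]
  apply ENNReal.ofReal_le_ofReal
  have ht0 := ht.1.le
  have ht1 := ht.2
  have b1 : |1 - 3 * t ^ 2 + 2 * t ^ 3| ≤ 6 := by
    have : t ^ 2 ≤ 1 := pow_le_one₀ ht0 ht1
    have : t ^ 3 ≤ 1 := pow_le_one₀ ht0 ht1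
    have : 0 ≤ t ^ 3 := by positivity
    rw [abs_le]; constructor <;> nlinarith
  have b2 : |6 * t ^ 2 - 6 * t| ≤ 6 := by
    have : t ^ 2 ≤ 1 := pow_le_one₀ ht0 ht1
    rw [abs_le]; constructor <;> nlinarith
  have b3 : |12 * t - 6| ≤ 6 := by rw [abs_le]; constructor <;> linarith
  set x := X (z + t)
  calc _ ≤ ‖(1 - 3 * t ^ 2 + 2 * t ^ 3) • B x‖ + ‖(6 * t ^ 2 - 6 * t) • A x‖
        + ‖(12 * t - 6) • x‖ := by
        refine (norm_sub_le _ _).trans ?_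
        gcongr
        exact norm_sub_le _ _
    _ ≤ 6 * (‖B‖ * ‖x‖) + 6 * (‖A‖ * ‖x‖) + 6 * ‖x‖ := by
        rw [norm_smul, norm_smul, norm_smul, Real.norm_eq_abs, Real.norm_eq_abs, Real.norm_eq_abs]
        gcongr
        · exact B.le_opNorm x
        · exact A.le_opNorm x
    _ = _ := by ring

/-- A square integrable solution of `X'' = A X' + B X` on the half-line is bounded, and so is its
derivative, which is square integrable as well. -/
lemma exists_bound_of_second_order (hX : Continuous X) (hY : Continuous Y)
    (hXd : ∀ s > 0, HasDerivAt X (Y s) s)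
    (hYd : ∀ s > 0, HasDerivAt Y (A (Y s) + B (X s)) s)
    (hX2 : ∫⁻ s in Ioi 0, ‖X s‖ₑ ^ 2 < ⊤) :
    ∃ H : ℝ≥0∞, H ≠ ⊤ ∧ (∀ s > 0, ‖X s‖ₑ + ‖Y s‖ₑ ≤ H) ∧
      ∫⁻ s in Ioi 0, (‖X s‖ₑ + ‖Y s‖ₑ) ^ 2 < ⊤ := by
  have hXm := hX.enorm.measurable
  have hYm := hY.enorm.measurable
  have hU : ∀ z > 0, ‖Y z - A (X z)‖ₑ ≤ ENNReal.ofReal (6 * (‖A‖ + ‖B‖ + 1)) *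
      ∫⁻ t in Ioc 0 1, ‖X (z + t)‖ₑ := fun z hz => enorm_sub_le_window hX hXd hYd hz
  set K := ENNReal.ofReal (6 * (‖A‖ + ‖B‖ + 1)) with hK
  have hKtop : K ≠ ⊤ := ENNReal.ofReal_ne_top
  have hYle : ∀ s, ‖Y s‖ₑ ≤ ‖Y s - A (X s)‖ₑ + ‖A‖ₑ * ‖X s‖ₑ := fun s => by
    calc ‖Y s‖ₑ = ‖(Y s - A (X s)) + A (X s)‖ₑ := by rw [sub_add_cancel]
      _ ≤ _ := (enorm_add_le _ _).trans (by gcongr; exact A.le_opENorm _)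
  have hUm : Measurable fun s => ‖Y s - A (X s)‖ₑ :=
    (hY.sub (A.continuous.comp hX)).enorm.measurable
  have hU2 : ∫⁻ s in Ioi 0, ‖Y s - A (X s)‖ₑ ^ 2 < ⊤ :=
    (lintegral_sq_le_of_window hXm hU).trans_lt
      (ENNReal.mul_lt_top (ENNReal.pow_lt_top hKtop.lt_top) hX2)
  have hY2 : ∫⁻ s in Ioi 0, ‖Y s‖ₑ ^ 2 < ⊤ := by
    calc ∫⁻ s in Ioi 0, ‖Y s‖ₑ ^ 2
        ≤ ∫⁻ s in Ioi 0, (2 * ‖Y s - A (X s)‖ₑ ^ 2 + 2 * ‖A‖ₑ ^ 2 * ‖X s‖ₑ ^ 2) := by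
          refine lintegral_mono fun s => ?_
          calc ‖Y s‖ₑ ^ 2 ≤ (‖Y s - A (X s)‖ₑ + ‖A‖ₑ * ‖X s‖ₑ) ^ 2 := by
                gcongr; exact hYle s
            _ ≤ _ := (add_sq_le_ennreal _ _).trans (le_of_eq (by ring))
      _ = 2 * (∫⁻ s in Ioi 0, ‖Y s - A (X s)‖ₑ ^ 2)
          + 2 * ‖A‖ₑ ^ 2 * ∫⁻ s in Ioi 0, ‖X s‖ₑ ^ 2 := by
          rw [lintegral_add_left (by fun_prop), lintegral_const_mul _ (by fun_prop),
            lintegral_const_mul _ (by fun_prop)]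
      _ < ⊤ := by
          have := hU2.ne
          have := hX2.ne
          finiteness
  have hXY2 : ∫⁻ s in Ioi 0, (‖X s‖ₑ + ‖Y s‖ₑ) ^ 2 < ⊤ := by
    calc ∫⁻ s in Ioi 0, (‖X s‖ₑ + ‖Y s‖ₑ) ^ 2
        ≤ ∫⁻ s in Ioi 0, (2 * ‖X s‖ₑ ^ 2 + 2 * ‖Y s‖ₑ ^ 2) := by
          refine lintegral_mono fun s => ?_
          exact (add_sq_le_ennreal _ _).trans (le_of_eq (by ring))
      _ = 2 * (∫⁻ s in Ioi 0, ‖X s‖ₑ ^ 2) + 2 * ∫⁻ s in Ioi 0, ‖Y s‖ₑ ^ 2 := by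
          rw [lintegral_add_left (by fun_prop), lintegral_const_mul _ (by fun_prop),
            lintegral_const_mul _ (by fun_prop)]
      _ < ⊤ := by
          have := hY2.ne
          have := hX2.ne
          finiteness
  have hroot : ∀ {a B : ℝ≥0∞}, a ^ 2 ≤ B → a ≤ B ^ (1 / 2 : ℝ) := by
    intro a B h
    have := ENNReal.rpow_le_rpow h (z := 1 / 2) (by norm_num)
    rw [← ENNReal.rpow_natCast, ← ENNReal.rpow_mul] at this
    norm_num at this
    simpa using this
  have hXb : ∀ s > 0, ‖X s‖ₑ ≤ (1 ^ 2 * ∫⁻ s in Ioi 0, (‖X s‖ₑ + ‖Y s‖ₑ) ^ 2) ^ (1 / 2 : ℝ) :=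
    fun s hs => hroot (sq_le_lintegral_of_window (f := fun s => ‖X s‖ₑ)
      (g := fun s => ‖X s‖ₑ + ‖Y s‖ₑ) (by fun_prop)
      (fun z hz => enorm_le_window hX hY hXd hz) hs)
  have hUb : ∀ s > 0, ‖Y s - A (X s)‖ₑ ≤ (K ^ 2 * ∫⁻ s in Ioi 0, ‖X s‖ₑ ^ 2) ^ (1 / 2 : ℝ) :=
    fun s hs => hroot (sq_le_lintegral_of_window (f := fun s => ‖Y s - A (X s)‖ₑ) hXm hU hs)
  set H1 := (1 ^ 2 * ∫⁻ s in Ioi 0, (‖X s‖ₑ + ‖Y s‖ₑ) ^ 2) ^ (1 / 2 : ℝ)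
  set H2 := (K ^ 2 * ∫⁻ s in Ioi 0, ‖X s‖ₑ ^ 2) ^ (1 / 2 : ℝ)
  have hH1 : H1 ≠ ⊤ := ENNReal.rpow_ne_top_of_nonneg (by norm_num)
    (ENNReal.mul_ne_top (by simp) hXY2.ne)
  have hH2 : H2 ≠ ⊤ := ENNReal.rpow_ne_top_of_nonneg (by norm_num)
    (ENNReal.mul_ne_top (ENNReal.pow_ne_top hKtop) hX2.ne)
  refine ⟨H1 + (H2 + ‖A‖ₑ * H1), by finiteness, fun s hs => ?_, hXY2⟩
  gcongr
  · exact hXb s hs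
  · refine (hYle s).trans ?_
    gcongr
    · exact hUb s hs
    · exact hXb s hs

end SecondOrder

/-! ## Symmetry of the coefficients -/

section Coefficients

lemma contDiff_dF {n d : ℕ} {f : Jet n d → ℝ} (hf : ContDiff ℝ ∞ f) (α : Fin n) (j : Fin d) :
    ContDiff ℝ ∞ (dF α j f) :=
  (hf.fderiv_right (m := ∞) (by simp)).clm_apply contDiff_const

lemma dF_comm {n d : ℕ} {f : Jet n d → ℝ} (hf : ContDiff ℝ ∞ f) (α β : Fin n) (j l : Fin d) :
    dF α j (dF β l f) = dF β l (dF α j f) := by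
  ext p
  have hd : DifferentiableAt ℝ (fderiv ℝ f) p :=
    (hf.fderiv_right (m := 1) (by norm_cast)).differentiable (by simp) p
  have hs : IsSymmSndFDerivAt ℝ f p :=
    hf.contDiffAt.isSymmSndFDerivAt (by simpa using ENat.LEInfty.out)
  have key : ∀ v w : Jet n d, fderiv ℝ (fun q => fderiv ℝ f q v) p w
      = fderiv ℝ (fderiv ℝ f) p w v := by
    intro v w
    rw [fderiv_clm_apply hd (differentiableAt_const v)]
    simp
  unfold dF
  rw [key, key]
  exact hs _ _

variable {n d : ℕ} {W : Jet n d → ℝ}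

lemma coefE_comm (hW : ContDiff ℝ ∞ W) (u₀ : Fin n → ℝ) (α β : Fin n) (j : Fin d) (γ : Fin n)
    (l : Fin d) : coefE W u₀ α β j γ l = coefE W u₀ α γ l β j := by
  unfold coefE
  rw [dF_comm hW]

lemma coefD_comm₁ (hW : ContDiff ℝ ∞ W) (u₀ : Fin n → ℝ) (α : Fin n) (j : Fin d) (β : Fin n)
    (l : Fin d) (γ : Fin n) (m : Fin d) :
    coefD W u₀ α j β l γ m = coefD W u₀ β l α j γ m := by
  unfold coefD
  rw [dF_comm (contDiff_dF hW γ m)]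

lemma coefD_comm₂ (hW : ContDiff ℝ ∞ W) (u₀ : Fin n → ℝ) (α : Fin n) (j : Fin d) (β : Fin n)
    (l : Fin d) (γ : Fin n) (m : Fin d) :
    coefD W u₀ α j β l γ m = coefD W u₀ α j γ m β l := by
  unfold coefD
  rw [dF_comm hW β γ]

end Coefficients

/-! ## Bounds for surface waves -/

section Wave

variable {n d : ℕ} {W : Jet n d → ℝ} {u₀ : Fin n → ℝ} {ν η : EuclideanSpace ℝ (Fin d)} {τ : ℝ}
  {V : ℝ → Fin n → ℂ}

/-- A function on the closed half-line, extended to the line by its value at `0`. -/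
def extend {E : Type*} (f : ℝ → E) (s : ℝ) : E := f (max s 0)

lemma extend_of_pos {E : Type*} (f : ℝ → E) {s : ℝ} (hs : 0 < s) : extend f s = f s := by
  rw [extend, max_eq_left hs.le]

lemma continuous_extend {E : Type*} [TopologicalSpace E] {f : ℝ → E}
    (hf : ContinuousOn f (Ici 0)) : Continuous (extend f) :=
  hf.comp_continuous (by fun_prop) fun s => le_max_right s 0

lemma hasDerivAt_extend {E : Type*} [NormedAddCommGroup E] [NormedSpace ℝ E] {f : ℝ → E}
    (hf : DifferentiableOn ℝ f (Ici 0)) {s : ℝ} (hs : 0 < s) :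
    HasDerivAt (extend f) (derivWithin f (Ici 0) s) s := by
  have h1 := (hf s hs.le).hasDerivWithinAt.hasDerivAt (Ici_mem_nhds hs)
  refine h1.congr_of_eventuallyEq ?_
  filter_upwards [Ioi_mem_nhds hs] with t ht
  exact extend_of_pos f ht

lemma hasDerivAt_of_pos {E : Type*} [NormedAddCommGroup E] [NormedSpace ℝ E] {f : ℝ → E}
    (hf : DifferentiableOn ℝ f (Ici 0)) {s : ℝ} (hs : 0 < s) :
    HasDerivAt f (derivWithin f (Ici 0) s) s :=
  (hf s hs.le).hasDerivWithinAt.hasDerivAt (Ici_mem_nhds hs)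

lemma IsSurfaceWave.contDiffOn_deriv (hV : IsSurfaceWave W u₀ ν η τ V) :
    ContDiffOn ℝ 1 (derivWithin V (Ici 0)) (Ici 0) :=
  hV.contDiffOn.derivWithin (uniqueDiffOn_Ici 0) (by norm_num)

lemma IsSurfaceWave.derivWithin_tangD (hV : IsSurfaceWave W u₀ ν η τ V) (l : Fin d) {z : ℝ}
    (hz : 0 < z) (β : Fin n) : derivWithin (tangD ν η l V) (Ici 0) z β =
      (ν l : ℂ) * derivWithin (derivWithin V (Ici 0)) (Ici 0) z β
        + Complex.I * (η l : ℂ) * derivWithin V (Ici 0) z β := by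
  have h1 := (hV.contDiffOn.differentiableOn (by norm_num) z hz.le).hasDerivWithinAt
  have h2 := (hV.contDiffOn_deriv.differentiableOn (by norm_num) z hz.le).hasDerivWithinAt
  have h3 : HasDerivWithinAt (tangD ν η l V) (fun β => (ν l : ℂ) *
      derivWithin (derivWithin V (Ici 0)) (Ici 0) z β
        + Complex.I * (η l : ℂ) * derivWithin V (Ici 0) z β) (Ici 0) z := by
    rw [hasDerivWithinAt_pi] at h1 h2 ⊢
    exact fun β => ((h2 β).const_mul _).add ((h1 β).const_mul _)
  rw [h3.derivWithin (uniqueDiffOn_Ici 0 z hz.le)]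

/-- The matrix `ν_j ν_ℓ c_{αjβℓ}`. -/
def normalMatrix (W : Jet n d → ℝ) (u₀ : Fin n → ℝ) (ν : EuclideanSpace ℝ (Fin d)) :
    Matrix (Fin n) (Fin n) ℝ :=
  fun α β => ∑ j, ∑ l, ν j * ν l * coefC W u₀ α j β l

/-- (H3) with `ξ = ν` makes the quadratic form of this matrix positive on nonzero real vectors,
which excludes a real kernel. -/
lemma normalMatrix_det_ne_zero (h3 : H3 W) (u₀ : Fin n → ℝ) (hν : ‖ν‖ = 1) :
    (normalMatrix W u₀ ν).det ≠ 0 := by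
  intro hdet
  obtain ⟨v, hv, hMv⟩ := Matrix.exists_mulVec_eq_zero_iff.mpr hdet
  have hν0 : (fun j => ν j) ≠ 0 := by
    intro h0
    have : ν = 0 := by
      ext j
      exact congrFun h0 j
    rw [this, norm_zero] at hν
    exact zero_ne_one hν
  have hpos := h3 u₀ v (fun j => ν j) hv hν0
  have hzero : ∑ α, v α * (normalMatrix W u₀ ν).mulVec v α = 0 := by simp [hMv]
  have e : ∑ α, ∑ j, ∑ β, ∑ l, v α * ν j * v β * ν l * dF α j (dF β l W) (u₀, 0)
      = ∑ α, v α * (normalMatrix W u₀ ν).mulVec v α := by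
    refine Finset.sum_congr rfl fun α _ => ?_
    rw [Finset.sum_comm, Matrix.mulVec, dotProduct, Finset.mul_sum]
    refine Finset.sum_congr rfl fun β _ => ?_
    rw [normalMatrix, Finset.sum_mul, Finset.mul_sum]
    refine Finset.sum_congr rfl fun j _ => ?_
    rw [Finset.sum_mul, Finset.mul_sum]
    refine Finset.sum_congr rfl fun l _ => ?_
    rw [coefC]
    ring
  rw [e, hzero] at hpos
  exact lt_irrefl _ hpos

/-- The interior equation solved for the second derivative. -/
lemma IsSurfaceWave.exists_second_order (h3 : H3 W) (hν : ‖ν‖ = 1)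
    (hV : IsSurfaceWave W u₀ ν η τ V) : ∃ A B : (Fin n → ℂ) →L[ℝ] (Fin n → ℂ), ∀ z > 0,
      derivWithin (derivWithin V (Ici 0)) (Ici 0) z = A (derivWithin V (Ici 0) z) + B (V z) := by
  set M : Matrix (Fin n) (Fin n) ℂ := (normalMatrix W u₀ ν).map Complex.ofRealHom with hM
  have hdet : IsUnit M.det := by
    rw [hM, ← RingHom.mapMatrix_apply, ← RingHom.map_det]
    simpa using normalMatrix_det_ne_zero h3 u₀ hν
  -- Expanding `(ν_j ∂_z + i η_j)(ν_ℓ ∂_z + i η_ℓ)`, the interior equation becomes `M V'' = A₀ V' +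
  -- (B₀ - τ²) V`.
  set A₀ : Matrix (Fin n) (Fin n) ℂ := fun α β =>
    -∑ j, ∑ l, Complex.I * ((ν j : ℂ) * η l + η j * ν l) * coefC W u₀ α j β l with hA₀
  set B₀ : Matrix (Fin n) (Fin n) ℂ := fun α β =>
    ∑ j, ∑ l, (η j : ℂ) * η l * coefC W u₀ α j β l with hB₀
  refine ⟨(LinearMap.toContinuousLinearMap (Matrix.mulVecLin (M⁻¹ * A₀))).restrictScalars ℝ,
    (LinearMap.toContinuousLinearMap
      (Matrix.mulVecLin (M⁻¹ * (B₀ - Matrix.diagonal fun _ => (τ : ℂ) ^ 2)))).restrictScalars ℝ,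
    fun z hz => ?_⟩
  set V₂ := derivWithin (derivWithin V (Ici 0)) (Ici 0) z with hV₂
  set V₁ := derivWithin V (Ici 0) z with hV₁
  have key : M.mulVec V₂ = A₀.mulVec V₁
      + (B₀ - Matrix.diagonal fun _ => (τ : ℂ) ^ 2).mulVec (V z) := by
    ext α
    have h := hV.interior z hz α
    have e : ∑ j, ∑ β, ∑ l, (coefC W u₀ α j β l : ℂ) * tangD ν η j (tangD ν η l V) z β
        = M.mulVec V₂ α - A₀.mulVec V₁ α - B₀.mulVec (V z) α := by
      rw [Finset.sum_comm]
      simp only [Matrix.mulVec, dotProduct]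
      rw [← Finset.sum_sub_distrib, ← Finset.sum_sub_distrib]
      refine Finset.sum_congr rfl fun β _ => ?_
      simp only [hM, hA₀, hB₀, Matrix.map_apply, normalMatrix, map_sum, neg_mul, Finset.sum_mul,
        sub_neg_eq_add]
      rw [← Finset.sum_add_distrib, ← Finset.sum_sub_distrib]
      refine Finset.sum_congr rfl fun j _ => ?_
      rw [← Finset.sum_add_distrib, ← Finset.sum_sub_distrib]
      refine Finset.sum_congr rfl fun l _ => ?_
      rw [tangD, hV.derivWithin_tangD l hz β, tangD, ← hV₁, ← hV₂]
      simp only [map_mul, Complex.ofRealHom_eq_coe]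
      linear_combination ((coefC W u₀ α j β l : ℂ) * η j * η l * V z β) * Complex.I_sq
    rw [e] at h
    simp only [Matrix.sub_mulVec, Pi.add_apply, Pi.sub_apply, Matrix.mulVec_diagonal]
    linear_combination -h
  have h1 : V₂ = (M⁻¹ * M).mulVec V₂ := by rw [Matrix.nonsing_inv_mul _ hdet, Matrix.one_mulVec]
  rw [h1, ← Matrix.mulVec_mulVec, key, Matrix.mulVec_add, Matrix.mulVec_mulVec,
    Matrix.mulVec_mulVec]
  rfl

/-- The size of a profile and of its derivative. -/
def profileSize (V : ℝ → Fin n → ℂ) (s : ℝ) : ℝ≥0∞ :=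
  ‖extend V s‖ₑ + ‖extend (derivWithin V (Ici 0)) s‖ₑ

lemma IsSurfaceWave.continuous_extend (hV : IsSurfaceWave W u₀ ν η τ V) :
    Continuous (extend V) :=
  SurfaceWave.continuous_extend hV.contDiffOn.continuousOn

lemma IsSurfaceWave.continuous_extend_deriv (hV : IsSurfaceWave W u₀ ν η τ V) :
    Continuous (extend (derivWithin V (Ici 0))) :=
  SurfaceWave.continuous_extend hV.contDiffOn_deriv.continuousOn

lemma IsSurfaceWave.measurable_profileSize (hV : IsSurfaceWave W u₀ ν η τ V) :
    Measurable (profileSize V) :=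
  (hV.continuous_extend.enorm.measurable).add hV.continuous_extend_deriv.enorm.measurable

lemma IsSurfaceWave.exists_bound (h3 : H3 W) (hν : ‖ν‖ = 1) (hV : IsSurfaceWave W u₀ ν η τ V) :
    ∃ H : ℝ≥0∞, H ≠ ⊤ ∧ (∀ s > 0, profileSize V s ≤ H) ∧
      ∫⁻ s in Ioi 0, profileSize V s ^ 2 < ⊤ := by
  obtain ⟨A, B, hAB⟩ := hV.exists_second_order h3 hν
  refine exists_bound_of_second_order (A := A) (B := B) hV.continuous_extend
    hV.continuous_extend_deriv (fun s hs => ?_) (fun s hs => ?_) ?_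
  · rw [extend_of_pos _ hs]
    exact hasDerivAt_extend (hV.contDiffOn.differentiableOn (by norm_num)) hs
  · rw [extend_of_pos _ hs, extend_of_pos _ hs, ← hAB s hs]
    exact hasDerivAt_extend (hV.contDiffOn_deriv.differentiableOn (by norm_num)) hs
  · have h := hV.memLp.eLpNorm_lt_top
    rw [eLpNorm_lt_top_iff_lintegral_rpow_enorm_lt_top (by norm_num) (by norm_num)] at h
    calc ∫⁻ s in Ioi 0, ‖extend V s‖ₑ ^ 2 = ∫⁻ s in Ioi 0, ‖V s‖ₑ ^ (2 : ℝ≥0∞).toReal := by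
          refine setLIntegral_congr_fun measurableSet_Ioi fun s hs => ?_
          simp only [extend_of_pos V hs, ENNReal.toReal_ofNat]
          exact (ENNReal.rpow_two _).symm
      _ < ⊤ := h

end Wave

/-! ## The kernel of the amplitude equation -/

section Forms

variable {n d : ℕ}

/-- The trilinear form with coefficients `e_{αβjγℓ}`. -/
def formE (W : Jet n d → ℝ) (u₀ : Fin n → ℝ) (r : Fin n → ℂ) (g g' : Fin d → Fin n → ℂ) : ℂ :=
  ∑ α, ∑ β, ∑ j, ∑ γ, ∑ l, (coefE W u₀ α β j γ l : ℂ) * (r α * g j β * g' l γ)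

/-- The trilinear form with coefficients `d_{αjβℓγm}`. -/
def formD (W : Jet n d → ℝ) (u₀ : Fin n → ℝ) (g g' g'' : Fin d → Fin n → ℂ) : ℂ :=
  ∑ α, ∑ j, ∑ β, ∑ l, ∑ γ, ∑ m, (coefD W u₀ α j β l γ m : ℂ) * (g j α * g' l β * g'' m γ)

lemma sum_pair_comm {ι κ : Type*} [Fintype ι] [Fintype κ] (F : ι → κ → ι → κ → ℂ) :
    ∑ a, ∑ i, ∑ c, ∑ k, F a i c k = ∑ a, ∑ i, ∑ c, ∑ k, F c k a i := by
  have := Finset.sum_comm (s := (Finset.univ : Finset (ι × κ)))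
    (t := (Finset.univ : Finset (ι × κ))) (f := fun p q => F p.1 p.2 q.1 q.2)
  simpa [Fintype.sum_prod_type] using this

variable {W : Jet n d → ℝ}

lemma formE_comm (hW : ContDiff ℝ ∞ W) (u₀ : Fin n → ℝ) (r : Fin n → ℂ)
    (g g' : Fin d → Fin n → ℂ) : formE W u₀ r g g' = formE W u₀ r g' g := by
  unfold formE
  refine Finset.sum_congr rfl fun α _ => ?_
  rw [sum_pair_comm]
  refine Finset.sum_congr rfl fun β _ => Finset.sum_congr rfl fun j _ =>
    Finset.sum_congr rfl fun γ _ => Finset.sum_congr rfl fun l _ => ?_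
  rw [coefE_comm hW]
  ring

lemma formD_comm₁ (hW : ContDiff ℝ ∞ W) (u₀ : Fin n → ℝ) (g g' g'' : Fin d → Fin n → ℂ) :
    formD W u₀ g g' g'' = formD W u₀ g' g g'' := by
  unfold formD
  rw [sum_pair_comm]
  refine Finset.sum_congr rfl fun α _ => Finset.sum_congr rfl fun j _ =>
    Finset.sum_congr rfl fun β _ => Finset.sum_congr rfl fun l _ =>
    Finset.sum_congr rfl fun γ _ => Finset.sum_congr rfl fun m _ => ?_
  rw [coefD_comm₁ hW]
  ring

lemma formD_comm₂ (hW : ContDiff ℝ ∞ W) (u₀ : Fin n → ℝ) (g g' g'' : Fin d → Fin n → ℂ) :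
    formD W u₀ g g' g'' = formD W u₀ g g'' g' := by
  unfold formD
  refine Finset.sum_congr rfl fun α _ => Finset.sum_congr rfl fun j _ => ?_
  rw [sum_pair_comm]
  refine Finset.sum_congr rfl fun β _ => Finset.sum_congr rfl fun l _ =>
    Finset.sum_congr rfl fun γ _ => Finset.sum_congr rfl fun m _ => ?_
  rw [coefD_comm₂ hW]
  ring

lemma conj_formE (u₀ : Fin n → ℝ) (r : Fin n → ℂ) (g g' : Fin d → Fin n → ℂ) :
    conj (formE W u₀ r g g') = formE W u₀ (fun α => conj (r α)) (fun j α => conj (g j α))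
      (fun j α => conj (g' j α)) := by
  simp only [formE, map_sum, map_mul, Complex.conj_ofReal]

lemma conj_formD (u₀ : Fin n → ℝ) (g g' g'' : Fin d → Fin n → ℂ) :
    conj (formD W u₀ g g' g'') = formD W u₀ (fun j α => conj (g j α))
      (fun j α => conj (g' j α)) (fun j α => conj (g'' j α)) := by
  simp only [formD, map_sum, map_mul, Complex.conj_ofReal]

lemma formE_eq₂ (u₀ : Fin n → ℝ) (r : Fin n → ℂ) (g g' : Fin d → Fin n → ℂ) :
    ∑ α, ∑ β, ∑ j, ∑ γ, ∑ l, (coefE W u₀ β α j γ l : ℂ) * (g j α * r β * g' l γ)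
      = formE W u₀ r g g' := by
  unfold formE
  rw [Finset.sum_comm]
  refine Finset.sum_congr rfl fun α _ => Finset.sum_congr rfl fun β _ =>
    Finset.sum_congr rfl fun j _ => Finset.sum_congr rfl fun γ _ =>
    Finset.sum_congr rfl fun l _ => ?_
  ring

lemma formE_eq₃ (u₀ : Fin n → ℝ) (r : Fin n → ℂ) (g g' : Fin d → Fin n → ℂ) :
    ∑ α, ∑ β, ∑ j, ∑ γ, ∑ l, (coefE W u₀ γ α j β l : ℂ) * (g j α * g' l β * r γ)
      = formE W u₀ r g g' := by
  unfold formE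
  rw [Finset.sum_comm (f := fun α β => ∑ j, ∑ γ, ∑ l, (coefE W u₀ α β j γ l : ℂ) *
    (r α * g j β * g' l γ))]
  refine Finset.sum_congr rfl fun α _ => ?_
  have e : ∀ F : Fin n → Fin d → Fin n → ℂ, ∑ β, ∑ j, ∑ γ, F β j γ = ∑ γ, ∑ j, ∑ β, F β j γ := by
    intro F
    rw [Finset.sum_comm (t := Finset.univ (α := Fin d))]
    conv_rhs => rw [Finset.sum_comm]
    exact Finset.sum_congr rfl fun j _ => Finset.sum_comm
  rw [e]
  refine Finset.sum_congr rfl fun γ _ => Finset.sum_congr rfl fun j _ =>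
    Finset.sum_congr rfl fun β _ => Finset.sum_congr rfl fun l _ => ?_
  ring

lemma enorm_formE_le (W : Jet n d → ℝ) (u₀ : Fin n → ℝ) {r : Fin n → ℂ}
    {g g' : Fin d → Fin n → ℂ} {a a' a'' : ℝ≥0∞} (hr : ∀ α, ‖r α‖ₑ ≤ a)
    (hg : ∀ j α, ‖g j α‖ₑ ≤ a') (hg' : ∀ j α, ‖g' j α‖ₑ ≤ a'') :
    ‖formE W u₀ r g g'‖ₑ ≤
      (∑ α, ∑ β, ∑ j, ∑ γ, ∑ l, ‖(coefE W u₀ α β j γ l : ℂ)‖ₑ) * (a * a' * a'') := by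
  unfold formE
  simp only [Finset.sum_mul]
  refine (enorm_sum_le _ _).trans (Finset.sum_le_sum fun α _ => ?_)
  refine (enorm_sum_le _ _).trans (Finset.sum_le_sum fun β _ => ?_)
  refine (enorm_sum_le _ _).trans (Finset.sum_le_sum fun j _ => ?_)
  refine (enorm_sum_le _ _).trans (Finset.sum_le_sum fun γ _ => ?_)
  refine (enorm_sum_le _ _).trans (Finset.sum_le_sum fun l _ => ?_)
  rw [enorm_mul, enorm_mul, enorm_mul]
  gcongr
  · exact hr α
  · exact hg j β
  · exact hg' l γ

lemma enorm_formD_le (W : Jet n d → ℝ) (u₀ : Fin n → ℝ) {g g' g'' : Fin d → Fin n → ℂ}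
    {a a' a'' : ℝ≥0∞} (hg : ∀ j α, ‖g j α‖ₑ ≤ a)
    (hg' : ∀ j α, ‖g' j α‖ₑ ≤ a') (hg'' : ∀ j α, ‖g'' j α‖ₑ ≤ a'') :
    ‖formD W u₀ g g' g''‖ₑ ≤
      (∑ α, ∑ j, ∑ β, ∑ l, ∑ γ, ∑ m, ‖(coefD W u₀ α j β l γ m : ℂ)‖ₑ) * (a * a' * a'') := by
  unfold formD
  simp only [Finset.sum_mul]
  refine (enorm_sum_le _ _).trans (Finset.sum_le_sum fun α _ => ?_)
  refine (enorm_sum_le _ _).trans (Finset.sum_le_sum fun j _ => ?_)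
  refine (enorm_sum_le _ _).trans (Finset.sum_le_sum fun β _ => ?_)
  refine (enorm_sum_le _ _).trans (Finset.sum_le_sum fun l _ => ?_)
  refine (enorm_sum_le _ _).trans (Finset.sum_le_sum fun γ _ => ?_)
  refine (enorm_sum_le _ _).trans (Finset.sum_le_sum fun m _ => ?_)
  rw [enorm_mul, enorm_mul, enorm_mul]
  gcongr
  · exact hg j α
  · exact hg' l β
  · exact hg'' m γ

lemma measurable_formE {α' : Type*} [MeasurableSpace α'] (W : Jet n d → ℝ) (u₀ : Fin n → ℝ)
    {r : α' → Fin n → ℂ} {g g' : α' → Fin d → Fin n → ℂ} (hr : ∀ α, Measurable fun p => r p α)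
    (hg : ∀ j α, Measurable fun p => g p j α) (hg' : ∀ j α, Measurable fun p => g' p j α) :
    Measurable fun p => formE W u₀ (r p) (g p) (g' p) := by
  unfold formE
  exact Finset.measurable_fun_sum _ fun α _ => Finset.measurable_fun_sum _ fun β _ =>
    Finset.measurable_fun_sum _ fun j _ => Finset.measurable_fun_sum _ fun γ _ =>
    Finset.measurable_fun_sum _ fun l _ =>
    (((hr α).mul (hg j β)).mul (hg' l γ)).const_mul _

lemma measurable_formD {α' : Type*} [MeasurableSpace α'] (W : Jet n d → ℝ) (u₀ : Fin n → ℝ)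
    {g g' g'' : α' → Fin d → Fin n → ℂ} (hg : ∀ j α, Measurable fun p => g p j α)
    (hg' : ∀ j α, Measurable fun p => g' p j α) (hg'' : ∀ j α, Measurable fun p => g'' p j α) :
    Measurable fun p => formD W u₀ (g p) (g' p) (g'' p) := by
  unfold formD
  exact Finset.measurable_fun_sum _ fun α _ => Finset.measurable_fun_sum _ fun j _ =>
    Finset.measurable_fun_sum _ fun β _ => Finset.measurable_fun_sum _ fun l _ =>
    Finset.measurable_fun_sum _ fun γ _ => Finset.measurable_fun_sum _ fun m _ =>
    (((hg j α).mul (hg' l β)).mul (hg'' m γ)).const_mul _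

end Forms

/-! ### Profiles of frequency `ξ` as rescaled copies of `V` -/

section Profiles

variable {n d : ℕ} {W : Jet n d → ℝ} {u₀ : Fin n → ℝ} {ν η : EuclideanSpace ℝ (Fin d)} {τ : ℝ}
  {V : ℝ → Fin n → ℂ}

/-- The identity for positive frequencies, the complex conjugation otherwise. -/
def conjSign (ξ : ℝ) (w : ℂ) : ℂ := if 0 < ξ then w else conj w

lemma enorm_conjSign (ξ : ℝ) (w : ℂ) : ‖conjSign ξ w‖ₑ = ‖w‖ₑ := by
  unfold conjSign
  split_ifs
  · rfl
  · rw [← ofReal_norm, RCLike.norm_conj, ofReal_norm]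

lemma conjSign_neg {ξ : ℝ} (hξ : ξ ≠ 0) (w : ℂ) : conjSign (-ξ) w = conj (conjSign ξ w) := by
  unfold conjSign
  rcases lt_or_gt_of_ne hξ with h | h
  · rw [if_pos (by linarith), if_neg (by linarith), Complex.conj_conj]
  · rw [if_neg (by linarith), if_pos h]

lemma measurable_conjSign {α : Type*} [MeasurableSpace α] {ξ : α → ℝ} {w : α → ℂ}
    (hξ : Measurable ξ) (hw : Measurable w) : Measurable fun a => conjSign (ξ a) (w a) :=
  Measurable.ite (measurableSet_lt measurable_const hξ) hw
    (Complex.continuous_conj.measurable.comp hw)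

/-- The profile `r̂` in terms of the continuous extension of `V`. -/
def profR (V : ℝ → Fin n → ℂ) (ξ s : ℝ) (α : Fin n) : ℂ := conjSign ξ (extend V (|ξ| * s) α)

/-- The gradient of the profile in terms of the continuous extensions of `V` and `V'`. -/
def profG (ν η : EuclideanSpace ℝ (Fin d)) (V : ℝ → Fin n → ℂ) (ξ s : ℝ) (j : Fin d)
    (α : Fin n) : ℂ := |ξ| * conjSign ξ ((ν j : ℂ) * extend (derivWithin V (Ici 0)) (|ξ| * s) α
      + Complex.I * (η j : ℂ) * extend V (|ξ| * s) α)

lemma rHat_eq {ξ s : ℝ} (hξ : ξ ≠ 0) (hs : 0 < s) (α : Fin n) : rHat V ξ s α = profR V ξ s α := by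
  have hpos : 0 < |ξ| * s := mul_pos (abs_pos.mpr hξ) hs
  rw [profR, extend_of_pos _ hpos, rHat, conjSign]
  split_ifs with h
  · rw [abs_of_pos h]
  · rw [abs_of_nonpos (not_lt.mp h)]

lemma IsSurfaceWave.deriv_rHat (hV : IsSurfaceWave W u₀ ν η τ V) {ξ s : ℝ} (hξ : ξ ≠ 0)
    (hs : 0 < s) (α : Fin n) : deriv (fun s => rHat V ξ s α) s
      = |ξ| * conjSign ξ (extend (derivWithin V (Ici 0)) (|ξ| * s) α) := by
  have hpos : 0 < |ξ| * s := mul_pos (abs_pos.mpr hξ) hs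
  have h1 := hasDerivAt_of_pos (hV.contDiffOn.differentiableOn (by norm_num)) hpos
  have h2 : HasDerivAt (fun t : ℝ => |ξ| * t) |ξ| s := by
    simpa using (hasDerivAt_id s).const_mul |ξ|
  have h3 := hasDerivAt_pi.mp (h1.scomp s h2) α
  rw [extend_of_pos _ hpos]
  refine HasDerivAt.deriv ?_
  rcases lt_or_gt_of_ne hξ with h | h
  · have h4 := h3.star
    simp only [rHat, conjSign, if_neg h.le.not_gt]
    rw [abs_of_neg h] at h4 ⊢
    refine h4.congr_deriv ?_
    simp [Complex.real_smul]
  · simp only [rHat, conjSign, if_pos h]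
    rw [abs_of_pos h] at h3 ⊢
    refine h3.congr_deriv ?_
    simp [Complex.real_smul]

/-- Conjugation turns `i |ξ|` into `i ξ` when `ξ < 0`, so the gradient is `|ξ|` times one fixed
profile, rescaled and possibly conjugated. -/
lemma IsSurfaceWave.gradR_eq (hV : IsSurfaceWave W u₀ ν η τ V) {ξ s : ℝ} (hξ : ξ ≠ 0)
    (hs : 0 < s) (j : Fin d) (α : Fin n) : gradR ν η V ξ j s α = profG ν η V ξ s j α := by
  rw [gradR, hV.deriv_rHat hξ hs, rHat_eq hξ hs, profG, profR]
  unfold conjSign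
  rcases lt_or_gt_of_ne hξ with h | h
  · simp only [if_neg h.le.not_gt, abs_of_neg h, map_add, map_mul, Complex.conj_ofReal,
      Complex.conj_I]
    push_cast
    ring
  · simp only [if_pos h, abs_of_pos h]
    ring

lemma profR_neg {ξ : ℝ} (hξ : ξ ≠ 0) (s : ℝ) (α : Fin n) :
    profR V (-ξ) s α = conj (profR V ξ s α) := by
  rw [profR, conjSign_neg hξ, abs_neg, profR]

lemma profG_neg {ξ : ℝ} (hξ : ξ ≠ 0) (s : ℝ) (j : Fin d) (α : Fin n) :
    profG ν η V (-ξ) s j α = conj (profG ν η V ξ s j α) := by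
  rw [profG, conjSign_neg hξ, abs_neg, profG, map_mul, Complex.conj_ofReal]

lemma enorm_apply_le (f : Fin n → ℂ) (α : Fin n) : ‖f α‖ₑ ≤ ‖f‖ₑ := by
  rw [← ofReal_norm, ← ofReal_norm]
  exact ENNReal.ofReal_le_ofReal (norm_le_pi_norm f α)

lemma enorm_ofReal_apply_le (v : EuclideanSpace ℝ (Fin d)) (j : Fin d) :
    ‖((v j : ℝ) : ℂ)‖ₑ ≤ ‖v‖ₑ := by
  rw [← ofReal_norm, ← ofReal_norm, Complex.norm_real]
  exact ENNReal.ofReal_le_ofReal (PiLp.norm_apply_le v j)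

lemma enorm_profR_le (ξ s : ℝ) (α : Fin n) : ‖profR V ξ s α‖ₑ ≤ profileSize V (|ξ| * s) := by
  rw [profR, enorm_conjSign]
  exact (enorm_apply_le _ α).trans le_self_add

lemma enorm_profG_le (ξ s : ℝ) (j : Fin d) (α : Fin n) : ‖profG ν η V ξ s j α‖ₑ ≤
    ENNReal.ofReal |ξ| * ((‖ν‖ₑ + ‖η‖ₑ) * profileSize V (|ξ| * s)) := by
  rw [profG, enorm_mul, enorm_conjSign]
  gcongr
  · rw [← ofReal_norm, Complex.norm_real, Real.norm_eq_abs, abs_abs]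
  · refine (enorm_add_le _ _).trans ?_
    rw [enorm_mul, enorm_mul, enorm_mul, add_mul, profileSize]
    have hI : ‖Complex.I‖ₑ = 1 := by rw [← ofReal_norm, Complex.norm_I, ENNReal.ofReal_one]
    rw [hI, one_mul]
    gcongr
    · exact enorm_ofReal_apply_le ν j
    · exact (enorm_apply_le _ α).trans le_add_self
    · exact enorm_ofReal_apply_le η j
    · exact (enorm_apply_le _ α).trans le_self_add

lemma IsSurfaceWave.measurable_profR (hV : IsSurfaceWave W u₀ ν η τ V) {α' : Type*}
    [MeasurableSpace α'] {ξ s : α' → ℝ} (hξ : Measurable ξ) (hs : Measurable s) (α : Fin n) :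
    Measurable fun p => profR V (ξ p) (s p) α := by
  have h1 := (continuous_apply α).measurable.comp hV.continuous_extend.measurable
  exact measurable_conjSign hξ (h1.comp (hξ.abs.mul hs))

lemma IsSurfaceWave.measurable_profG (hV : IsSurfaceWave W u₀ ν η τ V) {α' : Type*}
    [MeasurableSpace α'] {ξ s : α' → ℝ} (hξ : Measurable ξ) (hs : Measurable s) (j : Fin d)
    (α : Fin n) : Measurable fun p => profG ν η V (ξ p) (s p) j α := by
  have h1 := (continuous_apply α).measurable.comp hV.continuous_extend.measurable
  have h2 := (continuous_apply α).measurable.comp hV.continuous_extend_deriv.measurable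
  have h3 := hξ.abs.mul hs
  exact (Complex.continuous_ofReal.measurable.comp hξ.abs).mul (measurable_conjSign hξ
    (((h2.comp h3).const_mul _).add ((h1.comp h3).const_mul _)))

end Profiles

/-! ### Symmetry and growth of the kernel -/

section Kernel

variable {n d : ℕ} {W : Jet n d → ℝ} {u₀ : Fin n → ℝ} {ν η : EuclideanSpace ℝ (Fin d)} {τ : ℝ}
  {V : ℝ → Fin n → ℂ}

/-- The integral of `formE` along profiles of frequencies `x`, `y`, `z`. -/
def integralE (W : Jet n d → ℝ) (u₀ : Fin n → ℝ) (ν η : EuclideanSpace ℝ (Fin d))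
    (V : ℝ → Fin n → ℂ) (x y z : ℝ) : ℂ :=
  ∫ s in Ioi (0 : ℝ), formE W u₀ (profR V x s) (profG ν η V y s) (profG ν η V z s)

/-- The integral of `formD` along profiles of frequencies `x`, `y`, `z`. -/
def integralD (W : Jet n d → ℝ) (u₀ : Fin n → ℝ) (ν η : EuclideanSpace ℝ (Fin d))
    (V : ℝ → Fin n → ℂ) (x y z : ℝ) : ℂ :=
  ∫ s in Ioi (0 : ℝ), formD W u₀ (profG ν η V x s) (profG ν η V y s) (profG ν η V z s)

/-- The kernel `b`, set to zero where one of the frequencies vanishes. -/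
def kernelZ (W : Jet n d → ℝ) (u₀ : Fin n → ℝ) (ν η : EuclideanSpace ℝ (Fin d))
    (V : ℝ → Fin n → ℂ) (x y z : ℝ) : ℂ :=
  if x ≠ 0 ∧ y ≠ 0 ∧ z ≠ 0 then (4 * Real.pi : ℂ)⁻¹ *
    (integralE W u₀ ν η V x y z + integralE W u₀ ν η V y x z + integralE W u₀ ν η V z x y
      + integralD W u₀ ν η V x y z) else 0

/-- At frequency `0` the conventional value of `rHat` is a conjugate, so the Hermitian symmetry of
`kernelB` may fail there. `kernelZ` restores it by changing values on a negligible set only. -/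
lemma IsSurfaceWave.kernelB_eq (hV : IsSurfaceWave W u₀ ν η τ V) {x y z : ℝ} (hx : x ≠ 0)
    (hy : y ≠ 0) (hz : z ≠ 0) : kernelB W u₀ ν η V x y z = kernelZ W u₀ ν η V x y z := by
  have e1 : (∫ s in Ioi (0 : ℝ), ∑ α, ∑ β, ∑ j, ∑ γ, ∑ l, (coefE W u₀ α β j γ l : ℂ) *
      (rHat V x s α * gradR ν η V y j s β * gradR ν η V z l s γ))
      = integralE W u₀ ν η V x y z := by
    refine setIntegral_congr_fun measurableSet_Ioi fun s hs => ?_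
    simp only [rHat_eq hx hs, hV.gradR_eq hy hs, hV.gradR_eq hz hs, formE]
  have e2 : (∫ s in Ioi (0 : ℝ), ∑ α, ∑ β, ∑ j, ∑ γ, ∑ l, (coefE W u₀ β α j γ l : ℂ) *
      (gradR ν η V x j s α * rHat V y s β * gradR ν η V z l s γ))
      = integralE W u₀ ν η V y x z := by
    refine setIntegral_congr_fun measurableSet_Ioi fun s hs => ?_
    simp only [rHat_eq hy hs, hV.gradR_eq hx hs, hV.gradR_eq hz hs, formE_eq₂]
  have e3 : (∫ s in Ioi (0 : ℝ), ∑ α, ∑ β, ∑ j, ∑ γ, ∑ l, (coefE W u₀ γ α j β l : ℂ) *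
      (gradR ν η V x j s α * gradR ν η V y l s β * rHat V z s γ))
      = integralE W u₀ ν η V z x y := by
    refine setIntegral_congr_fun measurableSet_Ioi fun s hs => ?_
    simp only [rHat_eq hz hs, hV.gradR_eq hx hs, hV.gradR_eq hy hs, formE_eq₃]
  have e4 : (∫ s in Ioi (0 : ℝ), ∑ α, ∑ j, ∑ β, ∑ l, ∑ γ, ∑ m, (coefD W u₀ α j β l γ m : ℂ) *
      (gradR ν η V x j s α * gradR ν η V y l s β * gradR ν η V z m s γ))
      = integralD W u₀ ν η V x y z := by
    refine setIntegral_congr_fun measurableSet_Ioi fun s hs => ?_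
    simp only [hV.gradR_eq hx hs, hV.gradR_eq hy hs, hV.gradR_eq hz hs, formD]
  rw [kernelZ, if_pos ⟨hx, hy, hz⟩, kernelB, kernelB1, kernelB2, e1, e2, e3, e4]
  ring

lemma integralE_comm (hW : ContDiff ℝ ∞ W) (x y z : ℝ) :
    integralE W u₀ ν η V x y z = integralE W u₀ ν η V x z y := by
  unfold integralE
  simp_rw [formE_comm hW u₀ _ (profG ν η V y _)]

lemma integralD_comm₁ (hW : ContDiff ℝ ∞ W) (x y z : ℝ) :
    integralD W u₀ ν η V x y z = integralD W u₀ ν η V y x z := by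
  unfold integralD
  simp_rw [formD_comm₁ hW u₀ (profG ν η V x _)]

lemma integralD_comm₂ (hW : ContDiff ℝ ∞ W) (x y z : ℝ) :
    integralD W u₀ ν η V x y z = integralD W u₀ ν η V x z y := by
  unfold integralD
  simp_rw [formD_comm₂ hW u₀ _ (profG ν η V y _)]

lemma integralE_neg {x y z : ℝ} (hx : x ≠ 0) (hy : y ≠ 0) (hz : z ≠ 0) :
    integralE W u₀ ν η V (-x) (-y) (-z) = conj (integralE W u₀ ν η V x y z) := by
  unfold integralE
  rw [← integral_conj]
  refine integral_congr_ae (Eventually.of_forall fun s => ?_)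
  simp only [conj_formE, ← profR_neg hx, ← profG_neg hy, ← profG_neg hz]

lemma integralD_neg {x y z : ℝ} (hx : x ≠ 0) (hy : y ≠ 0) (hz : z ≠ 0) :
    integralD W u₀ ν η V (-x) (-y) (-z) = conj (integralD W u₀ ν η V x y z) := by
  unfold integralD
  rw [← integral_conj]
  refine integral_congr_ae (Eventually.of_forall fun s => ?_)
  simp only [conj_formD, ← profG_neg hx, ← profG_neg hy, ← profG_neg hz]

lemma kernelZ_swap12 (hW : ContDiff ℝ ∞ W) (x y z : ℝ) :
    kernelZ W u₀ ν η V x y z = kernelZ W u₀ ν η V y x z := by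
  unfold kernelZ
  rw [integralE_comm hW z x y, integralD_comm₁ hW x y z]
  congr 1
  · simp only [eq_iff_iff]; tauto
  · ring

lemma kernelZ_swap23 (hW : ContDiff ℝ ∞ W) (x y z : ℝ) :
    kernelZ W u₀ ν η V x y z = kernelZ W u₀ ν η V x z y := by
  unfold kernelZ
  rw [integralE_comm hW x y z, integralD_comm₂ hW x y z]
  congr 1
  · simp only [eq_iff_iff]; tauto
  · ring

lemma kernelZ_neg (x y z : ℝ) :
    kernelZ W u₀ ν η V (-x) (-y) (-z) = conj (kernelZ W u₀ ν η V x y z) := by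
  unfold kernelZ
  by_cases h : x ≠ 0 ∧ y ≠ 0 ∧ z ≠ 0
  · obtain ⟨hx, hy, hz⟩ := h
    rw [if_pos ⟨neg_ne_zero.mpr hx, neg_ne_zero.mpr hy, neg_ne_zero.mpr hz⟩, if_pos ⟨hx, hy, hz⟩,
      integralE_neg hx hy hz, integralE_neg hy hx hz, integralE_neg hz hx hy,
      integralD_neg hx hy hz]
    simp only [map_mul, map_add, map_inv₀, Complex.conj_ofReal, Complex.conj_ofNat]
  · rw [if_neg (by simpa only [neg_ne_zero] using h), if_neg h, map_zero]

lemma IsSurfaceWave.measurable_integralE (hV : IsSurfaceWave W u₀ ν η τ V)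
    {x y z : ℝ × ℝ × ℝ → ℝ} (hx : Measurable x) (hy : Measurable y) (hz : Measurable z) :
    Measurable fun p => integralE W u₀ ν η V (x p) (y p) (z p) := by
  have h : Measurable fun q : (ℝ × ℝ × ℝ) × ℝ => formE W u₀ (profR V (x q.1) q.2)
      (profG ν η V (y q.1) q.2) (profG ν η V (z q.1) q.2) :=
    measurable_formE W u₀
      (fun α => hV.measurable_profR (hx.comp measurable_fst) measurable_snd α)
      (fun j α => hV.measurable_profG (hy.comp measurable_fst) measurable_snd j α)
      (fun j α => hV.measurable_profG (hz.comp measurable_fst) measurable_snd j α)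
  exact (h.stronglyMeasurable.integral_prod_right' (ν := volume.restrict (Ioi 0))).measurable

lemma IsSurfaceWave.measurable_integralD (hV : IsSurfaceWave W u₀ ν η τ V)
    {x y z : ℝ × ℝ × ℝ → ℝ} (hx : Measurable x) (hy : Measurable y) (hz : Measurable z) :
    Measurable fun p => integralD W u₀ ν η V (x p) (y p) (z p) := by
  have h : Measurable fun q : (ℝ × ℝ × ℝ) × ℝ => formD W u₀ (profG ν η V (x q.1) q.2)
      (profG ν η V (y q.1) q.2) (profG ν η V (z q.1) q.2) :=
    measurable_formD W u₀
      (fun j α => hV.measurable_profG (hx.comp measurable_fst) measurable_snd j α)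
      (fun j α => hV.measurable_profG (hy.comp measurable_fst) measurable_snd j α)
      (fun j α => hV.measurable_profG (hz.comp measurable_fst) measurable_snd j α)
  exact (h.stronglyMeasurable.integral_prod_right' (ν := volume.restrict (Ioi 0))).measurable

lemma IsSurfaceWave.measurable_kernelZ (hV : IsSurfaceWave W u₀ ν η τ V) :
    Measurable fun p : ℝ × ℝ × ℝ => kernelZ W u₀ ν η V p.1 p.2.1 p.2.2 := by
  have h1 : Measurable fun p : ℝ × ℝ × ℝ => p.1 := measurable_fst
  have h2 : Measurable fun p : ℝ × ℝ × ℝ => p.2.1 := measurable_snd.fst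
  have h3 : Measurable fun p : ℝ × ℝ × ℝ => p.2.2 := measurable_snd.snd
  unfold kernelZ
  refine Measurable.ite ?_ (((((hV.measurable_integralE h1 h2 h3).add
    (hV.measurable_integralE h2 h1 h3)).add (hV.measurable_integralE h3 h1 h2)).add
    (hV.measurable_integralD h1 h2 h3)).const_mul _) measurable_const
  have e : {p : ℝ × ℝ × ℝ | p.1 ≠ 0 ∧ p.2.1 ≠ 0 ∧ p.2.2 ≠ 0}
      = {p | p.1 = 0}ᶜ ∩ ({p | p.2.1 = 0}ᶜ ∩ {p | p.2.2 = 0}ᶜ) := rfl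
  rw [e]
  exact (measurableSet_eq_fun h1 measurable_const).compl.inter
    ((measurableSet_eq_fun h2 measurable_const).compl.inter
      (measurableSet_eq_fun h3 measurable_const).compl)

lemma lintegral_Ioi_mul {φ : ℝ → ℝ≥0∞} (hφ : Measurable φ) {a : ℝ} (ha : 0 < a) :
    ∫⁻ s in Ioi 0, φ (a * s) = ENNReal.ofReal a⁻¹ * ∫⁻ s in Ioi 0, φ s := by
  have e : ∀ s, (Ioi (0 : ℝ)).indicator (fun s => φ (a * s)) s
      = (Ioi (0 : ℝ)).indicator φ (a * s) := by
    intro s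
    by_cases hs : 0 < s
    · rw [indicator_of_mem (mem_Ioi.mpr hs), indicator_of_mem (mem_Ioi.mpr (mul_pos ha hs))]
    · rw [indicator_of_notMem (by simpa using hs), indicator_of_notMem (by
        rw [mem_Ioi, not_lt]
        exact mul_nonpos_of_nonneg_of_nonpos ha.le (not_lt.mp hs))]
  rw [← lintegral_indicator measurableSet_Ioi, ← lintegral_indicator measurableSet_Ioi]
  simp_rw [e]
  rw [← lintegral_map (μ := volume) (f := (Ioi (0 : ℝ)).indicator φ) (g := fun s : ℝ => a * s)
    (hφ.indicator measurableSet_Ioi) (by fun_prop), Real.map_volume_mul_left ha.ne',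
    lintegral_smul_measure, smul_eq_mul, abs_of_pos (inv_pos.mpr ha)]

/-- The integral of the product of three profile sizes, when the last one is bounded. -/
lemma lintegral_profileSize_le (hm : Measurable (profileSize V)) {H : ℝ≥0∞}
    (hH : ∀ s > 0, profileSize V s ≤ H) {x y z : ℝ} (hx : x ≠ 0) (hz : z ≠ 0)
    (hxy : |x| ≤ 2 * |y|) :
    ∫⁻ s in Ioi 0, profileSize V (|x| * s) * profileSize V (|y| * s) * profileSize V (|z| * s)
      ≤ ENNReal.ofReal (3 * |x|⁻¹) * (H * ∫⁻ s in Ioi 0, profileSize V s ^ 2) := by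
  have hx' : 0 < |x| := abs_pos.mpr hx
  have hy' : 0 < |y| := by linarith
  have hab : ∀ a b : ℝ≥0∞, a * b ≤ a ^ 2 + b ^ 2 := by
    intro a b
    rcases le_total a b with h | h
    · calc a * b ≤ b * b := by gcongr
        _ = b ^ 2 := (sq b).symm
        _ ≤ _ := le_add_self
    · calc a * b ≤ a * a := by gcongr
        _ = a ^ 2 := (sq a).symm
        _ ≤ _ := le_self_add
  calc _ ≤ ∫⁻ s in Ioi 0, (profileSize V (|x| * s) ^ 2 + profileSize V (|y| * s) ^ 2) * H := by
        refine setLIntegral_mono' measurableSet_Ioi fun s hs => ?_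
        gcongr
        · exact hab _ _
        · exact hH _ (mul_pos (abs_pos.mpr hz) hs)
    _ = (ENNReal.ofReal |x|⁻¹ * (∫⁻ s in Ioi 0, profileSize V s ^ 2)
        + ENNReal.ofReal |y|⁻¹ * ∫⁻ s in Ioi 0, profileSize V s ^ 2) * H := by
        rw [lintegral_mul_const _ (by fun_prop), lintegral_add_left (by fun_prop),
          lintegral_Ioi_mul (φ := fun s => profileSize V s ^ 2) (by fun_prop) hx',
          lintegral_Ioi_mul (φ := fun s => profileSize V s ^ 2) (by fun_prop) hy']
    _ = (ENNReal.ofReal |x|⁻¹ + ENNReal.ofReal |y|⁻¹)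
        * (H * ∫⁻ s in Ioi 0, profileSize V s ^ 2) := by ring
    _ ≤ _ := by
        gcongr
        rw [← ENNReal.ofReal_add (by positivity) (by positivity)]
        apply ENNReal.ofReal_le_ofReal
        have : |y|⁻¹ ≤ 2 * |x|⁻¹ := by
          rw [← div_eq_mul_inv, inv_le_comm₀ hy' (by positivity), inv_div]
          linarith
        linarith

/-- The integral of three profiles is `O(1/|x|)`, with the profile of frequency `z` bounded and the
other two in `L²`. The terms of `b₁` contain two gradients, hence products of two frequencies, at
most `5|x|²` in total because `|y| ≤ 2|x|`; the term of `b₂` contains three, at most `5|x|²|z|`.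
Dividing by `|x|` gives `|x|(1 + |z|)`. -/
lemma IsSurfaceWave.exists_kernel_bound (h3 : H3 W) (hν : ‖ν‖ = 1)
    (hV : IsSurfaceWave W u₀ ν η τ V) : ∃ C : ℝ, 0 ≤ C ∧ ∀ x y z : ℝ, x + y + z = 0 →
      |z| ≤ |x| → |z| ≤ |y| → ‖kernelZ W u₀ ν η V x y z‖ ≤ C * |x| * (1 + |z|) := by
  obtain ⟨H, hH, hsize, hL2⟩ := hV.exists_bound h3 hν
  have hm := hV.measurable_profileSize
  set CE := ∑ α, ∑ β, ∑ j, ∑ γ, ∑ l, ‖(coefE W u₀ α β j γ l : ℂ)‖ₑ with hCE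
  set CD := ∑ α, ∑ j, ∑ β, ∑ l, ∑ γ, ∑ m, ‖(coefD W u₀ α j β l γ m : ℂ)‖ₑ with hCD
  have hCEtop : CE ≠ ⊤ := by
    simp only [hCE, ne_eq, ENNReal.sum_eq_top, not_exists, not_and]
    exact fun _ _ _ _ _ _ _ _ _ _ => enorm_ne_top
  have hCDtop : CD ≠ ⊤ := by
    simp only [hCD, ne_eq, ENNReal.sum_eq_top, not_exists, not_and]
    exact fun _ _ _ _ _ _ _ _ _ _ _ _ => enorm_ne_top
  set P := ‖ν‖ₑ + ‖η‖ₑ with hP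
  have hPtop : P ≠ ⊤ := by finiteness
  set L := H * ∫⁻ s in Ioi 0, profileSize V s ^ 2 with hL
  have hLtop : L ≠ ⊤ := ENNReal.mul_ne_top hH hL2.ne
  set J := fun x y z : ℝ => ∫⁻ s in Ioi 0,
    profileSize V (|x| * s) * profileSize V (|y| * s) * profileSize V (|z| * s) with hJ
  have hE : ∀ x y z : ℝ, ‖integralE W u₀ ν η V x y z‖ₑ ≤
      CE * P ^ 2 * ENNReal.ofReal (|y| * |z|) * J x y z := by
    intro x y z
    refine (enorm_integral_le_lintegral_enorm _).trans ?_
    rw [hJ, ← lintegral_const_mul _ (by fun_prop)]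
    refine lintegral_mono fun s => ?_
    refine (enorm_formE_le W u₀ (fun α => enorm_profR_le x s α)
      (fun j α => enorm_profG_le y s j α) (fun j α => enorm_profG_le z s j α)).trans
      (le_of_eq ?_)
    rw [ENNReal.ofReal_mul (abs_nonneg y)]
    ring
  have hD : ∀ x y z : ℝ, ‖integralD W u₀ ν η V x y z‖ₑ ≤
      CD * P ^ 3 * ENNReal.ofReal (|x| * |y| * |z|) * J x y z := by
    intro x y z
    refine (enorm_integral_le_lintegral_enorm _).trans ?_
    rw [hJ, ← lintegral_const_mul _ (by fun_prop)]
    refine lintegral_mono fun s => ?_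
    refine (enorm_formD_le W u₀ (fun j α => enorm_profG_le x s j α)
      (fun j α => enorm_profG_le y s j α) (fun j α => enorm_profG_le z s j α)).trans
      (le_of_eq ?_)
    rw [ENNReal.ofReal_mul (by positivity), ENNReal.ofReal_mul (abs_nonneg x)]
    ring
  set K := ‖(4 * Real.pi : ℂ)⁻¹‖ₑ * ((CE * P ^ 2 + CD * P ^ 3) * L) with hK
  have hKtop : K ≠ ⊤ := by finiteness
  -- `15 = 5 · 3`: `5` from the products of frequencies, `3` from `|x|⁻¹ + |y|⁻¹ ≤ 3|x|⁻¹`.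
  refine ⟨K.toReal * 15, by positivity, fun x y z h0 hzx hzy => ?_⟩
  by_cases hne : x ≠ 0 ∧ y ≠ 0 ∧ z ≠ 0
  swap
  · rw [kernelZ, if_neg hne, norm_zero]
    positivity
  obtain ⟨hx, hy, hz⟩ := hne
  have hxy : |x| ≤ 2 * |y| := by
    have : |x| = |y + z| := by rw [← abs_neg x]; congr 1; linarith
    rw [this]
    linarith [abs_add_le y z]
  have hyx : |y| ≤ 2 * |x| := by
    have : |y| = |x + z| := by rw [← abs_neg y]; congr 1; linarith
    rw [this]
    linarith [abs_add_le x z]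
  have hJb : J x y z ≤ ENNReal.ofReal (3 * |x|⁻¹) * L :=
    lintegral_profileSize_le hm hsize hx hz hxy
  have hJ1 : J y x z = J x y z := by
    simp only [hJ]
    exact lintegral_congr fun s => by ring
  have hJ2 : J z x y = J x y z := by
    simp only [hJ]
    exact lintegral_congr fun s => by ring
  have hx0 := abs_nonneg x
  have hz0 := abs_nonneg z
  have hx' : 0 < |x| := abs_pos.mpr hx
  have main : ‖kernelZ W u₀ ν η V x y z‖ₑ ≤ ENNReal.ofReal (K.toReal * 15 * |x| * (1 + |z|)) := by
    rw [kernelZ, if_pos ⟨hx, hy, hz⟩, enorm_mul]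
    have hsum : |y| * |z| + |x| * |z| + |x| * |y| ≤ 5 * |x| ^ 2 := by
      have h1 : |y| * |z| ≤ 2 * |x| * |x| := by gcongr
      have h2 : |x| * |z| ≤ |x| * |x| := by gcongr
      have h3 : |x| * |y| ≤ |x| * (2 * |x|) := by gcongr
      nlinarith
    have hprod : |x| * |y| * |z| ≤ 5 * |x| ^ 2 * |z| := by
      have h3 : |x| * |y| ≤ |x| * (2 * |x|) := by gcongr
      have h4 : |x| * |y| ≤ 5 * |x| ^ 2 := by nlinarith
      gcongr
    calc _ ≤ ‖(4 * Real.pi : ℂ)⁻¹‖ₑ * (CE * P ^ 2 * ENNReal.ofReal (|y| * |z|) * J x y z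
          + CE * P ^ 2 * ENNReal.ofReal (|x| * |z|) * J y x z
          + CE * P ^ 2 * ENNReal.ofReal (|x| * |y|) * J z x y
          + CD * P ^ 3 * ENNReal.ofReal (|x| * |y| * |z|) * J x y z) := by
          gcongr
          refine (enorm_add_le _ _).trans (add_le_add ?_ (hD x y z))
          refine (enorm_add_le _ _).trans (add_le_add ?_ (hE z x y))
          exact (enorm_add_le _ _).trans (add_le_add (hE x y z) (hE y x z))
      _ = ‖(4 * Real.pi : ℂ)⁻¹‖ₑ * ((CE * P ^ 2 *
          ENNReal.ofReal (|y| * |z| + |x| * |z| + |x| * |y|)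
          + CD * P ^ 3 * ENNReal.ofReal (|x| * |y| * |z|)) * J x y z) := by
          rw [hJ1, hJ2, ENNReal.ofReal_add (by positivity) (by positivity),
            ENNReal.ofReal_add (by positivity) (by positivity)]
          ring
      _ ≤ ‖(4 * Real.pi : ℂ)⁻¹‖ₑ * ((CE * P ^ 2 * ENNReal.ofReal (5 * |x| ^ 2 * (1 + |z|))
          + CD * P ^ 3 * ENNReal.ofReal (5 * |x| ^ 2 * (1 + |z|)))
          * (ENNReal.ofReal (3 * |x|⁻¹) * L)) := by
          refine mul_le_mul_right (mul_le_mul' (add_le_add (mul_le_mul_right ?_ _)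
            (mul_le_mul_right ?_ _)) hJb) _
          · exact ENNReal.ofReal_le_ofReal
              (hsum.trans (le_mul_of_one_le_right (by positivity) (by linarith)))
          · exact ENNReal.ofReal_le_ofReal
              (hprod.trans (mul_le_mul_of_nonneg_left (by linarith) (by positivity)))
      _ = K * (ENNReal.ofReal (5 * |x| ^ 2 * (1 + |z|)) * ENNReal.ofReal (3 * |x|⁻¹)) := by
          rw [hK]
          ring
      _ = ENNReal.ofReal (K.toReal * 15 * |x| * (1 + |z|)) := by
          rw [← ENNReal.ofReal_mul (by positivity)]
          nth_rw 1 [← ENNReal.ofReal_toReal hKtop]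
          rw [← ENNReal.ofReal_mul (by positivity)]
          congr 1
          field_simp
          ring
  rw [← ofReal_norm] at main
  exact (ENNReal.ofReal_le_ofReal_iff (by positivity)).mp main

lemma IsSurfaceWave.exists_admissible (hW : ContDiff ℝ ∞ W) (h3 : H3 W) (hν : ‖ν‖ = 1)
    (hV : IsSurfaceWave W u₀ ν η τ V) : ∃ C : ℝ, AdmissibleKernel (kernelZ W u₀ ν η V) C := by
  obtain ⟨C, hC, hb⟩ := hV.exists_kernel_bound h3 hν
  exact ⟨C, hC, hV.measurable_kernelZ, kernelZ_swap12 hW, kernelZ_swap23 hW, kernelZ_neg, hb⟩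

end Kernel

/-! ### Irrelevance of the kernel at zero frequencies -/

section Congruence

variable {b b' : ℝ → ℝ → ℝ → ℂ} {c σ T : ℝ}

/-- For `k ≠ 0`, the line `m ↦ (-k, k-m, m)` meets the coordinate planes only at `m = 0` and `m =
k`, which the integral does not see. -/
lemma IsAmplitudeB.congr (h : ∀ x y z, x ≠ 0 → y ≠ 0 → z ≠ 0 → b x y z = b' x y z) {w g : L2R}
    (hg : IsAmplitudeB b c w g) : IsAmplitudeB b' c w g := by
  have hk0 : ∀ᵐ k : ℝ, k ≠ 0 := by simp [ae_iff]
  filter_upwards [hg, hk0] with k hk hk0'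
  have hm1 : ∀ᵐ m : ℝ, m ≠ k := by simp [ae_iff]
  have heq : (fun m : ℝ => b (-k) (k - m) m * hat w (k - m) * hat w m)
      =ᵐ[volume] fun m => b' (-k) (k - m) m * hat w (k - m) * hat w m := by
    filter_upwards [hk0, hm1] with m h0 h1
    rw [h _ _ _ (neg_ne_zero.mpr hk0') (sub_ne_zero.mpr h1.symm) h0]
  exact ⟨hk.1.congr heq, by rw [hk.2, integral_congr_ae heq]⟩

lemma IsSolution.congr (h : ∀ x y z, x ≠ 0 → y ≠ 0 → z ≠ 0 → b x y z = b' x y z) {w : ℝ → L2R}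
    (hw : IsSolution b c σ T w) : IsSolution b' c σ T w where
  mem := hw.mem
  cont := hw.cont
  eqn s hs := by
    obtain ⟨g, k, hg, hk⟩ := hw.eqn s hs
    exact ⟨g, k, hg.congr h, hk⟩

lemma LocallyWellPosed.congr (h : ∀ x y z, x ≠ 0 → y ≠ 0 → z ≠ 0 → b x y z = b' x y z)
    (hb : LocallyWellPosed b c σ) : LocallyWellPosed b' c σ where
  unique T hT v w hv hw := hb.unique T hT v w
    (hv.congr fun x y z hx hy hz => (h x y z hx hy hz).symm)
    (hw.congr fun x y z hx hy hz => (h x y z hx hy hz).symm)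
  exist R hR := by
    have h' : ∀ x y z, x ≠ 0 → y ≠ 0 → z ≠ 0 → b' x y z = b x y z :=
      fun x y z hx hy hz => (h x y z hx hy hz).symm
    obtain ⟨T, hT, hex, hdep⟩ := hb.exist R hR
    refine ⟨T, hT, fun w₀ hw₀ hR₀ => ?_, fun w hw hR₀ ε hε => ?_⟩
    · obtain ⟨w, hw, hw0⟩ := hex w₀ hw₀ hR₀
      exact ⟨w, hw.congr h, hw0⟩
    · obtain ⟨δ, hδ, hd⟩ := hdep w (hw.congr h') hR₀ ε hε
      exact ⟨δ, hδ, fun w' hw' => hd w' (hw'.congr h')⟩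

end Congruence

end SurfaceWave

end

theorem mainTheorem7 {n d : ℕ} (W : SurfaceWave.Jet n d → ℝ) (hW : ContDiff ℝ ∞ W)
    (h1 : SurfaceWave.H1 W) (h2 : SurfaceWave.H2 W) (h3 : SurfaceWave.H3 W)
    (ν η : EuclideanSpace ℝ (Fin d)) (hν : ‖ν‖ = 1)
    (u₀ : Fin n → ℝ) (hu₀ : SurfaceWave.NaturalBC W ν u₀)
    (τ : ℝ) (h4 : SurfaceWave.H4 W u₀ ν η τ)
    (V : ℝ → Fin n → ℂ) (hV : SurfaceWave.IsSurfaceWave W u₀ ν η τ V)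
    (hV0 : SurfaceWave.Nontriv V)
    (σ : ℝ) (hσ : 2 < σ) :
    SurfaceWave.LocallyWellPosed (SurfaceWave.kernelB W u₀ ν η V)
      (SurfaceWave.coefc τ V) σ := by
  obtain ⟨C, hC⟩ := hV.exists_admissible hW h3 hν
  exact (hC.locallyWellPosed hσ _).congr fun x y z hx hy hz => (hV.kernelB_eq hx hy hz).symm
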